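/- Let $p$ be an odd prime, let $k$ be an algebraically closed field of characteristic $p$, let $W(k)$ be its ring of Witt vectors with Frobenius $x\mapsto{}^Fx$, and let $K(k)=\operatorname{Frac}W(k)$. A Dieudonné module is a finitely generated torsion free $W(k)$-module with an ${}^F$-linear operator $F$ and an ${}^{F^{-1}}$-linear operator $V$ such that $FV=VF=p$. It is superspecial if $FM=VM$, and supersingular if its isocrystal $M\otimes\mathbb Q$ is isomorphic to that of a superspecial Dieudonné module. Let $M$ be a supersingular Dieudonné module of rank $8$ with a symmetric $W(k)$-bilinear pairing $\phi:M\times M\to W(k)$ satisfying $\phi(x,Fy)={}^F\phi(Vx,y)$. For a lattice $L\subset M\otimes\mathbb Q$ put $L^t=\{x\in M\otimes\mathbb Q:\phi(L,x)\subset W(k)\}$. Assume that $\phi$ is perfect, i.e. $M^t=M$, and that its crystalline discriminant is $1$: for a $K(k)$-basis $x_1,\dots,x_8$ of $M\otimes\mathbb Q$ with $Fx_1\wedge\dots\wedge Fx_8=p^4\,x_1\wedge\dots\wedge x_8$, the determinant $\det(\phi(x_i,x_j))$ is the square of an element of $K(\mathbb F_p)^\times$. Let $N=S^0(M)$ be the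 smallest superspecial Dieudonné lattice in $M\otimes\mathbb Q$ containing $M$, and $S_0(M)$ the biggest superspecial lattice contained in $M$. There is a decomposition $N=\bigoplus_{i=1}^4N_i$ into pairwise orthogonal Dieudonné modules of rank $2$, with $S_0(M)=N^t=\bigoplus_{i=1}^4F^{r_i}N_i$ for integers $r_1\le r_2\le r_3\le r_4$, where each $N_i$ has a $W(k)$-basis $x_i$, $y_i=Fx_i=Vx_i$ such that, for some integer $n_i$, either $\phi(x_i,x_i)=\phi(y_i,y_i)=0$ and $\phi(x_i,y_i)=p^{n_i}$, or $\phi(x_i,y_i)=0$, $\phi(x_i,x_i)=\epsilon_ip^{n_i}$ and $\phi(y_i,y_i)={}^F\epsilon_i\,p^{n_i+1}$ with $\epsilon_i\in W(\mathbb F_{p^2})^\times$. For every such decomposition, $(r_1,r_2,r_3,r_4)$ is one of (i) $(0,0,0,0)$, (ii) $(1,1,1,1)$, (iii) $(0,2,2,2)$, (iv) $(2,2,2,2)$. Moreover, there exists a superspecial Dieudonné lattice $Q\subset M\otimes\mathbb Q$ which contains $FM$ and satisfies (a) $Q^t=Q$, (b) $\dim_k(M/(M\cap Q))=\dim_k(Q/(M\cap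 Q))=1$. In the cases (iii) and (iv), the superspecial Dieudonné lattice $Q$ satisfying (a) and (b) is unique. -/

import Mathlib

open scoped Isocrystal

noncomputable section

namespace SymmDieudonne

/-! `k` is an algebraically closed field of characteristic `p`, `W(k) = WittVector p k`, and
`K(p, k)` is its field of fractions. A Dieudonné module is a finitely generated torsion free
`W(k)`-module `M` with operators `F`, `V`; equivalently it is a `W(k)`-lattice, stable under `F` and
`V = p F⁻¹`, in its isocrystal `M ⊗ ℚ`. We work with lattices in a fixed isocrystal `E`. -/

section

variable (p : ℕ) [Fact p.Prime] (k : Type*) [Field k] [IsAlgClosed k] [CharP k p]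
variable {E : Type*} [AddCommGroup E] [WittVector.Isocrystal p k E]

/-- The Frobenius `F` of the isocrystal `E`, as an automorphism of the additive group. -/
def frob : AddAut E := (WittVector.Isocrystal.frobenius p k (V := E)).toAddEquiv

/-- The Verschiebung `V = p F⁻¹` of the isocrystal `E`, so that `FV = VF = p`. -/
def ver (x : E) : E := (p : K(p, k)) • (frob p k (E := E)).symm x

/-- A pairing on an isocrystal: a bilinear form with `φ(x, F y) = ᶠφ(V x, y)`. -/
def IsPairing (φ : LinearMap.BilinForm K(p, k) E) : Prop :=
  ∀ x y : E, φ x (frob p k y) = WittVector.FractionRing.frobenius p k (φ (ver p k x) y)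

/-- The embedding of `K(𝔽_p)` into `K(k)`. -/
def baseEmb : K(p, ZMod p) →+* K(p, k) :=
  IsFractionRing.map (A := WittVector p (ZMod p)) (B := WittVector p k)
    (j := WittVector.map (ZMod.castHom (dvd_refl p) k))
    (WittVector.map_injective _ (ZMod.castHom (dvd_refl p) k).injective)

/-- The group `K(𝔽_p)ˣ / (K(𝔽_p)ˣ)²`. -/
abbrev SquareClass : Type :=
  (K(p, ZMod p))ˣ ⧸ (powMonoidHom 2 : (K(p, ZMod p))ˣ →* (K(p, ZMod p))ˣ).range

/-- `d` is the crystalline discriminant of the symmetric form `φ` on the isocrystal `E` of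
dimension `2n`: for a basis `x₁, …, x₂ₙ` with `Fx₁ ∧ … ∧ Fx₂ₙ = pⁿ x₁ ∧ … ∧ x₂ₙ`, the determinant of
the Gram matrix lies in `K(𝔽_p)ˣ` and has class `d`. -/
def IsCrisDisc (n : ℕ) (φ : LinearMap.BilinForm K(p, k) E) (d : SquareClass p) : Prop :=
  ∃ b : Module.Basis (Fin (2 * n)) K(p, k) E,
    b.det (fun i => frob p k (b i)) = (p : K(p, k)) ^ n ∧
    ∃ c : (K(p, ZMod p))ˣ, (QuotientGroup.mk c : SquareClass p) = d ∧
      (Matrix.of fun i j => φ (b i) (b j)).det = baseEmb p k c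

/-- The subring `W(𝔽_{p²})` of `W(k)`: the Witt vectors fixed by the square of Frobenius, that is,
those all of whose coefficients `a` satisfy `a ^ (p ^ 2) = a`. -/
def quadSubring : Subring (WittVector p k) :=
  RingHom.eqLocus ((WittVector.frobenius (p := p) (R := k)).comp WittVector.frobenius)
    (RingHom.id _)

variable [Module (WittVector p k) E] [IsScalarTower (WittVector p k) K(p, k) E]

theorem frob_smul (w : WittVector p k) (x : E) :
    frob p k (w • x) = (WittVector.frobeniusEquiv p k w) • frob p k x := by
  have h1 : w • x = algebraMap (WittVector p k) K(p, k) w • x := by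
    rw [algebraMap_smul]
  have h2 : frob p k (algebraMap (WittVector p k) K(p, k) w • x)
      = WittVector.FractionRing.frobenius p k (algebraMap (WittVector p k) K(p, k) w)
        • frob p k x :=
    (WittVector.Isocrystal.frobenius p k (V := E)).map_smulₛₗ _ _
  rw [h1, h2, WittVector.FractionRing.frobenius,
    IsFractionRing.ringEquivOfRingEquiv_algebraMap, algebraMap_smul]

theorem frob_zsmul_smul (r : ℤ) (w : WittVector p k) (x : E) :
    (r • frob p k (E := E)) (w • x)
      = ((WittVector.frobeniusEquiv p k : RingAut (WittVector p k)) ^ r) w •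
        (r • frob p k (E := E)) x := by
  have hinv : ∀ (w : WittVector p k) (x : E), (-frob p k (E := E)) (w • x)
      = ((WittVector.frobeniusEquiv p k : RingAut (WittVector p k))⁻¹) w •
        (-frob p k (E := E)) x := by
    intro w x
    apply (frob p k (E := E)).injective
    rw [frob_smul]
    change frob p k ((frob p k (E := E)).symm _) = (WittVector.frobeniusEquiv p k)
      ((WittVector.frobeniusEquiv p k).symm w) • frob p k ((frob p k (E := E)).symm x)
    rw [AddEquiv.apply_symm_apply, AddEquiv.apply_symm_apply, RingEquiv.apply_symm_apply]
  induction r using Int.induction_on generalizing w x with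
  | zero => simp
  | succ n ih =>
    rw [add_zsmul, one_zsmul, zpow_add_one, AddAut.add_apply, AddAut.add_apply, frob_smul, ih]
    rfl
  | pred n ih =>
    rw [sub_zsmul, one_zsmul, zpow_sub_one, AddAut.add_apply, AddAut.add_apply, hinv, ih]
    rfl

/-- The `W(k)`-submodule `F^r L`, for an integer `r`. The group `AddAut E` is written additively, so
`r • F` is the `r`-th power of `F` with respect to composition. -/
def frobPow (r : ℤ) (L : Submodule (WittVector p k) E) : Submodule (WittVector p k) E where
  carrier := (r • frob p k (E := E)) '' (L : Set E)
  add_mem' := by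
    rintro _ _ ⟨x, hx, rfl⟩ ⟨y, hy, rfl⟩
    exact ⟨x + y, L.add_mem hx hy, map_add _ x y⟩
  zero_mem' := ⟨0, L.zero_mem, map_zero _⟩
  smul_mem' := by
    rintro w _ ⟨x, hx, rfl⟩
    refine ⟨((WittVector.frobeniusEquiv p k : RingAut (WittVector p k)) ^ r).symm w • x,
      L.smul_mem _ hx, ?_⟩
    rw [frob_zsmul_smul, RingEquiv.apply_symm_apply]

/-- `L` is a Dieudonné lattice in `E`: a Dieudonné module whose isocrystal is `E`. -/
structure IsDieudonneLattice (L : Submodule (WittVector p k) E) : Prop where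
  fg : L.FG
  span_eq_top : Submodule.span K(p, k) (L : Set E) = ⊤
  frob_mem : ∀ x ∈ L, frob p k x ∈ L
  ver_mem : ∀ x ∈ L, ver p k x ∈ L

/-- A Dieudonné lattice is superspecial if `FL = VL`. -/
structure IsSuperspecial (L : Submodule (WittVector p k) E) : Prop
    extends IsDieudonneLattice p k L where
  frob_eq_ver : (frob p k (E := E)) '' (L : Set E) = (ver p k) '' (L : Set E)

variable (E) in
/-- `E` is the isocrystal of a superspecial Dieudonné module. A Dieudonné lattice `M` in `E` is
supersingular, i.e. isogenous to a superspecial Dieudonné module, if and only if this holds. -/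
def IsSupersingular : Prop := ∃ L : Submodule (WittVector p k) E, IsSuperspecial p k L

/-- `S⁰(M)`, the smallest superspecial lattice containing `M`. -/
def upperS (M : Submodule (WittVector p k) E) : Submodule (WittVector p k) E :=
  sInf {L | IsSuperspecial p k L ∧ M ≤ L}

/-- `S₀(M)`, the biggest superspecial lattice contained in `M`. -/
def lowerS (M : Submodule (WittVector p k) E) : Submodule (WittVector p k) E :=
  sSup {L | IsSuperspecial p k L ∧ L ≤ M}

/-- The dual `Lᵗ = {x ∈ E | φ(L, x) ⊆ W(k)}`. -/
def dual (φ : LinearMap.BilinForm K(p, k) E) (L : Submodule (WittVector p k) E) :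
    Submodule (WittVector p k) E where
  carrier := {x | ∀ y ∈ L, φ y x ∈ (algebraMap (WittVector p k) K(p, k)).range}
  add_mem' := by
    intro a b ha hb y hy
    rw [map_add]
    exact add_mem (ha y hy) (hb y hy)
  zero_mem' := by
    intro y _
    rw [map_zero]
    exact zero_mem _
  smul_mem' := by
    intro w x hx y hy
    rw [← algebraMap_smul K(p, k) w x, map_smul, smul_eq_mul]
    exact mul_mem ⟨w, rfl⟩ (hx y hy)

/-- `P` is a Dieudonné module of rank two with a `W(k)`-basis `x, y` such that `y = Fx = Vx` (hence
`Fy = Vy = px`), on which `φ` is given by one of the two normal forms: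
(i) `φ(x,x) = φ(y,y) = 0`, `φ(x,y) = pⁿ`;
(ii) `φ(x,y) = 0`, `φ(x,x) = ε pⁿ`, `φ(y,y) = ᶠε pⁿ⁺¹`,
with `n` an integer and `ε` a unit of `W(𝔽_{p²})`. -/
def IsNormalPlane (φ : LinearMap.BilinForm K(p, k) E) (P : Submodule (WittVector p k) E) : Prop :=
  ∃ x y : E, frob p k x = y ∧ ver p k x = y ∧
    LinearIndependent (WittVector p k) ![x, y] ∧
    Submodule.span (WittVector p k) {x, y} = P ∧
    ∃ n : ℤ,
      (φ x x = 0 ∧ φ y y = 0 ∧ φ x y = (p : K(p, k)) ^ n) ∨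
      (φ x y = 0 ∧ ∃ ε : (quadSubring p k)ˣ,
        φ x x = algebraMap (WittVector p k) K(p, k) (ε : quadSubring p k) * (p : K(p, k)) ^ n ∧
        φ y y = algebraMap (WittVector p k) K(p, k)
          (WittVector.frobenius ((ε : quadSubring p k) : WittVector p k)) *
            (p : K(p, k)) ^ (n + 1))

/-- `N = ⨁ Pᵢ` is an orthogonal direct sum of Dieudonné modules of rank two in normal form. -/
structure IsDiagonalization (φ : LinearMap.BilinForm K(p, k) E)
    (N : Submodule (WittVector p k) E) {m : ℕ} (P : Fin m → Submodule (WittVector p k) E) :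
    Prop where
  normal : ∀ i, IsNormalPlane p k φ (P i)
  orthogonal : ∀ i j, i ≠ j → ∀ x ∈ P i, ∀ y ∈ P j, φ x y = 0
  independent : iSupIndep P
  iSup_eq : ⨆ i, P i = N

/-- A choice, for `N = S⁰(M)`, of a decomposition `N = ⨁ Nᵢ` into four orthogonal Dieudonné modules
in normal form, together with integers `r₁ ≤ r₂ ≤ r₃ ≤ r₄` such that
`S₀(M) = Nᵗ = ⨁ F^{rᵢ} Nᵢ`. -/
structure HasType (φ : LinearMap.BilinForm K(p, k) E) (M : Submodule (WittVector p k) E)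
    (P : Fin 4 → Submodule (WittVector p k) E) (r : Fin 4 → ℤ) : Prop where
  diag : IsDiagonalization p k φ (upperS p k M) P
  mono : Monotone r
  lower_eq_dual : lowerS p k M = dual p k φ (upperS p k M)
  dual_eq : dual p k φ (upperS p k M) = ⨆ i, frobPow p k (r i) (P i)

/-- The relative length of `M` over `M ∩ Q`, i.e. the length of the `W(k)`-module `M / (M ∩ Q)`. When
this module is killed by `p`, the length is its dimension over `k`. -/
def colength (M Q : Submodule (WittVector p k) E) : ℕ∞ :=
  Module.length (WittVector p k) (M ⧸ (M ⊓ Q).submoduleOf M)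

/-- A superspecial lattice `Q` with `Qᵗ = Q` and
`dim M / (M ∩ Q) = dim Q / (M ∩ Q) = 1`. -/
structure IsSuperspecialNeighbour (φ : LinearMap.BilinForm K(p, k) E)
    (M Q : Submodule (WittVector p k) E) : Prop where
  superspecial : IsSuperspecial p k Q
  self_dual : dual p k φ Q = Q
  left : colength p k M Q = 1
  right : colength p k Q M = 1

end

end SymmDieudonne

end

/-! The proof runs on ψ = p⁻¹F², a σ²-linear bijection of the isocrystal: an F-stable lattice is
superspecial exactly when x and ψx always lie in it together. Lang's theorem, lifted from k to W(k)
by successive approximation (`span_fixed_eq_top_witt`), shows that such a lattice is spanned by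
ψ-fixed vectors. On these φ takes values fixed by σ², and a Gram–Schmidt argument using Hensel's
lemma and norms (`exists_normal_summand`, `exists_normal_family`) splits N = S⁰(M) into normal
planes. Duality exchanges the superspecial lattices inside M with those containing M, so S₀(M) = Nᵗ.
A `Frame` records coordinates for such a splitting, and `Frame.dual_lat` computes duals in it.

The types are bounded by reducing modulo p. The quotient N/FN is k⁴ with an 𝔽_{p²}-structure given
by the fixed vectors, and minimality of N says that the image of M lies in no rational hyperplane
(`Frame.nonrational_redImage`). Let U be the image of M in the coordinates where rᵢ is maximal. If
the maximum is 2s > 0, integrality of φ(M, FM) makes U isotropic for ∑ uᵢvᵢ^p. For s > 1,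
integrality of φ(M, F³M) makes U + U^(p²) isotropic as well; counting dimensions, U is then stable
under the p²-Frobenius, hence everything, which is absurd. So s = 1, at least three rᵢ equal 2, and
U is a line. If the maximum is 2s + 1, then U is isotropic for the quadratic form ∑ εᵢuᵢvᵢ over
𝔽_{p²}. For s > 0 so is U + U^(p²), which forces four coordinates. The discriminant hypothesis
(`Frame.disc`) makes this quaternary form split, and then U satisfies a rational equation
(`Nonrational.not_quaternary`). For s = 0 the discriminant excludes type (0,0,1,1)
(`Nonrational.not_binary`). It also makes ∑ rᵢ even, and only the four types remain.

For the last two types Q = ⨁ F^(rᵢ/2) Nᵢ is self-dual, and it is a neighbour because U is a line.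
For type (1,1,1,1), M is the preimage of a maximal isotropic subspace of a split quadratic space,
and Q is the preimage of a rational one meeting it in a line (`exists_rational_plane`). For type
(0,0,0,0), M = N and an explicit neighbour is written down.

Uniqueness (`Frame.neighbour_eq`): F is nilpotent on the simple module M/(M ∩ Q), so FM ⊆ Q. Since
F⁻¹Q is superspecial, FN ⊆ Q, and dually Q ⊆ F⁻¹Nᵗ. Integrality of φ(z, Fz) on Q then leaves only
one lattice. -/

set_option linter.unusedSectionVars false

noncomputable section

namespace SymmDieudonne

/-! ### Semilinear maps over an algebraically closed field -/

section Lang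

variable {k : Type*} [Field k] [IsAlgClosed k] {V : Type*} [AddCommGroup V] [Module k V]

/-- A combination ∑ cᵢΦⁱv is fixed as soon as c₀ = a₀t^q and cᵢ₊₁ = cᵢ^q + aᵢ₊₁t^q, where t is the
last coefficient. All cᵢ are thus polynomials in t, and one polynomial equation in t remains, for
which a nonzero root is needed. -/
theorem exists_nonzero_fixed_of_relation {q : ℕ} (hq : 1 < q) {n : ℕ} (a : ℕ → k)
    (ha : ∃ i < n, a i ≠ 0) (Φ : V →+ V) (hΦ : ∀ (c : k) (v : V), Φ (c • v) = c ^ q • Φ v)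
    (v : V) (hv : Φ^[n] v = ∑ i ∈ Finset.range n, a i • Φ^[i] v)
    (hli : ∀ c : ℕ → k, ∑ i ∈ Finset.range n, c i • Φ^[i] v = 0 → ∀ i < n, c i = 0) :
    ∃ w : V, w ≠ 0 ∧ Φ w = w := by
  classical
  -- the coefficients of a fixed vector, as polynomials in the last one
  let g : ℕ → Polynomial k := fun j => Nat.rec (Polynomial.C (a 0) * Polynomial.X ^ q)
    (fun i P => P ^ q + Polynomial.C (a (i + 1)) * Polynomial.X ^ q) j
  have hg0 : g 0 = Polynomial.C (a 0) * Polynomial.X ^ q := rfl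
  have hgs : ∀ i, g (i + 1) = g i ^ q + Polynomial.C (a (i + 1)) * Polynomial.X ^ q := fun _ => rfl
  obtain ⟨m, rfl⟩ : ∃ m, n = m + 1 := by
    obtain ⟨i, hi, -⟩ := ha
    exact ⟨n - 1, by omega⟩
  have hdvd : ∀ j, Polynomial.X ^ 2 ∣ g j := by
    intro j
    have hX : (Polynomial.X ^ 2 : Polynomial k) ∣ Polynomial.X ^ q := pow_dvd_pow _ hq
    induction j with
    | zero => rw [hg0]; exact Dvd.dvd.mul_left hX _
    | succ j ih =>
      rw [hgs]
      exact dvd_add (dvd_pow ih (by omega)) (Dvd.dvd.mul_left hX _)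
  -- The term g_j^q has larger degree than the new term in X^q, so nothing cancels: g_m vanishes
  -- only if all the aᵢ do.
  have hdeg : ∀ j, (g j = 0 ∧ ∀ i ≤ j, a i = 0) ∨ (∃ e, (g j).natDegree = q ^ (e + 1)) := by
    intro j
    induction j with
    | zero =>
      by_cases h0 : a 0 = 0
      · left; exact ⟨by simp [hg0, h0], by intro i hi; rwa [Nat.le_zero.1 hi]⟩
      · right; exact ⟨0, by rw [hg0, Polynomial.natDegree_C_mul_X_pow _ _ h0]; simp⟩
    | succ j ih =>
      rcases ih with ⟨h1, h2⟩ | ⟨e, he⟩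
      · by_cases h0 : a (j + 1) = 0
        · left
          refine ⟨by rw [hgs, h1, h0]; simp; omega, fun i hi => ?_⟩
          rcases Nat.lt_or_ge i (j + 1) with h | h
          · exact h2 i (by omega)
          · rwa [le_antisymm hi h]
        · right
          refine ⟨0, ?_⟩
          rw [hgs, h1, zero_pow (by omega), zero_add, Polynomial.natDegree_C_mul_X_pow _ _ h0]
          simp
      · right
        refine ⟨e + 1, ?_⟩
        have h3 : (g j ^ q).natDegree = q ^ (e + 1 + 1) := by
          rw [Polynomial.natDegree_pow, he]; ring
        rw [hgs, Polynomial.natDegree_add_eq_left_of_natDegree_lt, h3]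
        rw [h3]
        refine lt_of_le_of_lt (Polynomial.natDegree_C_mul_X_pow_le _ _) ?_
        calc q = q ^ 1 := (pow_one q).symm
          _ < q ^ (e + 1 + 1) := Nat.pow_lt_pow_right hq (by omega)
  obtain ⟨h, hh⟩ := hdvd m
  -- Writing g_m = X²h, the equation g_m(t) = t divided by t reads t·h(t) = 1, whose roots are
  -- automatically nonzero.
  have hroot : ∃ t : k, t ≠ 0 ∧ (g m).eval t = t := by
    have hne : (Polynomial.X * h - 1 : Polynomial k).degree ≠ 0 := by
      rcases hdeg m with ⟨h1, h2⟩ | ⟨e, he⟩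
      · obtain ⟨i, hi, hi'⟩ := ha
        exact absurd (h2 i (by omega)) hi'
      · have hh0 : h ≠ 0 := by
          rintro rfl
          rw [hh, mul_zero, Polynomial.natDegree_zero] at he
          exact (pow_pos (by omega : 0 < q) _).ne he
        have hd : (Polynomial.X * h - 1 : Polynomial k).natDegree ≠ 0 := by
          rw [Polynomial.natDegree_sub_eq_left_of_natDegree_lt, Polynomial.natDegree_X_mul hh0]
          · omega
          · rw [Polynomial.natDegree_X_mul hh0, Polynomial.natDegree_one]; omega
        intro h4
        exact hd (Polynomial.natDegree_eq_of_degree_eq_some h4)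
    obtain ⟨t, ht⟩ := IsAlgClosed.exists_root _ hne
    have ht' : t * h.eval t = 1 := by
      have := ht
      simp only [Polynomial.IsRoot, Polynomial.eval_sub, Polynomial.eval_mul, Polynomial.eval_X,
        Polynomial.eval_one] at this
      linear_combination this
    refine ⟨t, by rintro rfl; simp at ht', ?_⟩
    rw [hh, Polynomial.eval_mul, Polynomial.eval_pow, Polynomial.eval_X]
    linear_combination t * ht'
  obtain ⟨t, ht0, ht⟩ := hroot
  let c : ℕ → k := fun j => (g j).eval t
  have hc0 : c 0 = a 0 * t ^ q := by simp [c, hg0]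
  have hcs : ∀ i, c (i + 1) = c i ^ q + a (i + 1) * t ^ q := by intro i; simp [c, hgs]
  have hcm : c m = t := ht
  refine ⟨∑ i ∈ Finset.range (m + 1), c i • Φ^[i] v, ?_, ?_⟩
  · intro h0
    exact ht0 (hcm ▸ hli c h0 m (by omega))
  · rw [map_sum]
    simp only [hΦ, ← Function.iterate_succ_apply' Φ]
    rw [Finset.sum_range_succ, hcm, hv, Finset.smul_sum, Finset.sum_range_succ', 
      Finset.sum_range_succ' (fun i => c i • Φ^[i] v), ← add_assoc, ← Finset.sum_add_distrib, hc0]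
    congr 1
    · refine Finset.sum_congr rfl fun i _ => ?_
      rw [hcs, smul_smul, ← add_smul]
      congr 1; ring
    · rw [smul_smul]; congr 1; ring

/-- Cut the orbit of a nonzero vector at its first linear relation. Injectivity keeps Φⁿv nonzero,
so this relation has a nonzero coefficient. -/
theorem exists_nonzero_fixed [FiniteDimensional k V] [Nontrivial V] {q : ℕ} (hq : 1 < q)
    (Φ : V →+ V) (hΦ : ∀ (c : k) (v : V), Φ (c • v) = c ^ q • Φ v)
    (hinj : Function.Injective Φ) : ∃ w : V, w ≠ 0 ∧ Φ w = w := by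
  classical
  obtain ⟨v, hv⟩ := exists_ne (0 : V)
  let P : ℕ → Prop := fun n => ∃ a : ℕ → k, Φ^[n] v = ∑ i ∈ Finset.range n, a i • Φ^[i] v
  have hP : ∃ n, P n := by
    by_contra hcon
    push Not at hcon
    have hli : LinearIndependent k (fun i : ℕ => Φ^[i] v) := by
      rw [linearIndependent_iff']
      intro s
      induction s using Finset.induction_on_max with
      | empty => simp
      | insert n s hs ih =>
        intro g hg
        rw [Finset.sum_insert (fun h => lt_irrefl _ (hs n h))] at hg
        have hgn : g n = 0 := by
          by_contra hgn
          refine hcon n ⟨fun i => if i ∈ s then - (g n)⁻¹ * g i else 0, ?_⟩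
          have h1 : Φ^[n] v = - (g n)⁻¹ • ∑ i ∈ s, g i • Φ^[i] v := by
            rw [eq_neg_of_add_eq_zero_right hg, smul_neg, neg_smul, neg_neg, smul_smul,
              inv_mul_cancel₀ hgn, one_smul]
          rw [h1, Finset.smul_sum]
          simp only [ite_smul, zero_smul]
          rw [Finset.sum_ite_mem, Finset.inter_eq_right.2
            (fun i hi => Finset.mem_range.2 (hs i hi))]
          exact Finset.sum_congr rfl fun i _ => by rw [smul_smul]
        rw [hgn, zero_smul, zero_add] at hg
        intro i hi
        rcases Finset.mem_insert.1 hi with rfl | hi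
        · exact hgn
        · exact ih g hg i hi
    exact not_finite_iff_infinite.2 inferInstance hli.finite
  obtain ⟨a, ha⟩ := Nat.find_spec hP
  have hmin : ∀ m < Nat.find hP, ¬ P m := fun m hm => Nat.find_min hP hm
  have hne : Φ^[Nat.find hP] v ≠ 0 := by
    intro h0
    have h1 : (Φ^[Nat.find hP]) (0 : V) = 0 := by
      exact Function.iterate_fixed (map_zero Φ) _
    exact hv (hinj.iterate _ (h0.trans h1.symm))
  refine exists_nonzero_fixed_of_relation hq a ?_ Φ hΦ v ha ?_
  · by_contra hcon
    push Not at hcon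
    rw [ha] at hne
    exact hne (Finset.sum_eq_zero fun i hi => by rw [hcon i (Finset.mem_range.1 hi), zero_smul])
  · intro c hc
    by_contra hcon
    push Not at hcon
    -- Solving for the largest index with nonzero coefficient would give a relation of smaller
    -- length than the minimal one.
    let T := (Finset.range (Nat.find hP)).filter fun i => c i ≠ 0
    have hT : T.Nonempty := by
      obtain ⟨i, hi, hi'⟩ := hcon
      exact ⟨i, Finset.mem_filter.2 ⟨Finset.mem_range.2 hi, hi'⟩⟩
    have hm := Finset.mem_filter.1 (T.max'_mem hT)
    set m := T.max' hT
    refine hmin m (Finset.mem_range.1 hm.1) ⟨fun i => - (c m)⁻¹ * c i, ?_⟩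
    have h2 : ∑ i ∈ Finset.range (m + 1), c i • Φ^[i] v = 0 := by
      rw [← hc]
      refine Finset.sum_subset (fun i hi => ?_) (fun i hi hi' => ?_)
      · have := Finset.mem_range.1 hm.1
        have := Finset.mem_range.1 hi
        exact Finset.mem_range.2 (by omega)
      · by_contra h3
        have h4 : c i ≠ 0 := fun h => h3 (by rw [h, zero_smul])
        have h5 := T.le_max' i (Finset.mem_filter.2 ⟨hi, h4⟩)
        exact hi' (Finset.mem_range.2 (by omega))
    rw [Finset.sum_range_succ] at h2
    rw [← inv_smul_smul₀ hm.2 (Φ^[m] v), eq_neg_of_add_eq_zero_right h2, smul_neg,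
      Finset.smul_sum, ← Finset.sum_neg_distrib]
    exact Finset.sum_congr rfl fun i _ => by simp only [smul_smul, neg_mul, neg_smul]

theorem exists_pow_sub_self_eq {q : ℕ} (hq : 1 < q) (a : k) : ∃ c : k, c ^ q - c = a := by
  have hd : (Polynomial.X ^ q - Polynomial.X - Polynomial.C a : Polynomial k).natDegree = q := by
    rw [sub_sub]
    rw [Polynomial.natDegree_sub_eq_left_of_natDegree_lt, Polynomial.natDegree_X_pow]
    rw [Polynomial.natDegree_X_pow, Polynomial.natDegree_X_add_C]
    exact hq
  obtain ⟨c, hc⟩ := IsAlgClosed.exists_root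
    (Polynomial.X ^ q - Polynomial.X - Polynomial.C a : Polynomial k) (by
      intro h
      have := Polynomial.natDegree_eq_zero_iff_degree_le_zero.2 h.le
      omega)
  refine ⟨c, ?_⟩
  simp only [Polynomial.IsRoot, Polynomial.eval_sub, Polynomial.eval_pow, Polynomial.eval_X,
    Polynomial.eval_C] at hc
  linear_combination hc

/-- On multiples of a fixed vector Φ − 1 acts through c ↦ c^q − c, which is surjective by
Artin–Schreier. -/
theorem fixed_sub_surjective_of_span {q : ℕ} (hq : 1 < q) (Φ : V →+ V)
    (hΦ : ∀ (c : k) (v : V), Φ (c • v) = c ^ q • Φ v) {x : V}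
    (hx : x ∈ Submodule.span k {v | Φ v = v}) :
    ∃ y ∈ Submodule.span k {v | Φ v = v}, Φ y - y = x := by
  -- Φ − 1 is only additive, so the induction has to carry every scalar multiple of x.
  suffices h : ∀ a : k, ∃ y ∈ Submodule.span k {v | Φ v = v}, Φ y - y = a • x by
    simpa using h 1
  induction hx using Submodule.span_induction with
  | mem v hv =>
    intro a
    obtain ⟨c, hc⟩ := exists_pow_sub_self_eq hq a
    refine ⟨c • v, Submodule.smul_mem _ _ (Submodule.subset_span hv), ?_⟩
    rw [hΦ, show Φ v = v from hv, ← sub_smul, hc]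
  | zero => exact fun a => ⟨0, Submodule.zero_mem _, by simp⟩
  | add u v _ _ hu hv =>
    intro a
    obtain ⟨y, hy, hy'⟩ := hu a
    obtain ⟨z, hz, hz'⟩ := hv a
    exact ⟨y + z, Submodule.add_mem _ hy hz, by rw [map_add, smul_add, ← hy', ← hz']; abel⟩
  | smul b v _ hv =>
    intro a
    rw [smul_smul]; exact hv (a * b)

/-- Lang's theorem. Were the span S proper, Φ would fix a nonzero class in V/S; since Φ − 1 is
surjective on S, a lift of that class can be corrected to a fixed vector outside S. -/
theorem span_fixed_eq_top [FiniteDimensional k V] {q : ℕ} (hq : 1 < q)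
    (Φ : V →+ V) (hΦ : ∀ (c : k) (v : V), Φ (c • v) = c ^ q • Φ v)
    (hinj : Function.Injective Φ) : Submodule.span k {v | Φ v = v} = ⊤ := by
  set S := Submodule.span k {v | Φ v = v} with hS
  by_contra hne
  have hΦS : ∀ x ∈ S, Φ x ∈ S := by
    intro x hx
    induction hx using Submodule.span_induction with
    | mem v hv => rw [show Φ v = v from hv]; exact Submodule.subset_span hv
    | zero => rw [map_zero]; exact S.zero_mem
    | add a b _ _ iha ihb => rw [map_add]; exact S.add_mem iha ihb
    | smul a v _ ih => rw [hΦ]; exact S.smul_mem _ ih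
  -- Φ maps S onto S because scalars have q-th roots; together with injectivity this makes the
  -- induced map on V/S injective.
  have hpre : ∀ x, Φ x ∈ S → x ∈ S := by
    have hspan : ∀ x ∈ S, ∃ y ∈ S, Φ y = x := by
      intro x hx
      induction hx using Submodule.span_induction with
      | mem v hv => exact ⟨v, Submodule.subset_span hv, hv⟩
      | zero => exact ⟨0, S.zero_mem, map_zero _⟩
      | add a b _ _ ha hb =>
        obtain ⟨y, hy, rfl⟩ := ha
        obtain ⟨z, hz, rfl⟩ := hb
        exact ⟨y + z, S.add_mem hy hz, map_add _ _ _⟩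
      | smul a v _ hv =>
        obtain ⟨y, hy, rfl⟩ := hv
        obtain ⟨c, hc⟩ := IsAlgClosed.exists_pow_nat_eq a (by omega : 0 < q)
        exact ⟨c • y, S.smul_mem _ hy, by rw [hΦ, hc]⟩
    intro x hx
    obtain ⟨y, hy, hyx⟩ := hspan _ hx
    rwa [← hinj hyx]
  let Ψ : (V ⧸ S) →+ (V ⧸ S) := QuotientAddGroup.map S.toAddSubgroup S.toAddSubgroup Φ
    (fun x hx => hΦS x hx)
  have hΨ : ∀ v : V, Ψ (Submodule.Quotient.mk v) = Submodule.Quotient.mk (Φ v) := fun _ => rfl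
  have : Nontrivial (V ⧸ S) := Submodule.Quotient.nontrivial_iff.2 hne
  obtain ⟨w, hw0, hw⟩ := exists_nonzero_fixed (k := k) hq Ψ (by
      intro c v
      obtain ⟨v, rfl⟩ := Submodule.Quotient.mk_surjective S v
      rw [← Submodule.Quotient.mk_smul, hΨ, hΨ, hΦ, Submodule.Quotient.mk_smul]) (by
      rw [injective_iff_map_eq_zero]
      intro v hv
      obtain ⟨v, rfl⟩ := Submodule.Quotient.mk_surjective S v
      rw [hΨ, Submodule.Quotient.mk_eq_zero] at hv
      rw [Submodule.Quotient.mk_eq_zero]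
      exact hpre v hv)
  obtain ⟨v, rfl⟩ := Submodule.Quotient.mk_surjective S w
  rw [hΨ, Submodule.Quotient.eq] at hw
  obtain ⟨s, hs, hs'⟩ := fixed_sub_surjective_of_span hq Φ hΦ hw
  refine hw0 ((Submodule.Quotient.mk_eq_zero S).2 ?_)
  have hfix : v - s ∈ S := Submodule.subset_span (by
    change Φ (v - s) = v - s
    rw [map_sub, ← sub_eq_zero,
      show Φ v - Φ s - (v - s) = (Φ v - v) - (Φ s - s) by abel, hs', sub_self])
  have := S.add_mem hfix hs
  rwa [sub_add_cancel] at this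

theorem fixed_sub_surjective [FiniteDimensional k V] {q : ℕ} (hq : 1 < q)
    (Φ : V →+ V) (hΦ : ∀ (c : k) (v : V), Φ (c • v) = c ^ q • Φ v)
    (hinj : Function.Injective Φ) (x : V) : ∃ y, Φ y - y = x := by
  obtain ⟨y, -, hy⟩ := fixed_sub_surjective_of_span hq Φ hΦ
    (x := x) (by rw [span_fixed_eq_top hq Φ hΦ hinj]; trivial)
  exact ⟨y, hy⟩

end Lang

end SymmDieudonne

namespace SymmDieudonne

/-! ### Semilinear maps over Witt vectors -/

section WittLang

variable {p : ℕ} [Fact p.Prime] {k : Type*} [Field k] [IsAlgClosed k] [CharP k p]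

theorem coeff_zero_eq_zero_iff (w : WittVector p k) :
    WittVector.constantCoeff w = 0 ↔ ∃ v : WittVector p k, w = p * v := by
  rw [← RingHom.mem_ker, WittVector.ker_constantCoeff, Ideal.mem_span_singleton]
  rfl

theorem isUnit_of_constantCoeff_ne_zero {w : WittVector p k}
    (h : WittVector.constantCoeff w ≠ 0) : IsUnit w :=
  WittVector.isUnit_of_coeff_zero_ne_zero w h

theorem constantCoeff_frobenius (w : WittVector p k) :
    WittVector.constantCoeff (WittVector.frobenius w) = WittVector.constantCoeff w ^ p :=
  WittVector.coeff_frobenius_charP p w 0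

theorem eq_zero_of_forall_dvd {w : WittVector p k} (h : ∀ n : ℕ, (p : WittVector p k) ^ n ∣ w) :
    w = 0 := by
  ext n
  rw [WittVector.zero_coeff]
  have h1 := (WittVector.mem_span_p_pow_iff_le_coeff_eq_zero w (n + 1)).1
    (Ideal.mem_span_singleton.2 (h (n + 1)))
  exact h1 n (Nat.lt_succ_self n)

theorem exists_limit (x : ℕ → WittVector p k)
    (h : ∀ n, (p : WittVector p k) ^ n ∣ x (n + 1) - x n) :
    ∃ l : WittVector p k, ∀ n, (p : WittVector p k) ^ n ∣ l - x n := by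
  have h2 : ∀ m n, m ≤ n → (p : WittVector p k) ^ m ∣ x n - x m := by
    intro m n hmn
    induction n, hmn using Nat.le_induction with
    | base => simp
    | succ n hmn ih =>
      have := dvd_add ((pow_dvd_pow _ hmn).trans (h n)) ih
      simpa using this
  obtain ⟨l, hl⟩ := IsPrecomplete.prec' (I := Ideal.span {(p : WittVector p k)}) x (by
    intro m n hmn
    rw [SModEq.sub_mem, smul_eq_mul, Ideal.mul_top, Ideal.span_singleton_pow,
      Ideal.mem_span_singleton, ← neg_sub, dvd_neg]
    exact h2 m n hmn)
  refine ⟨l, fun n => ?_⟩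
  have := hl n
  rwa [SModEq.sub_mem, smul_eq_mul, Ideal.mul_top, Ideal.span_singleton_pow,
      Ideal.mem_span_singleton, ← neg_sub, dvd_neg] at this

/-- Additive maps commute with multiplication by p, so solutions modulo p can be improved to
solutions modulo every pⁿ, and these converge p-adically. -/
theorem surjective_of_surjective_mod_p {ι : Type*} [Finite ι]
    (G : (ι → WittVector p k) →+ (ι → WittVector p k))
    (hG : ∀ x, ∃ y z, x = G y + (p : WittVector p k) • z) : Function.Surjective G := by
  have hGp : ∀ (n : ℕ) (x : ι → WittVector p k),
      G ((p : WittVector p k) ^ n • x) = (p : WittVector p k) ^ n • G x := by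
    intro n x
    have h := map_nsmul G (p ^ n) x
    rw [← Nat.cast_smul_eq_nsmul (WittVector p k), ← Nat.cast_smul_eq_nsmul (WittVector p k),
      Nat.cast_pow] at h
    exact h
  choose f g hfg using hG
  intro x
  let r : ℕ → (ι → WittVector p k) := fun n => g^[n] x
  have hr : ∀ n, r n = G (f (r n)) + (p : WittVector p k) • r (n + 1) := by
    intro n
    have := hfg (r n)
    rwa [show g (r n) = r (n + 1) from (Function.iterate_succ_apply' g n x).symm] at this
  let X : ℕ → (ι → WittVector p k) :=
    fun n => ∑ i ∈ Finset.range n, (p : WittVector p k) ^ i • f (r i)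
  have hX : ∀ n, x = G (X n) + (p : WittVector p k) ^ n • r n := by
    intro n
    induction n with
    | zero => simp [X, r]
    | succ n ih =>
      have h1 : X (n + 1) = X n + (p : WittVector p k) ^ n • f (r n) := Finset.sum_range_succ _ _
      rw [h1, map_add, hGp, add_assoc]
      have h2 := hr n
      rw [pow_succ, mul_smul, ← smul_add, ← h2]
      exact ih
  have hl : ∀ i, ∃ l : WittVector p k, ∀ n, (p : WittVector p k) ^ n ∣ l - X n i := by
    intro i
    refine exists_limit _ fun n => ?_
    rw [show X (n + 1) = X n + (p : WittVector p k) ^ n • f (r n) from Finset.sum_range_succ _ _]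
    simp
  choose l hl using hl
  choose e he using hl
  refine ⟨l, ?_⟩
  have h3 : ∀ n, l = X n + (p : WittVector p k) ^ n • (fun i => e i n) := by
    intro n
    ext1 i
    rw [Pi.add_apply, Pi.smul_apply, smul_eq_mul, ← he]
    ring
  rw [← sub_eq_zero]
  ext1 i
  refine eq_zero_of_forall_dvd fun n => ⟨(G (fun i => e i n)) i - r n i, ?_⟩
  have h4 : G l - x = (p : WittVector p k) ^ n • (G (fun i => e i n) - r n) := by
    conv_lhs => rw [h3 n, hX n, map_add, hGp]
    rw [smul_sub]; abel
  rw [h4]; rfl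

/-- Lang's theorem for the reduction, which is semilinear for c ↦ c^(p²), gives both a spanning set
of fixed vectors and the surjectivity of T − 1. The latter lifts the fixed vectors to W(k), and
Nakayama's lemma concludes. -/
theorem span_fixed_eq_top_witt {ι : Type*} [Fintype ι]
    (T : (ι → WittVector p k) →+ (ι → WittVector p k))
    (hT : ∀ (a : WittVector p k) v,
      T (a • v) = WittVector.frobenius (WittVector.frobenius a) • T v)
    (hbij : Function.Bijective T) :
    Submodule.span (WittVector p k) {v | T v = v} = ⊤ := by
  have hp1 : 1 < p ^ 2 := Nat.one_lt_pow (by norm_num) (Fact.out : p.Prime).one_lt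
  let red : (ι → WittVector p k) →+ (ι → k) :=
    { toFun := fun v i => WittVector.constantCoeff (v i)
      map_zero' := by ext i; simp
      map_add' := fun u v => by ext i; exact map_add WittVector.constantCoeff _ _ }
  have hred : ∀ v, red v = 0 ↔ ∃ w, v = (p : WittVector p k) • w := by
    intro v
    constructor
    · intro h
      have h1 : ∀ i, ∃ w : WittVector p k, v i = p * w :=
        fun i => (coeff_zero_eq_zero_iff _).1 (congrFun h i)
      choose w hw using h1
      exact ⟨w, funext hw⟩
    · rintro ⟨w, rfl⟩
      ext i
      exact (coeff_zero_eq_zero_iff _).2 ⟨w i, rfl⟩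
  have hTp : ∀ v, T ((p : WittVector p k) • v) = (p : WittVector p k) • T v := by
    intro v; rw [hT, map_natCast, map_natCast]
  have hredsmul : ∀ (a : WittVector p k) v, red (a • v) = WittVector.constantCoeff a • red v := by
    intro a v; ext i; exact map_mul (WittVector.constantCoeff (p := p) (R := k)) _ _
  let s : (ι → k) → (ι → WittVector p k) := fun u i => WittVector.teichmuller p (u i)
  have hs : Function.RightInverse s red := by
    intro u; ext i; exact WittVector.teichmuller_coeff_zero p (u i)
  -- The reduction of T modulo p, computed on Teichmüller lifts; it is well defined because T
  -- preserves multiples of p.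
  let Φ : (ι → k) →+ (ι → k) := AddMonoidHom.liftOfRightInverse red s hs
    ⟨red.comp T, by
      intro v hv
      obtain ⟨w, rfl⟩ := (hred v).1 hv
      change red (T _) = 0
      rw [hTp]
      exact (hred _).2 ⟨_, rfl⟩⟩
  have hΦr : ∀ v, Φ (red v) = red (T v) := fun v =>
    AddMonoidHom.liftOfRightInverse_comp_apply red s hs _ v
  have hΦ : ∀ (c : k) u, Φ (c • u) = c ^ (p ^ 2) • Φ u := by
    intro c u
    obtain ⟨v, rfl⟩ := hs.surjective u
    obtain ⟨c, rfl⟩ := WittVector.constantCoeff_surjective p c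
    rw [← hredsmul, hΦr, hΦr, hT, hredsmul, constantCoeff_frobenius, constantCoeff_frobenius,
      ← pow_mul, sq]
  have hinj : Function.Injective Φ := by
    rw [injective_iff_map_eq_zero]
    intro u hu
    obtain ⟨v, rfl⟩ := hs.surjective u
    rw [hΦr, hred] at hu
    obtain ⟨w, hw⟩ := hu
    obtain ⟨v', rfl⟩ := hbij.2 w
    rw [← hTp] at hw
    rw [hbij.1 hw]
    exact (hred _).2 ⟨_, rfl⟩
  have hsurj : Function.Surjective (T - AddMonoidHom.id (ι → WittVector p k)) := by
    apply surjective_of_surjective_mod_p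
    intro x
    obtain ⟨u, hu⟩ := fixed_sub_surjective hp1 Φ hΦ hinj (red x)
    obtain ⟨v, rfl⟩ := hs.surjective u
    rw [hΦr, ← map_sub] at hu
    obtain ⟨z, hz⟩ := (hred (x - (T v - v))).1 (by rw [map_sub, hu, sub_self])
    exact ⟨v, z, by rw [← hz]; simp⟩
  have hlift : ∀ u, Φ u = u → ∃ v, T v = v ∧ red v = u := by
    intro u hu
    obtain ⟨v, rfl⟩ := hs.surjective u
    rw [hΦr, ← sub_eq_zero, ← map_sub] at hu
    obtain ⟨w, hw⟩ := (hred _).1 hu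
    -- If Tv − v = pw, then v + py is fixed as soon as Ty − y = −w.
    obtain ⟨y, hy⟩ := hsurj (-w)
    have hy' : T y - y = -w := hy
    refine ⟨v + (p : WittVector p k) • y, ?_, ?_⟩
    · rw [map_add, hTp, ← sub_eq_zero, show T v + (p : WittVector p k) • T y -
        (v + (p : WittVector p k) • y) = (T v - v) + (p : WittVector p k) • (T y - y) by
          rw [smul_sub]; abel, hw, hy', smul_neg, add_neg_cancel]
    · rw [map_add, (hred ((p : WittVector p k) • y)).2 ⟨_, rfl⟩, add_zero]
  set S := Submodule.span (WittVector p k) {v | T v = v} with hS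
  have hSred : ∀ u, ∃ v ∈ S, red v = u := by
    intro u
    have hu : u ∈ Submodule.span k {u | Φ u = u} := by
      rw [span_fixed_eq_top hp1 Φ hΦ hinj]; trivial
    induction hu using Submodule.span_induction with
    | mem u hu =>
      obtain ⟨v, hv, hv'⟩ := hlift u hu
      exact ⟨v, Submodule.subset_span hv, hv'⟩
    | zero => exact ⟨0, S.zero_mem, map_zero _⟩
    | add a b _ _ ha hb =>
      obtain ⟨y, hy, rfl⟩ := ha
      obtain ⟨z, hz, rfl⟩ := hb
      exact ⟨y + z, S.add_mem hy hz, map_add _ _ _⟩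
    | smul c u _ hu =>
      obtain ⟨y, hy, rfl⟩ := hu
      obtain ⟨c, rfl⟩ := WittVector.constantCoeff_surjective p c
      exact ⟨c • y, S.smul_mem _ hy, hredsmul _ _⟩
  refine top_le_iff.1 (Submodule.le_of_le_smul_of_le_jacobson_bot
    (I := Ideal.span {(p : WittVector p k)}) (Module.finite_def.1 inferInstance) ?_ ?_)
  · rw [IsLocalRing.jacobson_eq_maximalIdeal _ bot_ne_top, Ideal.span_singleton_le_iff_mem,
      IsLocalRing.mem_maximalIdeal]
    exact (WittVector.irreducible p).not_isUnit
  · intro v _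
    obtain ⟨w, hw, hw'⟩ := hSred (red v)
    obtain ⟨z, hz⟩ := (hred (v - w)).1 (by rw [map_sub, hw', sub_self])
    rw [← sub_add_cancel v w, hz, add_comm]
    exact Submodule.add_mem_sup hw
      (Submodule.smul_mem_smul (Ideal.mem_span_singleton_self _) trivial)

/-! ### Equations over Witt vectors -/

/-- Hensel's lemma by iteration: c ↦ −B⁻¹(A + pCc²) is a p-adic contraction because of the factor p.
-/
theorem exists_quadratic_root (A B C : WittVector p k) (hB : WittVector.constantCoeff B ≠ 0) :
    ∃ c : WittVector p k, A + B * c + p * C * c ^ 2 = 0 := by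
  obtain ⟨b, hb⟩ := (isUnit_of_constantCoeff_ne_zero hB).exists_right_inv
  let f : WittVector p k → WittVector p k := fun c => - b * (A + p * C * c ^ 2)
  have hf : ∀ (n : ℕ) (c d : WittVector p k), (p : WittVector p k) ^ n ∣ c - d →
      (p : WittVector p k) ^ (n + 1) ∣ f c - f d := by
    rintro n c d ⟨e, he⟩
    exact ⟨- b * C * (c + d) * e, by
      simp only [f]; rw [pow_succ]; linear_combination (- b * p * C * (c + d)) * he⟩
  have hx : ∀ n : ℕ, (p : WittVector p k) ^ n ∣ f^[n + 1] 0 - f^[n] 0 := by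
    intro n
    induction n with
    | zero => simp
    | succ n ih =>
      rw [Function.iterate_succ_apply'] at ih
      rw [Function.iterate_succ_apply', Function.iterate_succ_apply' f n]
      exact hf n _ _ ih
  obtain ⟨l, hl⟩ := exists_limit (fun n => f^[n] 0) hx
  have h1 : f l - l = 0 := by
    refine eq_zero_of_forall_dvd fun n => ?_
    have h2 := (pow_dvd_pow _ (Nat.le_succ n)).trans (hf n _ _ (hl n))
    have h3 := dvd_sub ((pow_dvd_pow _ (Nat.le_succ n)).trans (hl (n + 1))) h2
    rw [← dvd_neg]
    convert h3 using 1
    rw [Function.iterate_succ_apply']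
    ring
  refine ⟨l, ?_⟩
  have h4 : - b * (A + p * C * l ^ 2) - l = 0 := h1
  linear_combination (-B) * h4 - (A + p * C * l ^ 2) * hb

theorem quadratic_root_unique {A B C c d : WittVector p k} (hB : WittVector.constantCoeff B ≠ 0)
    (hc : A + B * c + p * C * c ^ 2 = 0) (hd : A + B * d + p * C * d ^ 2 = 0) : c = d := by
  have h : (B + p * (C * (c + d))) * (c - d) = 0 := by linear_combination hc - hd
  rcases mul_eq_zero.1 h with h | h
  · refine absurd ?_ hB
    have := congrArg WittVector.constantCoeff h
    rwa [map_add, (coeff_zero_eq_zero_iff ((p : WittVector p k) * (C * (c + d)))).2 ⟨_, rfl⟩, add_zero,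
      map_zero] at this
  · exact sub_eq_zero.1 h

theorem two_ne_zero_of_odd (hp : p ≠ 2) : (2 : k) ≠ 0 := by
  have h : ((2 : ℕ) : k) ≠ 0 := by
    rw [Ne, CharP.cast_eq_zero_iff k p]
    intro h
    exact hp ((Nat.prime_dvd_prime_iff_eq Fact.out Nat.prime_two).1 h)
  exact_mod_cast h

/-- The norm from `W(𝔽_{p²})` to `W(𝔽_p)` is surjective on units. -/
theorem exists_norm_eq (hp : p ≠ 2) (w : WittVector p k) (hw : WittVector.constantCoeff w ≠ 0)
    (hfix : WittVector.frobenius w = w) :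
    ∃ u : WittVector p k, u * WittVector.frobenius u = w := by
  have hp0 : 0 < p := (Fact.out : p.Prime).pos
  set c := WittVector.constantCoeff w with hc
  have hcp : c ^ p = c := by
    rw [hc, ← constantCoeff_frobenius, hfix]
  -- The Teichmüller lift of t has norm [t · t^p] = [c], so the problem is reduced to a unit
  -- congruent to 1.
  obtain ⟨t, ht⟩ := IsAlgClosed.exists_pow_nat_eq c (by omega : 0 < p + 1)
  have ht0 : t ≠ 0 := by rintro rfl; rw [zero_pow (by omega)] at ht; exact hw ht.symm
  set τ := WittVector.teichmuller p t
  have hτ : WittVector.frobenius τ = WittVector.teichmuller p (t ^ p) := by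
    rw [WittVector.frobenius_eq_map_frobenius, WittVector.map_teichmuller]; rfl
  have hττ : τ * WittVector.frobenius τ = WittVector.teichmuller p c := by
    rw [hτ, ← map_mul, ← ht, pow_succ, mul_comm]
  have hcfix : WittVector.frobenius (WittVector.teichmuller p c) = WittVector.teichmuller p c := by
    rw [WittVector.frobenius_eq_map_frobenius, WittVector.map_teichmuller]
    exact congrArg _ hcp
  have hcu : WittVector.constantCoeff (WittVector.teichmuller p c) = c :=
    WittVector.teichmuller_coeff_zero p c
  obtain ⟨v, hv⟩ := (isUnit_of_constantCoeff_ne_zero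
    (w := WittVector.teichmuller p c) (by rw [hcu]; exact hw)).exists_right_inv
  have hvfix : WittVector.frobenius v = v := by
    have h := congrArg WittVector.frobenius hv
    rw [map_mul, hcfix, map_one] at h
    linear_combination (WittVector.frobenius v) * (-hv) + v * h
  obtain ⟨e, he⟩ := (coeff_zero_eq_zero_iff (w * v - 1)).1 (by
    have h := congrArg WittVector.constantCoeff hv
    rw [map_mul, hcu, map_one] at h
    rw [map_sub, map_mul, map_one, ← hc, h, sub_self])
  have hp0' : (p : WittVector p k) ≠ 0 := WittVector.p_nonzero p k
  have hefix : WittVector.frobenius e = e := by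
    apply mul_left_cancel₀ hp0'
    rw [← he]
    have h := congrArg WittVector.frobenius he
    rw [map_mul, map_sub, map_mul, hfix, hvfix, map_one, map_natCast] at h
    exact h.symm
  have h2 : WittVector.constantCoeff (2 : WittVector p k) ≠ 0 := by
    rw [map_ofNat]; exact two_ne_zero_of_odd hp
  -- The equation 2s + ps² = e says (1 + ps)² = 1 + pe. Uniqueness of the root makes s invariant
  -- under Frobenius, so this square is the norm of 1 + ps.
  obtain ⟨s, hs⟩ := exists_quadratic_root (-e) 2 1 h2
  have hsfix : WittVector.frobenius s = s := by
    refine quadratic_root_unique (A := -e) (C := 1) h2 ?_ hs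
    have h := congrArg WittVector.frobenius hs
    simpa only [map_add, map_mul, map_neg, hefix, map_natCast, map_ofNat, map_one, map_pow,
      map_zero] using h
  refine ⟨τ * (1 + p * s), ?_⟩
  rw [map_mul, map_add, map_mul, hsfix, map_one, map_natCast]
  linear_combination (1 + p * s) ^ 2 * hττ + WittVector.teichmuller p c * (p * hs) -
    WittVector.teichmuller p c * he + w * hv

end WittLang

end SymmDieudonne

namespace SymmDieudonne

/-! ### The fraction field of the Witt vectors -/

section FractionField

variable (p : ℕ) [Fact p.Prime] (k : Type*) [Field k] [IsAlgClosed k] [CharP k p]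

/-- The ring of integers `W(k)` of `K(k)`. -/
abbrev intRing : Subring K(p, k) := (algebraMap (WittVector p k) K(p, k)).range

variable {p k}

theorem algebraMap_witt_injective :
    Function.Injective (algebraMap (WittVector p k) K(p, k)) :=
  IsFractionRing.injective _ _

theorem p_ne_zero : (p : K(p, k)) ≠ 0 := WittVector.FractionRing.p_nonzero p k

theorem algebraMap_mem (w : WittVector p k) : algebraMap (WittVector p k) K(p, k) w ∈ intRing p k :=
  ⟨w, rfl⟩

theorem p_mem : (p : K(p, k)) ∈ intRing p k := ⟨p, map_natCast _ _⟩

theorem frobenius_algebraMap (w : WittVector p k) :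
    WittVector.FractionRing.frobenius p k (algebraMap (WittVector p k) K(p, k) w) =
      algebraMap (WittVector p k) K(p, k) (WittVector.frobenius w) := by
  rw [WittVector.FractionRing.frobenius, IsFractionRing.ringEquivOfRingEquiv_algebraMap]
  rfl

theorem frobenius_mem_iff {a : K(p, k)} :
    WittVector.FractionRing.frobenius p k a ∈ intRing p k ↔ a ∈ intRing p k := by
  constructor
  · rintro ⟨w, hw⟩
    obtain ⟨v, rfl⟩ := (WittVector.frobenius_bijective p k).2 w
    rw [← frobenius_algebraMap] at hw
    exact ⟨v, (WittVector.FractionRing.frobenius p k).injective hw⟩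
  · rintro ⟨w, rfl⟩
    exact ⟨_, (frobenius_algebraMap w).symm⟩

theorem frobenius_p : WittVector.FractionRing.frobenius p k (p : K(p, k)) = p := map_natCast _ _

theorem exists_eq_zpow_mul {a : K(p, k)} (ha : a ≠ 0) :
    ∃ (n : ℤ) (u : WittVector p k), WittVector.constantCoeff u ≠ 0 ∧
      a = (p : K(p, k)) ^ n * algebraMap (WittVector p k) K(p, k) u := by
  obtain ⟨x, y, hy, rfl⟩ := IsFractionRing.div_surjective (WittVector p k) a
  have hy0 : y ≠ 0 := nonZeroDivisors.ne_zero hy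
  have hx0 : x ≠ 0 := by rintro rfl; simp at ha
  obtain ⟨m, b, hb, hxb⟩ := WittVector.exists_eq_pow_p_mul x hx0
  obtain ⟨n, c, hc, hyc⟩ := WittVector.exists_eq_pow_p_mul y hy0
  obtain ⟨d, hd⟩ := (isUnit_of_constantCoeff_ne_zero (w := c) hc).exists_right_inv
  refine ⟨(m : ℤ) - n, b * d, ?_, ?_⟩
  · rw [map_mul]
    refine mul_ne_zero hb fun h => ?_
    have := congrArg WittVector.constantCoeff hd
    rw [map_mul, h, mul_zero, map_one] at this
    exact zero_ne_one this
  · have hc0 : algebraMap (WittVector p k) K(p, k) c ≠ 0 := by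
      intro h
      have h1 := congrArg (algebraMap (WittVector p k) K(p, k)) hd
      rw [map_mul, h, zero_mul, map_one] at h1
      exact zero_ne_one h1
    have h1 := congrArg (algebraMap (WittVector p k) K(p, k)) hd
    rw [map_mul, map_one] at h1
    rw [hxb, hyc, map_mul, map_mul, map_mul, map_pow, map_pow, map_natCast,
      zpow_sub₀ p_ne_zero, zpow_natCast, zpow_natCast]
    have hp0 : (p : K(p, k)) ≠ 0 := p_ne_zero
    field_simp
    linear_combination (-algebraMap (WittVector p k) K(p, k) b) * h1

theorem zpow_mem {n : ℤ} (hn : 0 ≤ n) : (p : K(p, k)) ^ n ∈ intRing p k := by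
  obtain ⟨m, rfl⟩ := Int.eq_ofNat_of_zero_le hn
  rw [zpow_natCast]
  exact pow_mem p_mem m

theorem inv_mem_of_constantCoeff_ne_zero {u : WittVector p k}
    (hu : WittVector.constantCoeff u ≠ 0) :
    algebraMap (WittVector p k) K(p, k) u ≠ 0 ∧
      (algebraMap (WittVector p k) K(p, k) u)⁻¹ ∈ intRing p k := by
  obtain ⟨d, hd⟩ := (isUnit_of_constantCoeff_ne_zero (w := u) hu).exists_right_inv
  have h1 := congrArg (algebraMap (WittVector p k) K(p, k)) hd
  rw [map_mul, map_one] at h1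
  exact ⟨left_ne_zero_of_mul_eq_one h1, d, eq_inv_of_mul_eq_one_right h1⟩

theorem inv_p_notMem : (p : K(p, k))⁻¹ ∉ intRing p k := by
  rintro ⟨w, hw⟩
  refine (WittVector.irreducible (k := k) p).not_isUnit (.of_mul_eq_one w ?_)
  apply algebraMap_witt_injective
  rw [map_mul, hw, map_natCast, map_one, mul_inv_cancel₀ p_ne_zero]

theorem zpow_mul_unit_mem_iff {n : ℤ} {u : WittVector p k}
    (hu : WittVector.constantCoeff u ≠ 0) :
    (p : K(p, k)) ^ n * algebraMap (WittVector p k) K(p, k) u ∈ intRing p k ↔ 0 ≤ n := by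
  refine ⟨fun h => ?_, fun h => mul_mem (zpow_mem h) ⟨u, rfl⟩⟩
  by_contra hn
  obtain ⟨h0, hinv⟩ := inv_mem_of_constantCoeff_ne_zero hu
  have h1 := mul_mem h hinv
  rw [mul_assoc, mul_inv_cancel₀ h0, mul_one] at h1
  refine inv_p_notMem (p := p) (k := k) ?_
  have h2 := mul_mem h1 (zpow_mem (p := p) (k := k) (n := -1 - n) (by omega))
  rwa [← zpow_add₀ p_ne_zero, show n + (-1 - n) = -1 by ring, zpow_neg_one] at h2

theorem zpow_mem_iff {n : ℤ} : (p : K(p, k)) ^ n ∈ intRing p k ↔ 0 ≤ n := by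
  have := zpow_mul_unit_mem_iff (n := n) (u := (1 : WittVector p k)) (by simp)
  simpa using this

/-- An element of `K(k)` which is not integral has inverse in `p W(k)`. -/
theorem inv_mem_of_notMem {a : K(p, k)} (ha : a ∉ intRing p k) :
    (p : K(p, k))⁻¹ * a⁻¹ ∈ intRing p k := by
  have ha0 : a ≠ 0 := by rintro rfl; exact ha (zero_mem _)
  obtain ⟨n, u, hu, rfl⟩ := exists_eq_zpow_mul ha0
  rw [zpow_mul_unit_mem_iff hu] at ha
  obtain ⟨h0, hinv⟩ := inv_mem_of_constantCoeff_ne_zero hu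
  rw [mul_inv, ← zpow_neg, ← mul_assoc, ← zpow_neg_one, ← zpow_add₀ p_ne_zero]
  exact mul_mem (zpow_mem (by omega)) hinv

/-- The residue map `W(k) → k`. -/
def redHom : intRing p k →+* k :=
  WittVector.constantCoeff.comp
    (RingEquiv.ofLeftInverse (f := algebraMap (WittVector p k) K(p, k))
      (Function.leftInverse_invFun algebraMap_witt_injective)).symm.toRingHom

open Classical in
/-- The residue map `W(k) → k`, extended by zero to `K(k)`. -/
def red (a : K(p, k)) : k := if h : a ∈ intRing p k then redHom ⟨a, h⟩ else 0

theorem red_algebraMap (w : WittVector p k) :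
    red (algebraMap (WittVector p k) K(p, k) w) = WittVector.constantCoeff w := by
  rw [red, dif_pos ⟨w, rfl⟩, redHom]
  refine congrArg WittVector.constantCoeff ?_
  refine (RingEquiv.ofLeftInverse (f := algebraMap (WittVector p k) K(p, k))
      (Function.leftInverse_invFun algebraMap_witt_injective)).injective ?_
  exact (RingEquiv.apply_symm_apply _ _).trans (Subtype.ext rfl)

theorem red_add {a b : K(p, k)} (ha : a ∈ intRing p k) (hb : b ∈ intRing p k) :
    red (a + b) = red a + red b := by
  obtain ⟨a, rfl⟩ := ha
  obtain ⟨b, rfl⟩ := hb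
  rw [← map_add, red_algebraMap, red_algebraMap, red_algebraMap, map_add]

theorem red_mul {a b : K(p, k)} (ha : a ∈ intRing p k) (hb : b ∈ intRing p k) :
    red (a * b) = red a * red b := by
  obtain ⟨a, rfl⟩ := ha
  obtain ⟨b, rfl⟩ := hb
  rw [← map_mul, red_algebraMap, red_algebraMap, red_algebraMap, map_mul]

theorem red_neg {a : K(p, k)} (ha : a ∈ intRing p k) : red (-a) = -red a := by
  obtain ⟨a, rfl⟩ := ha
  rw [← map_neg, red_algebraMap, red_algebraMap, map_neg]

theorem red_sub {a b : K(p, k)} (ha : a ∈ intRing p k) (hb : b ∈ intRing p k) :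
    red (a - b) = red a - red b := by
  rw [sub_eq_add_neg, red_add ha (neg_mem hb), red_neg hb, ← sub_eq_add_neg]

@[simp] theorem red_zero : red (0 : K(p, k)) = 0 := by
  rw [← map_zero (algebraMap (WittVector p k) K(p, k)), red_algebraMap, map_zero]

@[simp] theorem red_one : red (1 : K(p, k)) = 1 := by
  rw [← map_one (algebraMap (WittVector p k) K(p, k)), red_algebraMap, map_one]

theorem red_sum {ι : Type*} (s : Finset ι) (f : ι → K(p, k)) (hf : ∀ i ∈ s, f i ∈ intRing p k) :
    red (∑ i ∈ s, f i) = ∑ i ∈ s, red (f i) := by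
  classical
  induction s using Finset.induction_on with
  | empty => simp
  | insert i s hi ih =>
    rw [Finset.sum_insert hi, Finset.sum_insert hi, red_add (hf i (Finset.mem_insert_self i s))
      (sum_mem fun j hj => hf j (Finset.mem_insert_of_mem hj)),
      ih fun j hj => hf j (Finset.mem_insert_of_mem hj)]

theorem red_frobenius {a : K(p, k)} (ha : a ∈ intRing p k) :
    red (WittVector.FractionRing.frobenius p k a) = red a ^ p := by
  obtain ⟨a, rfl⟩ := ha
  rw [frobenius_algebraMap, red_algebraMap, red_algebraMap, constantCoeff_frobenius]

theorem red_eq_zero_iff {a : K(p, k)} (ha : a ∈ intRing p k) :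
    red a = 0 ↔ (p : K(p, k))⁻¹ * a ∈ intRing p k := by
  obtain ⟨w, rfl⟩ := ha
  rw [red_algebraMap, coeff_zero_eq_zero_iff]
  constructor
  · rintro ⟨v, rfl⟩
    exact ⟨v, by rw [map_mul, map_natCast, inv_mul_cancel_left₀ p_ne_zero]⟩
  · rintro ⟨v, hv⟩
    refine ⟨v, algebraMap_witt_injective ?_⟩
    rw [map_mul, hv, map_natCast, mul_inv_cancel_left₀ p_ne_zero]

theorem red_p_mul {a : K(p, k)} (ha : a ∈ intRing p k) : red ((p : K(p, k)) * a) = 0 := by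
  rw [red_eq_zero_iff (mul_mem p_mem ha), inv_mul_cancel_left₀ p_ne_zero]
  exact ha

theorem red_eq_zero_of_mem {a : K(p, k)} (ha : (p : K(p, k))⁻¹ * a ∈ intRing p k) : red a = 0 := by
  have := red_p_mul ha
  rwa [mul_inv_cancel_left₀ p_ne_zero] at this

theorem inv_mem_of_red_ne_zero {a : K(p, k)} (ha : a ∈ intRing p k) (h : red a ≠ 0) :
    a⁻¹ ∈ intRing p k := by
  obtain ⟨w, rfl⟩ := ha
  rw [red_algebraMap] at h
  exact (inv_mem_of_constantCoeff_ne_zero h).2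

theorem red_zpow_pos {n : ℤ} (hn : 0 < n) : red ((p : K(p, k)) ^ n) = 0 := by
  apply red_eq_zero_of_mem
  rw [← zpow_neg_one, ← zpow_add₀ p_ne_zero]
  exact zpow_mem (by omega)

theorem red_surjective (c : k) : ∃ a ∈ intRing p k, red a = c := by
  obtain ⟨w, rfl⟩ := WittVector.constantCoeff_surjective p c
  exact ⟨_, ⟨w, rfl⟩, red_algebraMap w⟩

theorem intRing_fixed_lift {c : k} (hc : c ^ p ^ 2 = c) :
    ∃ a ∈ intRing p k, red a = c ∧ WittVector.FractionRing.frobenius p k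
      (WittVector.FractionRing.frobenius p k a) = a := by
  refine ⟨algebraMap _ _ (WittVector.teichmuller p c), ⟨_, rfl⟩, ?_, ?_⟩
  · rw [red_algebraMap]; exact WittVector.teichmuller_coeff_zero p c
  · rw [frobenius_algebraMap, frobenius_algebraMap, WittVector.frobenius_eq_map_frobenius,
      WittVector.map_teichmuller, WittVector.map_teichmuller]
    congr 2
    change (c ^ p) ^ p = c
    rw [← pow_mul, ← sq, hc]

end FractionField

/-! ### Isocrystals -/

section Isocrystal

variable (p : ℕ) [Fact p.Prime] (k : Type*) [Field k] [IsAlgClosed k] [CharP k p]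
variable {E : Type*} [AddCommGroup E] [WittVector.Isocrystal p k E]

theorem frob_smul' (a : K(p, k)) (x : E) :
    frob p k (a • x) = WittVector.FractionRing.frobenius p k a • frob p k x :=
  (WittVector.Isocrystal.frobenius p k (V := E)).map_smulₛₗ _ _

theorem frob_ver (x : E) : frob p k (ver p k x) = (p : K(p, k)) • x := by
  rw [ver, frob_smul', frobenius_p]
  exact congrArg _ ((frob p k (E := E)).apply_symm_apply x)

theorem ver_frob (x : E) : ver p k (frob p k x) = (p : K(p, k)) • x := by
  rw [ver]
  exact congrArg _ ((frob p k (E := E)).symm_apply_apply x)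

theorem frob_injective : Function.Injective (frob p k (E := E)) := (frob p k (E := E)).injective

/-- The operator `p⁻¹ F²`, inverse to `F⁻¹ V`. -/
def psi : E →+ E where
  toFun x := (p : K(p, k))⁻¹ • frob p k (frob p k x)
  map_zero' := by simp
  map_add' x y := by simp

theorem psi_apply (x : E) : psi p k x = (p : K(p, k))⁻¹ • frob p k (frob p k x) := rfl

theorem p_smul_psi (x : E) : (p : K(p, k)) • psi p k x = frob p k (frob p k x) := by
  rw [psi_apply, smul_inv_smul₀ p_ne_zero]

theorem psi_smul' (a : K(p, k)) (x : E) :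
    psi p k (a • x) = WittVector.FractionRing.frobenius p k
      (WittVector.FractionRing.frobenius p k a) • psi p k x := by
  rw [psi_apply, psi_apply, frob_smul', frob_smul', smul_comm]

theorem ver_psi (x : E) : ver p k (psi p k x) = frob p k x := by
  apply frob_injective p k
  rw [frob_ver, p_smul_psi]

theorem frob_psi (x : E) : frob p k (psi p k x) = psi p k (frob p k x) := by
  rw [psi_apply, psi_apply, frob_smul', map_inv₀, frobenius_p]

theorem psi_injective : Function.Injective (psi p k (E := E)) := by
  intro x y h
  have := congrArg (fun z => (p : K(p, k)) • z) h
  simp only [p_smul_psi] at this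
  exact frob_injective p k (frob_injective p k this)

theorem psi_surjective : Function.Surjective (psi p k (E := E)) := by
  intro x
  obtain ⟨y, hy⟩ := (frob p k (E := E)).surjective ((p : K(p, k)) • x)
  obtain ⟨z, rfl⟩ := (frob p k (E := E)).surjective y
  exact ⟨z, by rw [psi_apply, hy, inv_smul_smul₀ p_ne_zero]⟩

theorem psi_eq_self_iff (x : E) : psi p k x = x ↔ frob p k (frob p k x) = (p : K(p, k)) • x := by
  rw [← p_smul_psi]
  exact (smul_right_injective E (p_ne_zero (p := p) (k := k))).eq_iff.symm

theorem psi_eq_self_iff_ver (x : E) : psi p k x = x ↔ ver p k x = frob p k x := by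
  rw [psi_eq_self_iff, ← frob_ver, (frob_injective p k).eq_iff, eq_comm]

theorem psi_frob_of_psi {x : E} (hx : psi p k x = x) : psi p k (frob p k x) = frob p k x := by
  rw [← frob_psi, hx]

theorem frob_frob_of_psi {x : E} (hx : psi p k x = x) :
    frob p k (frob p k x) = (p : K(p, k)) • x := (psi_eq_self_iff p k x).1 hx

variable {p k}

section Pairing

variable {φ : LinearMap.BilinForm K(p, k) E} (hφ : IsPairing p k φ)
include hφ

theorem IsPairing.frob_frob (x y : E) :
    φ (frob p k x) (frob p k y) = p * WittVector.FractionRing.frobenius p k (φ x y) := by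
  rw [hφ, ver_frob, map_smul, LinearMap.smul_apply, smul_eq_mul, map_mul, frobenius_p]

theorem IsPairing.psi_psi (x y : E) :
    φ (psi p k x) (psi p k y) = WittVector.FractionRing.frobenius p k
      (WittVector.FractionRing.frobenius p k (φ x y)) := by
  rw [psi_apply, psi_apply, map_smul, map_smul, LinearMap.smul_apply, smul_eq_mul, smul_eq_mul,
    hφ.frob_frob, hφ.frob_frob, map_mul, frobenius_p, inv_mul_cancel_left₀ p_ne_zero,
    inv_mul_cancel_left₀ p_ne_zero]

theorem IsPairing.fixed_fixed {x y : E} (hx : psi p k x = x) (hy : psi p k y = y) :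
    WittVector.FractionRing.frobenius p k (WittVector.FractionRing.frobenius p k (φ x y)) =
      φ x y := by
  rw [← hφ.psi_psi, hx, hy]

end Pairing

variable [Module (WittVector p k) E] [IsScalarTower (WittVector p k) K(p, k) E]

theorem witt_smul_eq (w : WittVector p k) (x : E) :
    w • x = algebraMap (WittVector p k) K(p, k) w • x := (algebraMap_smul _ _ _).symm

theorem smul_mem_of_mem {L : Submodule (WittVector p k) E} {a : K(p, k)} (ha : a ∈ intRing p k)
    {x : E} (hx : x ∈ L) : a • x ∈ L := by
  obtain ⟨w, rfl⟩ := ha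
  rw [← witt_smul_eq]
  exact L.smul_mem w hx

theorem psi_smul (w : WittVector p k) (x : E) :
    psi p k (w • x) = WittVector.frobenius (WittVector.frobenius w) • psi p k x := by
  rw [witt_smul_eq, psi_smul', frobenius_algebraMap, frobenius_algebraMap, ← witt_smul_eq]

/-- Immediate from Vψ = F and the injectivity of V and F. In this form superspeciality passes
visibly to intersections and to duals. -/
theorem image_frob_eq_image_ver_iff (L : Submodule (WittVector p k) E) :
    (frob p k (E := E)) '' (L : Set E) = (ver p k) '' (L : Set E) ↔
      ∀ x, psi p k x ∈ L ↔ x ∈ L := by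
  have hver : Function.Injective (ver p k (E := E)) := by
    intro x y h
    have := congrArg (frob p k) h
    rw [frob_ver, frob_ver] at this
    exact smul_right_injective E p_ne_zero this
  constructor
  · intro h x
    constructor
    · intro hx
      have h1 : ver p k (psi p k x) ∈ (frob p k (E := E)) '' (L : Set E) := by
        rw [h]; exact ⟨_, hx, rfl⟩
      obtain ⟨y, hy, hxy⟩ := h1
      rw [ver_psi] at hxy
      rwa [← frob_injective p k hxy]
    · intro hx
      have h1 : frob p k x ∈ (ver p k (E := E)) '' (L : Set E) := by
        rw [← h]; exact ⟨_, hx, rfl⟩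
      obtain ⟨y, hy, hxy⟩ := h1
      rw [← ver_psi] at hxy
      rwa [← hver hxy]
  · intro h
    ext y
    constructor
    · rintro ⟨x, hx, rfl⟩
      exact ⟨psi p k x, (h x).2 hx, ver_psi p k x⟩
    · rintro ⟨x, hx, rfl⟩
      obtain ⟨z, rfl⟩ := psi_surjective p k x
      exact ⟨z, (h z).1 hx, (ver_psi p k z).symm⟩

end Isocrystal

end SymmDieudonne

namespace SymmDieudonne

/-! ### Lattices -/

section Lattices

variable {p : ℕ} [Fact p.Prime] {k : Type*} [Field k] [IsAlgClosed k] [CharP k p]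
variable {E : Type*} [AddCommGroup E] [WittVector.Isocrystal p k E]
variable [Module (WittVector p k) E] [IsScalarTower (WittVector p k) K(p, k) E]

theorem isTorsionFree_witt (L : Submodule (WittVector p k) E) :
    Module.IsTorsionFree (WittVector p k) L := by
  have : Module.IsTorsionFree (WittVector p k) E := by
    refine .of_smul_eq_zero fun w x h => ?_
    rw [witt_smul_eq, smul_eq_zero] at h
    exact h.imp_left fun h => algebraMap_witt_injective (h.trans (map_zero _).symm)
  infer_instance

/-- A lattice stable under `p⁻¹ F²` and its inverse is spanned by fixed vectors. -/
theorem span_fixed_eq (L : Submodule (WittVector p k) E) (hfg : L.FG)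
    (hL : ∀ x, psi p k x ∈ L ↔ x ∈ L) :
    Submodule.span (WittVector p k) {x | x ∈ L ∧ psi p k x = x} = L := by
  have := isTorsionFree_witt L
  have : Module.Finite (WittVector p k) L := Module.Finite.iff_fg.2 hfg
  have : Module.Free (WittVector p k) L := inferInstance
  let b := Module.Free.chooseBasis (WittVector p k) L
  let ι := Module.Free.ChooseBasisIndex (WittVector p k) L
  let e : L ≃ₗ[WittVector p k] (ι → WittVector p k) := b.equivFun
  let Ψ : L →+ L :=
    { toFun := fun x => ⟨psi p k (x : E), (hL x).2 x.2⟩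
      map_zero' := Subtype.ext (map_zero _)
      map_add' := fun x y => Subtype.ext (map_add _ _ _) }
  let T : (ι → WittVector p k) →+ (ι → WittVector p k) :=
    e.toAddMonoidHom.comp (Ψ.comp e.symm.toAddMonoidHom)
  have hTe : ∀ x, T (e x) = e (Ψ x) := by
    intro x
    change e (Ψ (e.symm (e x))) = _
    rw [e.symm_apply_apply]
  have hbij : Function.Bijective Ψ := by
    constructor
    · intro x y h
      exact Subtype.ext (psi_injective p k (congrArg Subtype.val h))
    · intro x
      obtain ⟨y, hy⟩ := psi_surjective p k (x : E)
      exact ⟨⟨y, (hL y).1 (hy ▸ x.2)⟩, Subtype.ext hy⟩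
  have htop := span_fixed_eq_top_witt T (by
    intro a v
    obtain ⟨x, rfl⟩ := e.surjective v
    rw [← map_smul, hTe, hTe, ← map_smul]
    congr 1
    exact Subtype.ext (psi_smul a (x : E)))
    (e.bijective.comp (hbij.comp e.symm.bijective))
  apply le_antisymm
  · exact Submodule.span_le.2 fun x hx => hx.1
  · intro x hx
    have h1 : ∀ v ∈ Submodule.span (WittVector p k) {v | T v = v},
        ((e.symm v : L) : E) ∈ Submodule.span (WittVector p k) {x | x ∈ L ∧ psi p k x = x} := by
      intro v hv
      induction hv using Submodule.span_induction with
      | mem v hv =>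
        obtain ⟨x, rfl⟩ := e.surjective v
        rw [e.symm_apply_apply]
        refine Submodule.subset_span ⟨x.2, ?_⟩
        have h2 : T (e x) = e x := hv
        rw [hTe] at h2
        exact congrArg Subtype.val (e.injective h2)
      | zero => rw [map_zero]; exact Submodule.zero_mem _
      | add a b _ _ ha hb => rw [map_add]; exact Submodule.add_mem _ ha hb
      | smul a v _ hv => rw [map_smul]; exact Submodule.smul_mem _ _ hv
    have h2 := h1 (e ⟨x, hx⟩) (by rw [htop]; trivial)
    rwa [e.symm_apply_apply] at h2

/-! ### Commensurability of lattices, rescaling, and the superspecial hull. -/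

theorem exists_pow_smul_mem_single {L : Submodule (WittVector p k) E}
    (hL : Submodule.span K(p, k) (L : Set E) = ⊤) (x : E) :
    ∃ a : ℕ, (p : K(p, k)) ^ a • x ∈ L := by
  have hx : x ∈ Submodule.span K(p, k) (L : Set E) := by rw [hL]; trivial
  have hup : ∀ (a b : ℕ) (x : E), a ≤ b → (p : K(p, k)) ^ a • x ∈ L →
      (p : K(p, k)) ^ b • x ∈ L := by
    intro a b x hab h
    obtain ⟨c, rfl⟩ := Nat.exists_eq_add_of_le hab
    rw [add_comm, pow_add, mul_smul]
    exact smul_mem_of_mem (pow_mem p_mem c) h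
  induction hx using Submodule.span_induction with
  | mem x hx => exact ⟨0, by simpa using hx⟩
  | zero => exact ⟨0, by simp⟩
  | add x y _ _ hx hy =>
    obtain ⟨a, ha⟩ := hx
    obtain ⟨b, hb⟩ := hy
    refine ⟨max a b, ?_⟩
    rw [smul_add]
    exact L.add_mem (hup _ _ _ (le_max_left _ _) ha) (hup _ _ _ (le_max_right _ _) hb)
  | smul c x _ hx =>
    obtain ⟨a, ha⟩ := hx
    by_cases hc : c = 0
    · exact ⟨0, by simp [hc]⟩
    obtain ⟨n, u, hu, rfl⟩ := exists_eq_zpow_mul hc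
    refine ⟨a + n.natAbs, ?_⟩
    rw [smul_smul, ← zpow_natCast, ← mul_assoc, ← zpow_add₀ p_ne_zero,
      show ((a + n.natAbs : ℕ) : ℤ) + n = (n.natAbs + n) + a by push_cast; ring,
      zpow_add₀ p_ne_zero, mul_right_comm, mul_smul, zpow_natCast]
    exact smul_mem_of_mem (mul_mem (zpow_mem (by omega)) ⟨u, rfl⟩) ha

theorem exists_pow_smul_mem {L M : Submodule (WittVector p k) E}
    (hL : Submodule.span K(p, k) (L : Set E) = ⊤) (hM : M.FG) :
    ∃ a : ℕ, ∀ x ∈ M, (p : K(p, k)) ^ a • x ∈ L := by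
  obtain ⟨s, rfl⟩ := hM
  choose f hf using exists_pow_smul_mem_single hL
  refine ⟨s.sup f, fun x hx => ?_⟩
  induction hx using Submodule.span_induction with
  | mem x hx =>
    obtain ⟨c, hc⟩ := Nat.exists_eq_add_of_le (Finset.le_sup (f := f) hx)
    rw [hc, add_comm, pow_add, mul_smul]
    exact smul_mem_of_mem (pow_mem p_mem c) (hf x)
  | zero => rw [smul_zero]; exact L.zero_mem
  | add a b _ _ ha hb => rw [smul_add]; exact L.add_mem ha hb
  | smul w x _ hx =>
    rw [witt_smul_eq, smul_comm]
    exact smul_mem_of_mem ⟨w, rfl⟩ hx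

/-- The lattice of all `x` with `c x ∈ L`. -/
def scale (c : K(p, k)) (L : Submodule (WittVector p k) E) : Submodule (WittVector p k) E where
  carrier := {x | c • x ∈ L}
  add_mem' := by
    intro x y hx hy
    rw [Set.mem_ofPred_eq, smul_add]
    exact L.add_mem hx hy
  zero_mem' := by rw [Set.mem_ofPred_eq, smul_zero]; exact L.zero_mem
  smul_mem' := by
    intro w x hx
    rw [Set.mem_ofPred_eq, witt_smul_eq, smul_comm]
    exact smul_mem_of_mem ⟨w, rfl⟩ hx

theorem mem_scale {c : K(p, k)} {L : Submodule (WittVector p k) E} {x : E} :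
    x ∈ scale c L ↔ c • x ∈ L := Iff.rfl

theorem scale_fg {c : K(p, k)} (hc : c ≠ 0) {L : Submodule (WittVector p k) E} (hL : L.FG) :
    (scale c L).FG := by
  obtain ⟨s, rfl⟩ := hL
  classical
  refine ⟨s.image fun x => c⁻¹ • x, le_antisymm (Submodule.span_le.2 ?_) ?_⟩
  · intro y hy
    rw [Finset.coe_image] at hy
    obtain ⟨x, hx, rfl⟩ := hy
    rw [SetLike.mem_coe, mem_scale, smul_inv_smul₀ hc]
    exact Submodule.subset_span hx
  · intro y hy
    rw [mem_scale] at hy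
    rw [← inv_smul_smul₀ hc y]
    generalize c • y = z at hy
    induction hy using Submodule.span_induction with
    | mem x hx => exact Submodule.subset_span (by rw [Finset.coe_image]; exact ⟨x, hx, rfl⟩)
    | zero => rw [smul_zero]; exact Submodule.zero_mem _
    | add a b _ _ ha hb => rw [smul_add]; exact Submodule.add_mem _ ha hb
    | smul w x _ hx =>
      rw [witt_smul_eq, smul_comm]
      exact smul_mem_of_mem ⟨w, rfl⟩ hx

/-- Stability under V is not listed on the right because V = Fψ⁻¹. -/
theorem isSuperspecial_iff (L : Submodule (WittVector p k) E) : IsSuperspecial p k L ↔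
    L.FG ∧ Submodule.span K(p, k) (L : Set E) = ⊤ ∧ (∀ x ∈ L, frob p k x ∈ L) ∧
      ∀ x, psi p k x ∈ L ↔ x ∈ L := by
  constructor
  · intro h
    exact ⟨h.fg, h.span_eq_top, h.frob_mem, (image_frob_eq_image_ver_iff L).1 h.frob_eq_ver⟩
  · rintro ⟨h1, h2, h3, h4⟩
    refine ⟨⟨h1, h2, h3, fun x hx => ?_⟩, (image_frob_eq_image_ver_iff L).2 h4⟩
    obtain ⟨y, rfl⟩ := psi_surjective p k x
    rw [ver_psi]
    exact h3 y ((h4 y).1 hx)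

theorem IsSuperspecial.psi_mem_iff {L : Submodule (WittVector p k) E} (h : IsSuperspecial p k L)
    (x : E) : psi p k x ∈ L ↔ x ∈ L := ((isSuperspecial_iff L).1 h).2.2.2 x

theorem span_scale {c : K(p, k)} (hc : c ≠ 0) {L : Submodule (WittVector p k) E}
    (hL : Submodule.span K(p, k) (L : Set E) = ⊤) :
    Submodule.span K(p, k) (scale c L : Set E) = ⊤ := by
  rw [eq_top_iff, ← hL, Submodule.span_le]
  intro x hx
  rw [SetLike.mem_coe, ← smul_inv_smul₀ hc x]
  refine Submodule.smul_mem _ _ (Submodule.subset_span ?_)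
  rw [SetLike.mem_coe, mem_scale, smul_inv_smul₀ hc]
  exact hx

theorem IsSuperspecial.scale {L : Submodule (WittVector p k) E} (h : IsSuperspecial p k L)
    (a : ℕ) : IsSuperspecial p k (scale ((p : K(p, k)) ^ a) L) := by
  have hp0 : ((p : K(p, k)) ^ a) ≠ 0 := pow_ne_zero _ p_ne_zero
  have hpf : WittVector.FractionRing.frobenius p k ((p : K(p, k)) ^ a) = (p : K(p, k)) ^ a := by
    rw [map_pow, frobenius_p]
  rw [isSuperspecial_iff]
  refine ⟨scale_fg hp0 h.fg, span_scale hp0 h.span_eq_top, fun x hx => ?_, fun x => ?_⟩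
  · rw [mem_scale] at hx ⊢
    rw [← hpf, ← frob_smul']
    exact h.frob_mem _ hx
  · rw [mem_scale, mem_scale, ← h.psi_mem_iff (((p : K(p, k)) ^ a) • x), psi_smul', hpf, hpf]

theorem fg_of_le {L M : Submodule (WittVector p k) E} (hM : M.FG) (hLM : L ≤ M) : L.FG := by
  have : Module.Finite (WittVector p k) M := Module.Finite.iff_fg.2 hM
  have : IsNoetherian (WittVector p k) M := inferInstance
  exact Submodule.FG.of_le_of_isNoetherian hLM

/-- The stability conditions pass to intersections. Supersingularity provides one superspecial
lattice p⁻ᵃL above M, and this bound makes the intersection finitely generated. -/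
theorem upperS_isSuperspecial (hss : IsSupersingular p k E) {M : Submodule (WittVector p k) E}
    (hfg : M.FG) (hspan : Submodule.span K(p, k) (M : Set E) = ⊤) :
    IsSuperspecial p k (upperS p k M) := by
  obtain ⟨L, hL⟩ := hss
  obtain ⟨a, ha⟩ := exists_pow_smul_mem hL.span_eq_top hfg
  have hle : upperS p k M ≤ scale ((p : K(p, k)) ^ a) L :=
    sInf_le ⟨hL.scale a, fun x hx => ha x hx⟩
  rw [isSuperspecial_iff]
  refine ⟨fg_of_le (hL.scale a).fg hle, ?_, fun x hx => ?_, fun x => ?_⟩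
  · rw [eq_top_iff, ← hspan]
    exact Submodule.span_mono (le_sInf fun _ h => h.2 : M ≤ upperS p k M)
  · rw [upperS, Submodule.mem_sInf] at hx ⊢
    exact fun L hL => hL.1.frob_mem x (hx L hL)
  · rw [upperS, Submodule.mem_sInf, Submodule.mem_sInf]
    exact forall₂_congr fun L hL => hL.1.psi_mem_iff x

theorem le_upperS (M : Submodule (WittVector p k) E) : M ≤ upperS p k M :=
  le_sInf fun _ h => h.2

theorem upperS_le {M L : Submodule (WittVector p k) E} (hL : IsSuperspecial p k L) (h : M ≤ L) :
    upperS p k M ≤ L := sInf_le ⟨hL, h⟩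

/-! ### Duality -/

variable {φ : LinearMap.BilinForm K(p, k) E}

theorem dual_anti {L M : Submodule (WittVector p k) E} (h : L ≤ M) :
    dual p k φ M ≤ dual p k φ L := fun _ hx y hy => hx y (h hy)

variable (hsymm : ∀ x y : E, φ x y = φ y x)
include hsymm

theorem le_dual_dual (L : Submodule (WittVector p k) E) : L ≤ dual p k φ (dual p k φ L) := by
  intro x hx y hy
  rw [hsymm]
  exact hy x hx

/-- Since L and M are commensurable and Mᵗ = M, the dual of L is again a lattice. It is F-stable
because F and V are adjoint up to σ, and ψ-invariant because φ(ψx, ψy) = σ²φ(x, y). -/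
theorem isSuperspecial_dual (hφ : IsPairing p k φ) {M : Submodule (WittVector p k) E}
    (hfg : M.FG) (hspan : Submodule.span K(p, k) (M : Set E) = ⊤) (hperf : dual p k φ M = M)
    {L : Submodule (WittVector p k) E} (hL : IsSuperspecial p k L) :
    IsSuperspecial p k (dual p k φ L) := by
  rw [isSuperspecial_iff]
  refine ⟨?_, ?_, fun x hx y hy => ?_, fun x => ?_⟩
  · obtain ⟨b, hb⟩ := exists_pow_smul_mem hL.span_eq_top hfg
    have hp0 : ((p : K(p, k)) ^ b) ≠ 0 := pow_ne_zero _ p_ne_zero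
    refine fg_of_le (scale_fg hp0 hfg) fun x hx => ?_
    rw [mem_scale, ← hperf]
    intro m hm
    rw [map_smul, ← LinearMap.smul_apply, ← map_smul]
    exact hx _ (hb m hm)
  · obtain ⟨a, ha⟩ := exists_pow_smul_mem hspan hL.fg
    have hp0 : ((p : K(p, k)) ^ a) ≠ 0 := pow_ne_zero _ p_ne_zero
    rw [eq_top_iff, ← hspan, Submodule.span_le]
    intro m hm
    rw [SetLike.mem_coe, ← inv_smul_smul₀ hp0 m]
    refine Submodule.smul_mem _ _ (Submodule.subset_span fun l hl => ?_)
    rw [map_smul, ← LinearMap.smul_apply, ← map_smul]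
    rw [SetLike.mem_coe, ← hperf] at hm
    exact hm _ (ha l hl)
  · rw [hφ, frobenius_mem_iff]
    exact hx _ (hL.ver_mem y hy)
  · constructor
    · intro h y hy
      have h1 := h _ ((hL.psi_mem_iff y).2 hy)
      rwa [hφ.psi_psi, frobenius_mem_iff, frobenius_mem_iff] at h1
    · intro h y hy
      obtain ⟨z, rfl⟩ := psi_surjective p k y
      rw [hφ.psi_psi, frobenius_mem_iff, frobenius_mem_iff]
      exact h z ((hL.psi_mem_iff z).1 hy)

/-- Duality reverses inclusions and preserves superspeciality, so it exchanges the superspecial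
lattices inside M with those containing Mᵗ = M. -/
theorem lowerS_eq_dual_upperS (hφ : IsPairing p k φ) (hss : IsSupersingular p k E)
    {M : Submodule (WittVector p k) E} (hfg : M.FG)
    (hspan : Submodule.span K(p, k) (M : Set E) = ⊤) (hperf : dual p k φ M = M) :
    lowerS p k M = dual p k φ (upperS p k M) := by
  apply le_antisymm
  · refine sSup_le fun L hL => ?_
    refine (le_dual_dual hsymm L).trans (dual_anti (upperS_le ?_ ?_))
    · exact isSuperspecial_dual hsymm hφ hfg hspan hperf hL.1
    · rw [← hperf]; exact dual_anti hL.2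
  · refine le_sSup ⟨isSuperspecial_dual hsymm hφ hfg hspan hperf
      (upperS_isSuperspecial hss hfg hspan), ?_⟩
    calc dual p k φ (upperS p k M) ≤ dual p k φ M := dual_anti (le_upperS M)
      _ = M := hperf

/-- The whole K(k)-line through a nonzero radical vector would lie in Mᵗ = M. Then K(k) would be
finite over W(k) and 1/p integral. -/
theorem eq_zero_of_forall_eq_zero {M : Submodule (WittVector p k) E} (hfg : M.FG)
    (hperf : dual p k φ M = M) {x : E} (hx : ∀ y, φ x y = 0) : x = 0 := by
  have hmem : ∀ c : K(p, k), c • x ∈ M := by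
    intro c
    rw [← hperf]
    intro y _
    rw [map_smul, hsymm, hx, smul_zero]
    exact zero_mem _
  by_contra h0
  let f : K(p, k) →ₗ[WittVector p k] M :=
    { toFun := fun c => ⟨c • x, hmem c⟩
      map_add' := fun a b => Subtype.ext (add_smul a b x)
      map_smul' := fun w c => Subtype.ext (smul_assoc w c x) }
  have hf : Function.Injective f := fun a b h =>
    smul_left_injective _ h0 (congrArg Subtype.val h)
  have : Module.Finite (WittVector p k) M := Module.Finite.iff_fg.2 hfg
  have hfin : Module.Finite (WittVector p k) K(p, k) := Module.Finite.of_injective f hf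
  have hint : IsIntegral (WittVector p k) ((p : K(p, k))⁻¹) := IsIntegral.of_finite _ _
  obtain ⟨w, hw⟩ := IsIntegrallyClosed.isIntegral_iff.1 hint
  exact inv_p_notMem ⟨w, hw⟩

end Lattices

end SymmDieudonne

namespace SymmDieudonne

/-! ### Subspaces of `kⁿ` and the Frobenius -/

section Twist

variable {p : ℕ} [Fact p.Prime] {k : Type*} [Field k] [IsAlgClosed k] [CharP k p]
variable {ι : Type*} [Fintype ι]

theorem sum_pow_p_pow (j : ℕ) (f : ι → k) :
    (∑ i, f i) ^ p ^ j = ∑ i, f i ^ p ^ j := by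
  simpa only [iterateFrobenius_def] using map_sum (iterateFrobenius k p j) f Finset.univ

theorem add_pow_p_pow (j : ℕ) (a b : k) : (a + b) ^ p ^ j = a ^ p ^ j + b ^ p ^ j :=
  add_pow_char_pow a b p j

theorem pow_p_pow_injective (j : ℕ) : Function.Injective (fun a : k => a ^ p ^ j) :=
  iterateFrobenius_inj k p j

variable (p) in
/-- The `j`-th power of the Frobenius, on vectors. -/
def pw (j : ℕ) (u : ι → k) : ι → k := fun i => u i ^ p ^ j

theorem pw_injective (j : ℕ) : Function.Injective (pw p j : (ι → k) → ι → k) :=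
  fun _ _ h => funext fun i => pow_p_pow_injective (p := p) j (congrFun h i)

theorem pw_surjective (j : ℕ) : Function.Surjective (pw p j : (ι → k) → ι → k) := by
  intro u
  choose v hv using fun i => IsAlgClosed.exists_pow_nat_eq (u i)
    (pow_pos (Fact.out : p.Prime).pos j)
  exact ⟨v, funext hv⟩

theorem pw_add (j : ℕ) (u v : ι → k) : pw p j (u + v) = pw p j u + pw p j v :=
  funext fun _ => add_pow_p_pow j _ _

theorem pw_zero (j : ℕ) : pw p j (0 : ι → k) = 0 :=
  funext fun _ => zero_pow (pow_pos (Fact.out : p.Prime).pos j).ne'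

theorem pw_smul (j : ℕ) (c : k) (u : ι → k) : pw p j (c • u) = c ^ p ^ j • pw p j u :=
  funext fun _ => mul_pow _ _ _

variable (p) in
/-- The image of a subspace under a power of the Frobenius. -/
def twist (j : ℕ) (U : Submodule k (ι → k)) : Submodule k (ι → k) where
  carrier := pw p j '' (U : Set (ι → k))
  add_mem' := by
    rintro _ _ ⟨u, hu, rfl⟩ ⟨v, hv, rfl⟩
    exact ⟨u + v, U.add_mem hu hv, pw_add j u v⟩
  zero_mem' := ⟨0, U.zero_mem, pw_zero j⟩
  smul_mem' := by
    rintro c _ ⟨u, hu, rfl⟩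
    obtain ⟨d, hd⟩ := IsAlgClosed.exists_pow_nat_eq c (pow_pos (Fact.out : p.Prime).pos j)
    exact ⟨d • u, U.smul_mem d hu, by rw [pw_smul, hd]⟩

theorem finrank_twist (j : ℕ) (U : Submodule k (ι → k)) :
    Module.finrank k (twist p j U) = Module.finrank k U := by
  let f : U → twist p j U := fun u => ⟨pw p j u, u, u.2, rfl⟩
  have hf : Function.Bijective f := by
    constructor
    · intro u v h
      exact Subtype.ext (pw_injective j (congrArg Subtype.val h))
    · rintro ⟨_, u, hu, rfl⟩
      exact ⟨⟨u, hu⟩, rfl⟩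
  let e : U ≃+ twist p j U :=
    { Equiv.ofBijective f hf with
      map_add' := fun u v => Subtype.ext (pw_add j (u : ι → k) v) }
  have h := rank_eq_of_equiv_equiv (fun a : k => a ^ p ^ j) e
    ⟨pow_p_pow_injective j, fun a => IsAlgClosed.exists_pow_nat_eq a
      (pow_pos (Fact.out : p.Prime).pos j)⟩
    (fun c u => Subtype.ext (pw_smul j c (u : ι → k)))
  rw [Module.finrank, Module.finrank, h]

/-- The orthogonal of a subspace with respect to a diagonal form. -/
def wperp (w : ι → k) (U : Submodule k (ι → k)) : Submodule k (ι → k) where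
  carrier := {v | ∀ u ∈ U, ∑ i, w i * u i * v i = 0}
  add_mem' := by
    intro a b ha hb u hu
    simp only [Pi.add_apply, mul_add, Finset.sum_add_distrib, ha u hu, hb u hu, add_zero]
  zero_mem' := by intro u _; simp
  smul_mem' := by
    intro c v hv u hu
    have h := hv u hu
    simp only [Pi.smul_apply, smul_eq_mul, mul_left_comm _ c]
    rw [← Finset.mul_sum, h, mul_zero]

theorem mem_wperp {w : ι → k} {U : Submodule k (ι → k)} {v : ι → k} :
    v ∈ wperp w U ↔ ∀ u ∈ U, ∑ i, w i * u i * v i = 0 := Iff.rfl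

theorem finrank_wperp {w : ι → k} (hw : ∀ i, w i ≠ 0) (U : Submodule k (ι → k)) :
    Module.finrank k (wperp w U) + Module.finrank k U = Fintype.card ι := by
  classical
  have hB : (Matrix.toBilin' (Matrix.diagonal w)).Nondegenerate := by
    apply LinearMap.BilinForm.nondegenerate_toBilin'_of_det_ne_zero'
    rw [Matrix.det_diagonal]
    exact Finset.prod_ne_zero_iff.2 fun i _ => hw i
  have heq : wperp w U = (Matrix.toBilin' (Matrix.diagonal w)).orthogonal U := by
    ext v
    rw [mem_wperp, LinearMap.BilinForm.mem_orthogonal_iff]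
    refine forall₂_congr fun u _ => ?_
    change _ ↔ Matrix.toBilin' (Matrix.diagonal w) u v = 0
    rw [Matrix.toBilin'_apply', dotProduct]
    refine Eq.congr (Finset.sum_congr rfl fun i _ => ?_) rfl
    rw [Matrix.mulVec_diagonal]
    ring
  have h := LinearMap.BilinForm.finrank_orthogonal hB U
  have h2 := Submodule.finrank_le U
  rw [Module.finrank_fintype_fun_eq_card] at h h2
  rw [heq, h]
  omega

variable (p) in
/-- `U` is not annihilated by a nonzero linear form with coefficients in `𝔽_{p²}`. -/
def Nonrational (U : Submodule k (ι → k)) : Prop :=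
  ∀ c : ι → k, (∀ i, c i ^ p ^ 2 = c i) → (∀ u ∈ U, ∑ i, c i * u i = 0) → c = 0

theorem Nonrational.mono {U U' : Submodule k (ι → k)} (h : Nonrational p U) (hle : U ≤ U') :
    Nonrational p U' := fun c hc hU => h c hc fun u hu => hU u (hle hu)

/-- The annihilator of a Frobenius-stable U is Frobenius-stable too. If it were nonzero it would
contain a nonzero fixed vector, that is, a rational linear form vanishing on U. -/
theorem Nonrational.eq_top {U : Submodule k (ι → k)} (h : Nonrational p U)
    (hU : ∀ u ∈ U, pw p 2 u ∈ U) : U = ⊤ := by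
  have hp1 : 1 < p ^ 2 := Nat.one_lt_pow (by norm_num) (Fact.out : p.Prime).one_lt
  set C := wperp 1 U with hC
  have hle : C ≤ twist p 2 C := by
    intro c hc
    obtain ⟨d, rfl⟩ := pw_surjective (p := p) 2 c
    refine ⟨d, fun u hu => ?_, rfl⟩
    have h1 := hc _ (hU u hu)
    apply pow_p_pow_injective (p := p) 2
    simp only [pw, Pi.one_apply, one_mul] at h1 ⊢
    rw [sum_pow_p_pow, zero_pow (by omega), ← h1]
    exact Finset.sum_congr rfl fun i _ => mul_pow _ _ _
  -- The relation on U gives C inside its twist; equality of dimensions turns this into stability of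
  -- C under the twist.
  have heq : C = twist p 2 C :=
    Submodule.eq_of_le_of_finrank_eq hle (finrank_twist 2 C).symm
  have hst : ∀ c ∈ C, pw p 2 c ∈ C := by
    intro c hc
    rw [heq]
    exact ⟨c, hc, rfl⟩
  have hbot : C = ⊥ := by
    by_contra hne
    have : Nontrivial C := Submodule.nontrivial_iff_ne_bot.2 hne
    let Φ : C →+ C :=
      { toFun := fun c => ⟨pw p 2 c, hst c c.2⟩
        map_zero' := Subtype.ext (pw_zero 2)
        map_add' := fun a b => Subtype.ext (pw_add 2 (a : ι → k) b) }
    obtain ⟨c, hc0, hc⟩ := exists_nonzero_fixed (k := k) hp1 Φ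
      (fun a c => Subtype.ext (pw_smul 2 a (c : ι → k)))
      (fun a b hab => Subtype.ext (pw_injective 2 (congrArg Subtype.val hab)))
    refine hc0 (Subtype.ext (h c (fun i => congrFun (congrArg Subtype.val hc) i) fun u hu => ?_))
    have := c.2 u hu
    simpa only [Pi.one_apply, one_mul, mul_comm (u _)] using this
  have h1 := finrank_wperp (w := (1 : ι → k)) (fun i => one_ne_zero) U
  rw [← hC, hbot, finrank_bot, zero_add, ← Module.finrank_fintype_fun_eq_card (R := k)] at h1
  exact Submodule.eq_top_of_finrank_eq h1

theorem Nonrational.ne_bot [Nonempty ι] {U : Submodule k (ι → k)} (h : Nonrational p U) :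
    U ≠ ⊥ := by
  rintro rfl
  have := h.eq_top (by
    intro u hu
    rw [(Submodule.mem_bot k).1 hu, pw_zero]
    exact Submodule.zero_mem _)
  exact bot_ne_top this

theorem Nonrational.finrank_pos [Nonempty ι] {U : Submodule k (ι → k)} (h : Nonrational p U) :
    0 < Module.finrank k U := by
  rw [Nat.pos_iff_ne_zero, Ne, Submodule.finrank_eq_zero]
  exact h.ne_bot

theorem finrank_le_of_le_wperp {w : ι → k} (hw : ∀ i, w i ≠ 0) {U U' : Submodule k (ι → k)}
    (h : U ≤ wperp w U') : Module.finrank k U + Module.finrank k U' ≤ Fintype.card ι := by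
  have h1 := finrank_wperp hw U'
  have h2 := Submodule.finrank_mono h
  omega

/-- Subspaces that are isotropic for the standard Hermitian form. -/
theorem Nonrational.hermitian [Nonempty ι] {U : Submodule k (ι → k)} (h : Nonrational p U)
    (hcard : Fintype.card ι ≤ 4) (hU : ∀ u ∈ U, ∀ v ∈ U, ∑ i, u i * v i ^ p = 0) :
    3 ≤ Fintype.card ι ∧ Module.finrank k U = 1 := by
  have hle : U ≤ wperp 1 (twist p 1 U) := by
    rintro u hu _ ⟨v, hv, rfl⟩
    have := hU u hu v hv
    simpa only [pw, Pi.one_apply, one_mul, mul_comm (u _), pow_one] using this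
  have h1 := finrank_le_of_le_wperp (fun i => one_ne_zero) hle
  have h2 := h.finrank_pos
  rw [finrank_twist] at h1
  -- In the half-dimensional case U is the orthogonal of its p-twist. Raising the isotropy relation
  -- to the p-th power then shows that U is stable under the p²-Frobenius, hence everything.
  have h3 : 2 * Module.finrank k U ≠ Fintype.card ι := by
    intro h3
    have heq : U = wperp 1 (twist p 1 U) := by
      refine Submodule.eq_of_le_of_finrank_eq hle ?_
      have := finrank_wperp (w := (1 : ι → k)) (fun i => one_ne_zero) (twist p 1 U)
      rw [finrank_twist] at this
      omega
    have htop := h.eq_top (by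
      intro v hv
      rw [heq]
      rintro _ ⟨u, hu, rfl⟩
      have h4 := congrArg (· ^ p ^ 1) (hU u hu v hv)
      simp only [sum_pow_p_pow] at h4
      rw [zero_pow (pow_pos (Fact.out : p.Prime).pos 1).ne'] at h4
      rw [← h4]
      refine Finset.sum_congr rfl fun i _ => ?_
      simp only [pw, Pi.one_apply, one_mul]
      rw [mul_pow, ← pow_mul, pow_one, sq])
    rw [htop, finrank_top, Module.finrank_fintype_fun_eq_card] at h3
    have := Fintype.card_pos (α := ι)
    omega
  omega

theorem Nonrational.le_sup_twist {U : Submodule k (ι → k)} (h : Nonrational p U) 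
    (heq : Module.finrank k U = Module.finrank k (U ⊔ twist p 2 U : Submodule k (ι → k))) :
    U = ⊤ := by
  have h1 : U = U ⊔ twist p 2 U := Submodule.eq_of_le_of_finrank_eq le_sup_left heq
  refine h.eq_top fun u hu => ?_
  rw [h1]
  exact Submodule.mem_sup_right ⟨u, hu, rfl⟩

/-- All products between U and its p²-twist are Frobenius powers of the two given ones, so the sum
of U and its twist is again Hermitian isotropic. Both spaces then have dimension 1, hence coincide,
and U would be everything. -/
theorem Nonrational.not_hermitian_hermitian [Nonempty ι] {U : Submodule k (ι → k)}
    (h : Nonrational p U) (hcard : Fintype.card ι ≤ 4)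
    (hU : ∀ u ∈ U, ∀ v ∈ U, ∑ i, u i * v i ^ p = 0)
    (hU' : ∀ u ∈ U, ∀ v ∈ U, ∑ i, u i * v i ^ p ^ 3 = 0) : False := by
  have hp0 := (Fact.out : p.Prime).pos
  have h1 := h.hermitian hcard hU
  have h2 := (h.mono (le_sup_left (b := twist p 2 U))).hermitian hcard (by
    intro x hx y hy
    obtain ⟨u, hu, _, ⟨a, ha, rfl⟩, rfl⟩ := Submodule.mem_sup.1 hx
    obtain ⟨v, hv, _, ⟨b, hb, rfl⟩, rfl⟩ := Submodule.mem_sup.1 hy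
    have e1 := hU u hu v hv
    have e2 := hU' u hu b hb
    have e3 := congrArg (· ^ p ^ 1) (hU v hv a ha)
    have e4 := congrArg (· ^ p ^ 2) (hU a ha b hb)
    simp only [sum_pow_p_pow] at e3 e4
    rw [zero_pow (pow_pos hp0 _).ne'] at e3 e4
    calc _ = (∑ i, u i * v i ^ p) + (∑ i, u i * b i ^ p ^ 3) + (∑ i, (v i * a i ^ p) ^ p ^ 1) +
          (∑ i, (a i * b i ^ p) ^ p ^ 2) := by
          rw [← Finset.sum_add_distrib, ← Finset.sum_add_distrib, ← Finset.sum_add_distrib]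
          refine Finset.sum_congr rfl fun i _ => ?_
          simp only [Pi.add_apply, pw]
          have := add_pow_p_pow (p := p) 1 (v i) (b i ^ p ^ 2)
          rw [pow_one] at this
          rw [this, mul_pow, mul_pow, pow_one, ← pow_mul, ← pow_mul, ← pow_mul, ← pow_succ,
            ← sq, ← pow_succ']
          ring
      _ = 0 := by rw [e1, e2, e3, e4]; simp)
  have h3 := h.le_sup_twist (h1.2.trans h2.2.symm)
  rw [h3, finrank_top, Module.finrank_fintype_fun_eq_card] at h1
  omega

/-- Subspaces that are isotropic for a quadratic form over `𝔽_{p²}`, together with their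
Frobenius twist. -/
theorem Nonrational.quadratic [Nonempty ι] {U : Submodule k (ι → k)} (h : Nonrational p U)
    (hcard : Fintype.card ι ≤ 4) {w : ι → k} (hw0 : ∀ i, w i ≠ 0) (hw : ∀ i, w i ^ p ^ 2 = w i)
    (hU : ∀ u ∈ U, ∀ v ∈ U, ∑ i, w i * u i * v i = 0)
    (hU' : ∀ u ∈ U, ∀ v ∈ U, ∑ i, w i * u i * v i ^ p ^ 2 = 0) :
    Fintype.card ι = 4 ∧ Module.finrank k U = 1 := by
  have hp0 := (Fact.out : p.Prime).pos
  -- The sum of U and its twist is totally isotropic, so it fills at most half of the space, and it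
  -- is strictly larger than U. At most four coordinates leave only dimensions 1 and 2 in dimension
  -- 4.
  have hle : U ⊔ twist p 2 U ≤ wperp w (U ⊔ twist p 2 U) := by
    intro x hx y hy
    obtain ⟨u, hu, _, ⟨a, ha, rfl⟩, rfl⟩ := Submodule.mem_sup.1 hx
    obtain ⟨v, hv, _, ⟨b, hb, rfl⟩, rfl⟩ := Submodule.mem_sup.1 hy
    have e1 := hU v hv u hu
    have e2 := hU' v hv a ha
    have e3 := hU' u hu b hb
    have e4 := congrArg (· ^ p ^ 2) (hU b hb a ha)
    simp only [sum_pow_p_pow] at e4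
    rw [zero_pow (pow_pos hp0 _).ne'] at e4
    calc _ = (∑ i, w i * v i * u i) + (∑ i, w i * v i * a i ^ p ^ 2) +
          (∑ i, w i * u i * b i ^ p ^ 2) + (∑ i, (w i * b i * a i) ^ p ^ 2) := by
          rw [← Finset.sum_add_distrib, ← Finset.sum_add_distrib, ← Finset.sum_add_distrib]
          refine Finset.sum_congr rfl fun i _ => ?_
          simp only [Pi.add_apply, pw]
          rw [mul_pow, mul_pow, hw]
          ring
      _ = 0 := by rw [e1, e2, e3, e4]; simp
  have h1 := finrank_le_of_le_wperp hw0 hle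
  have h2 := h.finrank_pos
  have h3 := Submodule.finrank_mono (le_sup_left (a := U) (b := twist p 2 U))
  have h4 : Module.finrank k U ≠ Module.finrank k (U ⊔ twist p 2 U : Submodule k (ι → k)) := by
    intro heq
    have h5 := h.le_sup_twist heq
    rw [← heq, h5, finrank_top, Module.finrank_fintype_fun_eq_card] at h1
    have := Fintype.card_pos (α := ι)
    omega
  omega

end Twist

end SymmDieudonne

namespace SymmDieudonne

/-! ### Quadratic forms over `𝔽_{p²}` of square discriminant -/

section Quadratic

variable {p : ℕ} [Fact p.Prime] {k : Type*} [Field k] [IsAlgClosed k] [CharP k p]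

theorem neg_pow_p_pow (j : ℕ) (a : k) : (-a) ^ p ^ j = -a ^ p ^ j := by
  simpa only [iterateFrobenius_def] using map_neg (iterateFrobenius k p j) a

/-- For odd p the number p² − 1 is divisible by 4, so the square roots of −1 lie in 𝔽_{p²}. -/
theorem exists_sq_eq_neg_one (hp : p ≠ 2) : ∃ f : k, f ^ 2 = -1 ∧ f ^ p ^ 2 = f := by
  obtain ⟨f, hf⟩ := IsAlgClosed.exists_pow_nat_eq (-1 : k) (by norm_num : 0 < 2)
  refine ⟨f, hf, ?_⟩
  obtain ⟨m, hm⟩ := (Fact.out : p.Prime).odd_of_ne_two hp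
  have : p ^ 2 = 4 * (m * m + m) + 1 := by rw [hm]; ring
  rw [this, pow_succ, pow_mul, show f ^ 4 = (f ^ 2) ^ 2 by ring, hf]
  simp

theorem exists_sq_root {x : k} (hx : x ^ p ^ 2 = x) :
    ∃ s : k, s ^ 2 = x ∧ (s ^ p ^ 2 = s ∨ s ^ p ^ 2 = -s) := by
  obtain ⟨s, hs⟩ := IsAlgClosed.exists_pow_nat_eq x (by norm_num : 0 < 2)
  refine ⟨s, hs, sq_eq_sq_iff_eq_or_eq_neg.1 ?_⟩
  rw [← pow_mul, mul_comm, pow_mul, hs, hx]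

/-- A binary form of square discriminant has no isotropic vectors outside the two rational
isotropic lines. -/
theorem Nonrational.not_binary (hp : p ≠ 2) {ι : Type*} [Fintype ι] [DecidableEq ι]
    {U : Submodule k (ι → k)} (h : Nonrational p U) {w : ι → k} (hw0 : ∀ i, w i ≠ 0)
    (hw : ∀ i, w i ^ p ^ 2 = w i) (hU : ∀ u ∈ U, ∀ v ∈ U, ∑ i, w i * u i * v i = 0)
    {i j : ι} (hij : i ≠ j) (hsum : ∀ f : ι → k, ∑ l, f l = f i + f j) {e : k}
    (he : e ^ 2 = w i * w j) (heq : e ^ p ^ 2 = e) : False := by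
  have hne : Nonempty ι := ⟨i⟩
  have hcard : Fintype.card ι = 2 := by
    have huniv : (Finset.univ : Finset ι) = {i, j} := by
      ext l
      simp only [Finset.mem_univ, Finset.mem_insert, Finset.mem_singleton, true_iff]
      by_contra hl
      push Not at hl
      have := hsum (Pi.single l 1)
      rw [Finset.sum_pi_single'] at this
      simp [hl.1.symm, hl.2.symm] at this
    rw [← Finset.card_univ, huniv, Finset.card_pair hij]
  have h1 := finrank_le_of_le_wperp hw0 (U := U) (U' := U) (fun u hu v hv => hU v hv u hu)
  have h2 := h.finrank_pos
  obtain ⟨u, hu, hu1⟩ := finrank_eq_one_iff'.1 (show Module.finrank k U = 1 by omega)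
  obtain ⟨f, hf, hfq⟩ := exists_sq_eq_neg_one (k := k) hp
  have h3 := hU u u.2 u u.2
  rw [hsum] at h3
  -- Isotropy multiplied by wᵢ, with −1 = f² and wᵢwⱼ = e². Taking square roots, wᵢuᵢ = ±f e uⱼ, a
  -- rational linear relation on the line U.
  have h4 : (w i * (u : ι → k) i) ^ 2 = (f * e * (u : ι → k) j) ^ 2 := by
    rw [mul_pow, mul_pow, mul_pow, hf, he]
    linear_combination w i * h3
  have key : ∀ s : k, s ^ p ^ 2 = s → w i * (u : ι → k) i = s * (u : ι → k) j → False := by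
    intro s hs hsu
    have h5 := h (Pi.single i (w i) + Pi.single j (-s)) (by
      intro l
      by_cases hl : l = i
      · subst hl
        simp [hij, hw]
      · by_cases hl' : l = j
        · subst hl'
          simp [hl, neg_pow_p_pow, hs]
        · simp [hl, hl', (Fact.out : p.Prime).ne_zero]) (by
      intro v hv
      obtain ⟨c, hc⟩ := hu1 ⟨v, hv⟩
      have hc' : v = c • (u : ι → k) := congrArg Subtype.val hc.symm
      rw [hsum, hc']
      simp only [Pi.add_apply, Pi.single_eq_same, Pi.single_eq_of_ne hij,
        Pi.single_eq_of_ne hij.symm, Pi.smul_apply, smul_eq_mul]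
      linear_combination c * hsu)
    have h6 := congrFun h5 i
    simp [hij] at h6
    exact hw0 i h6
  rcases sq_eq_sq_iff_eq_or_eq_neg.1 h4 with h5 | h5
  · exact key (f * e) (by rw [mul_pow, hfq, heq]) h5
  · exact key (-(f * e)) (by rw [neg_pow_p_pow, mul_pow, hfq, heq]) (by rw [h5]; ring)

/-- A quaternary form of square discriminant is hyperbolic. -/
theorem exists_hyperbolic_coordinates (hp : p ≠ 2) {w : Fin 4 → k} (hw0 : ∀ i, w i ≠ 0)
    (hw : ∀ i, w i ^ p ^ 2 = w i) {d : k} (hd : d ^ 2 = ∏ i, w i) (hdq : d ^ p ^ 2 = d) :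
    ∃ C : Matrix (Fin 4) (Fin 4) k, (∀ i j, C i j ^ p ^ 2 = C i j) ∧ IsUnit C.det ∧
      ∀ u v : Fin 4 → k, ∑ i, w i * u i * v i =
        C.mulVec u 0 * C.mulVec v 1 + C.mulVec u 1 * C.mulVec v 0 +
          C.mulVec u 2 * C.mulVec v 3 + C.mulVec u 3 * C.mulVec v 2 := by
  have h2 : (2 : k) ≠ 0 := two_ne_zero_of_odd hp
  have h2q : (2 : k) ^ p ^ 2 = 2 := by
    have := map_ofNat (iterateFrobenius k p 2) 2
    rwa [iterateFrobenius_def] at this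
  obtain ⟨f, hf, hfq⟩ := exists_sq_eq_neg_one (k := k) hp
  choose s hs hsq using fun i => exists_sq_root (hw i)
  have hs0 : ∀ i, s i ≠ 0 := by
    intro i h
    apply hw0 i
    rw [← hs, h]; ring
  -- it suffices to give two rational forms for each of two disjoint pairs of indices
  have pair : ∀ i j : Fin 4, (s i * s j) ^ p ^ 2 = s i * s j → ∃ a b c e : k,
      a ^ p ^ 2 = a ∧ b ^ p ^ 2 = b ∧ c ^ p ^ 2 = c ∧ e ^ p ^ 2 = e ∧
      ∀ x y x' y' : k, w i * x * x' + w j * y * y' =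
        (a * x + b * y) * (c * x' + e * y') + (c * x + e * y) * (a * x' + b * y') := by
    intro i j hij
    -- With g = f sᵢsⱼ one has g² = −wᵢwⱼ, so wᵢx² + wⱼy² = 2(wᵢx + gy)(x/2 − gy/(2wᵢ)). The four
    -- coefficients are read off from this factorisation.
    refine ⟨w i, f * (s i * s j), 2⁻¹, -(f * (s i * s j)) * (2 * w i)⁻¹, hw i, ?_, ?_, ?_, ?_⟩
    · rw [mul_pow, hfq, hij]
    · rw [inv_pow, h2q]
    · rw [mul_pow, neg_pow_p_pow, mul_pow f, hfq, hij, inv_pow, mul_pow, h2q, hw]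
    · intro x y x' y'
      have := hw0 i
      field_simp
      linear_combination (2 * y * y' * s i ^ 2 * s j ^ 2) * hf -
        (2 * y * y' * s j ^ 2) * hs i - (2 * y * y' * w i) * hs j
  have hunit : ∀ C : Matrix (Fin 4) (Fin 4) k, (∀ u v : Fin 4 → k, ∑ i, w i * u i * v i =
        C.mulVec u 0 * C.mulVec v 1 + C.mulVec u 1 * C.mulVec v 0 +
          C.mulVec u 2 * C.mulVec v 3 + C.mulVec u 3 * C.mulVec v 2) → IsUnit C.det := by
    intro C hC
    rw [isUnit_iff_ne_zero]
    intro h0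
    obtain ⟨u, hu0, hu⟩ := Matrix.exists_mulVec_eq_zero_iff.2 h0
    apply hu0
    ext i
    have h1 := hC u (Pi.single i 1)
    rw [hu] at h1
    simp only [Pi.single_apply, Pi.zero_apply, zero_mul, add_zero, mul_ite, mul_one, mul_zero,
      Finset.sum_ite_eq', Finset.mem_univ, if_true] at h1
    exact (mul_eq_zero.1 h1).resolve_left (hw0 i)
  have main : ∀ σ : Equiv.Perm (Fin 4), (s (σ 0) * s (σ 1)) ^ p ^ 2 = s (σ 0) * s (σ 1) →
      (s (σ 2) * s (σ 3)) ^ p ^ 2 = s (σ 2) * s (σ 3) → 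
      ∃ C : Matrix (Fin 4) (Fin 4) k, (∀ i j, C i j ^ p ^ 2 = C i j) ∧ 
      ∀ u v : Fin 4 → k, ∑ i, w i * u i * v i =
        C.mulVec u 0 * C.mulVec v 1 + C.mulVec u 1 * C.mulVec v 0 +
          C.mulVec u 2 * C.mulVec v 3 + C.mulVec u 3 * C.mulVec v 2 := by
    intro σ h01 h23
    obtain ⟨a, b, c, e, ha, hb, hc, he, hpol⟩ := pair _ _ h01
    obtain ⟨a', b', c', e', ha', hb', hc', he', hpol'⟩ := pair _ _ h23
    let C₀ : Matrix (Fin 4) (Fin 4) k := !![a, b, 0, 0; c, e, 0, 0; 0, 0, a', b'; 0, 0, c', e']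
    have h0q : (0 : k) ^ p ^ 2 = 0 := zero_pow (pow_pos (Fact.out : p.Prime).pos 2).ne'
    have hC₀ : ∀ i j, C₀ i j ^ p ^ 2 = C₀ i j := by
      intro i j
      fin_cases i <;> fin_cases j <;> simp only [C₀] <;> first | exact h0q | assumption
    have hmv : ∀ (u : Fin 4 → k) i, (C₀.submatrix id σ.symm).mulVec u i =
        C₀.mulVec (u ∘ σ) i := by
      intro u i
      simp only [Matrix.mulVec, dotProduct, Matrix.submatrix_apply, id, Function.comp]
      rw [← Equiv.sum_comp σ]
      simp
    refine ⟨C₀.submatrix id σ.symm, fun i j => hC₀ _ _, fun u v => ?_⟩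
    rw [← Equiv.sum_comp σ, Fin.sum_univ_four, hmv, hmv, hmv, hmv, hmv, hmv, hmv, hmv]
    have e1 := hpol (u (σ 0)) (u (σ 1)) (v (σ 0)) (v (σ 1))
    have e2 := hpol' (u (σ 2)) (u (σ 3)) (v (σ 2)) (v (σ 3))
    simp only [C₀, Matrix.mulVec, dotProduct, Fin.sum_univ_four, Function.comp,
      Matrix.of_apply, Matrix.cons_val]
    linear_combination e1 + e2
  suffices hmain : ∃ C : Matrix (Fin 4) (Fin 4) k, (∀ i j, C i j ^ p ^ 2 = C i j) ∧ 
      ∀ u v : Fin 4 → k, ∑ i, w i * u i * v i =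
        C.mulVec u 0 * C.mulVec v 1 + C.mulVec u 1 * C.mulVec v 0 +
          C.mulVec u 2 * C.mulVec v 3 + C.mulVec u 3 * C.mulVec v 2 by
    obtain ⟨C, h1, h2⟩ := hmain
    exact ⟨C, h1, hunit C h2, h2⟩
  -- The product of the sᵢ is ±d, hence fixed by the p²-Frobenius. So an even number of the sᵢ
  -- change sign, and the indices can be grouped in two pairs with fixed products; an odd sign
  -- pattern would equate a nonzero element with its negative.
  have hprod : (s 0 * s 1 * s 2 * s 3) ^ p ^ 2 = s 0 * s 1 * s 2 * s 3 := by
    have h5 : (s 0 * s 1 * s 2 * s 3) ^ 2 = d ^ 2 := by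
      rw [hd, Fin.prod_univ_four, ← hs, ← hs, ← hs, ← hs]; ring
    rcases sq_eq_sq_iff_eq_or_eq_neg.1 h5 with h6 | h6
    · rw [h6, hdq]
    · rw [h6, neg_pow_p_pow, hdq]
  have hnz : s 0 * s 1 * s 2 * s 3 ≠ 0 := by simp [hs0]
  have hchar : ∀ x : k, x ≠ 0 → x ≠ -x := by
    intro x hx h
    have : 2 * x = 0 := by linear_combination h
    exact (mul_ne_zero h2 hx) this
  rw [mul_pow, mul_pow, mul_pow] at hprod
  by_cases h01 : (s 0 * s 1) ^ p ^ 2 = s 0 * s 1 ∧ (s 2 * s 3) ^ p ^ 2 = s 2 * s 3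
  · exact main 1 h01.1 h01.2
  by_cases h02 : (s 0 * s 2) ^ p ^ 2 = s 0 * s 2 ∧ (s 1 * s 3) ^ p ^ 2 = s 1 * s 3
  · refine main (Equiv.swap 1 2) ?_ ?_
    · simpa [Equiv.swap_apply_def] using h02.1
    · simpa [Equiv.swap_apply_def] using h02.2
  by_cases h03 : (s 0 * s 3) ^ p ^ 2 = s 0 * s 3 ∧ (s 2 * s 1) ^ p ^ 2 = s 2 * s 1
  · refine main (Equiv.swap 1 3) ?_ ?_
    · simpa [Equiv.swap_apply_def] using h03.1
    · simpa [Equiv.swap_apply_def] using h03.2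
  exfalso
  rw [mul_pow, mul_pow] at h01 h02 h03
  rcases hsq 0 with e0 | e0 <;> rcases hsq 1 with e1 | e1 <;> rcases hsq 2 with e2 | e2 <;>
    rcases hsq 3 with e3 | e3 <;> rw [e0, e1, e2, e3] at hprod h01 h02 h03 <;>
    first
    | exact h01 ⟨by ring1, by ring1⟩
    | exact h02 ⟨by ring1, by ring1⟩
    | exact h03 ⟨by ring1, by ring1⟩
    | exact hchar _ hnz (by linear_combination -hprod)

theorem mulVec_pw {C : Matrix (Fin 4) (Fin 4) k} (hC : ∀ i j, C i j ^ p ^ 2 = C i j)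
    (u : Fin 4 → k) : C.mulVec (pw p 2 u) = pw p 2 (C.mulVec u) := by
  ext i
  simp only [Matrix.mulVec, dotProduct, pw]
  rw [sum_pow_p_pow]
  exact Finset.sum_congr rfl fun j _ => by rw [mul_pow, hC]

/-- The isotropic planes spanned by a line and its Frobenius twist contain a rational line. -/
theorem Nonrational.not_quaternary (hp : p ≠ 2) {U : Submodule k (Fin 4 → k)}
    (h : Nonrational p U) {w : Fin 4 → k} (hw0 : ∀ i, w i ≠ 0) (hw : ∀ i, w i ^ p ^ 2 = w i)
    {d : k} (hd : d ^ 2 = ∏ i, w i) (hdq : d ^ p ^ 2 = d)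
    (hU : ∀ u ∈ U, ∀ v ∈ U, ∑ i, w i * u i * v i = 0)
    (hU' : ∀ u ∈ U, ∀ v ∈ U, ∑ i, w i * u i * v i ^ p ^ 2 = 0) : False := by
  have h2 : (2 : k) ≠ 0 := two_ne_zero_of_odd hp
  obtain ⟨C, hC, hdet, hpol⟩ := exists_hyperbolic_coordinates hp hw0 hw hd hdq
  have hone := (h.quadratic (by simp) hw0 hw hU hU').2
  obtain ⟨u, hu, hu1⟩ := finrank_eq_one_iff'.1 hone
  have e1 := hU u u.2 u u.2
  have e2 := hU' u u.2 u u.2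
  rw [hpol] at e1
  have e2' : ∑ i, w i * (u : Fin 4 → k) i * pw p 2 (u : Fin 4 → k) i = 0 := e2
  rw [hpol, mulVec_pw hC] at e2'
  have key : ∀ t : Fin 4 → k, (∀ i, t i ^ p ^ 2 = t i) →
      ∑ i, t i * C.mulVec (u : Fin 4 → k) i = 0 → t = 0 := by
    intro t ht htu
    have h3 := h (Matrix.vecMul t C) (by
      intro j
      simp only [Matrix.vecMul, dotProduct]
      rw [sum_pow_p_pow]
      exact Finset.sum_congr rfl fun i _ => by rw [mul_pow, hC, ht]) (by
      intro v hv
      obtain ⟨c, hc⟩ := hu1 ⟨v, hv⟩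
      have hc' : v = c • (u : Fin 4 → k) := congrArg Subtype.val hc.symm
      change Matrix.vecMul t C ⬝ᵥ v = 0
      rw [hc', dotProduct_smul, ← Matrix.dotProduct_mulVec]
      rw [show t ⬝ᵥ C.mulVec (u : Fin 4 → k) = 0 from htu, smul_zero])
    by_contra ht0
    exact hdet.ne_zero (Matrix.exists_vecMul_eq_zero_iff.1 ⟨t, ht0, h3⟩)
  set x := C.mulVec (u : Fin 4 → k) with hx
  simp only [pw] at e2'
  have h0q : (0 : k) ^ p ^ 2 = 0 := zero_pow (pow_pos (Fact.out : p.Prime).pos 2).ne'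
  have hx0 : x 0 ≠ 0 := by
    intro h0
    have := congrFun (key (Pi.single 0 1 : Fin 4 → k) (by
      intro i
      by_cases hi : i = 0
      · subst hi; simp
      · simp [hi, (Fact.out : p.Prime).ne_zero]) (by
      simp only [Pi.single_apply, ite_mul, one_mul, zero_mul, Finset.sum_ite_eq', Finset.mem_univ,
        if_true]
      exact h0)) 0
    simp at this
  have e3 : x 0 * x 1 + x 2 * x 3 = 0 := by
    have : 2 * (x 0 * x 1 + x 2 * x 3) = 0 := by linear_combination e1
    exact (mul_eq_zero.1 this).resolve_left h2
  have e4 := congrArg (· ^ p ^ 2) e3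
  simp only [add_pow_p_pow, mul_pow] at e4
  rw [h0q] at e4
  -- Normalise x₀ = 1 and write x' for the twist. Isotropy gives x₁ = −x₂x₃, and orthogonality of x
  -- and x' becomes (x₂' − x₂)(x₃' − x₃) = 0. So x₂/x₀ or x₃/x₀ is rational.
  have e5 : (x 2 ^ p ^ 2 * x 0 - x 2 * x 0 ^ p ^ 2) * (x 3 ^ p ^ 2 * x 0 - x 3 * x 0 ^ p ^ 2) = 0 := by
    linear_combination x 0 ^ 2 * e4 + (x 0 ^ p ^ 2) ^ 2 * e3 - x 0 * x 0 ^ p ^ 2 * e2'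
  have key2 : ∀ j : Fin 4, j ≠ 0 → x j ^ p ^ 2 * x 0 - x j * x 0 ^ p ^ 2 = 0 → False := by
    intro j hj h5
    have ht : (x j / x 0) ^ p ^ 2 = x j / x 0 := by
      rw [div_pow, div_eq_div_iff (pow_ne_zero _ hx0) hx0]
      linear_combination h5
    have h6 := congrFun (key (Pi.single j 1 + Pi.single 0 (-(x j / x 0))) (by
      intro i
      by_cases hi : i = 0
      · subst hi
        simp [hj.symm, neg_pow_p_pow, ht]
      · by_cases hij : i = j
        · subst hij; simp [hi]
        · simp [hi, hij, (Fact.out : p.Prime).ne_zero]) (by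
      simp only [Pi.add_apply, add_mul, Finset.sum_add_distrib, Pi.single_apply, ite_mul, one_mul,
        zero_mul, Finset.sum_ite_eq', Finset.mem_univ, if_true]
      field_simp
      ring)) j
    simp [hj] at h6
  rcases mul_eq_zero.1 e5 with h5 | h5
  · exact key2 2 (by decide) h5
  · exact key2 3 (by decide) h5

/-- A maximal isotropic subspace of a hyperbolic quaternary form meets some rational maximal
isotropic subspace in a line. -/
theorem exists_rational_plane (hp : p ≠ 2) {U : Submodule k (Fin 4 → k)}
    {w : Fin 4 → k} (hw0 : ∀ i, w i ≠ 0) (hw : ∀ i, w i ^ p ^ 2 = w i)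
    {d : k} (hd : d ^ 2 = ∏ i, w i) (hdq : d ^ p ^ 2 = d) (hU : wperp w U = U) :
    ∃ Q : Submodule k (Fin 4 → k), (∀ u, pw p 2 u ∈ Q ↔ u ∈ Q) ∧ wperp w Q = Q ∧
      ∃ u₀ ∈ U, u₀ ∉ Q ∧ ∀ u ∈ U, ∃ c : k, u - c • u₀ ∈ Q := by
  have h2 : (2 : k) ≠ 0 := two_ne_zero_of_odd hp
  obtain ⟨C, hC, hdet, hpol⟩ := exists_hyperbolic_coordinates hp hw0 hw hd hdq
  have h0q : ∀ x : k, x ^ p ^ 2 = 0 ↔ x = 0 :=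
    fun x => pow_eq_zero_iff (pow_pos (Fact.out : p.Prime).pos 2).ne'
  have hsurj : ∀ x, ∃ u, C.mulVec u = x := fun x =>
    ⟨C⁻¹.mulVec x, by rw [Matrix.mulVec_mulVec, Matrix.mul_nonsing_inv _ hdet, Matrix.one_mulVec]⟩
  have hinj : ∀ u, C.mulVec u = 0 → u = 0 := by
    intro u hu
    have := congrArg (C⁻¹.mulVec) hu
    rwa [Matrix.mulVec_mulVec, Matrix.nonsing_inv_mul _ hdet, Matrix.one_mulVec,
      Matrix.mulVec_zero] at this
  let l : Fin 4 → (Fin 4 → k) →ₗ[k] k := fun j => (LinearMap.proj j).comp C.mulVecLin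
  have hl : ∀ j u, l j u = C.mulVec u j := fun _ _ => rfl
  have hrank : Module.finrank k U = 2 := by
    have := finrank_wperp hw0 U
    rw [hU, Fintype.card_fin] at this
    omega
  have hiso : ∀ u ∈ U, ∀ v ∈ U, l 0 u * l 1 v + l 1 u * l 0 v + l 2 u * l 3 v + l 3 u * l 2 v
      = 0 := by
    intro u hu v hv
    rw [← hU] at hv
    rw [← hv u hu, hpol]; rfl
  have hself : ∀ u ∈ U, l 0 u * l 1 u + l 2 u * l 3 u = 0 := by
    intro u hu
    have : 2 * (l 0 u * l 1 u + l 2 u * l 3 u) = 0 := by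
      linear_combination hiso u hu u hu
    exact (mul_eq_zero.1 this).resolve_left h2
  -- the two rational planes
  have plane : ∀ a b : Fin 4, (a = 2 ∧ b = 3 ∨ a = 3 ∧ b = 2) →
      (∃ u₀ ∈ U, (l 1 u₀ ≠ 0 ∨ l a u₀ ≠ 0) ∧ ∀ u ∈ U, ∃ c : k, l 1 (u - c • u₀) = 0 ∧
        l a (u - c • u₀) = 0) →
      ∃ Q : Submodule k (Fin 4 → k), (∀ u, pw p 2 u ∈ Q ↔ u ∈ Q) ∧ wperp w Q = Q ∧
      ∃ u₀ ∈ U, u₀ ∉ Q ∧ ∀ u ∈ U, ∃ c : k, u - c • u₀ ∈ Q := by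
    intro a b hab h
    let Q := LinearMap.ker (l 1) ⊓ LinearMap.ker (l a)
    have hQ : ∀ u, u ∈ Q ↔ l 1 u = 0 ∧ l a u = 0 := fun u => Iff.rfl
    have hpol' : ∀ u v, ∑ i, w i * u i * v i =
        l 0 u * l 1 v + l 1 u * l 0 v + l a u * l b v + l b u * l a v := by
      intro u v
      rw [hpol]
      rcases hab with ⟨rfl, rfl⟩ | ⟨rfl, rfl⟩
      · rfl
      · rw [hl, hl, hl, hl, hl, hl, hl, hl]; ring
    have hb1 : (1 : Fin 4) ≠ b ∧ a ≠ b ∧ a ≠ 0 ∧ b ≠ 0 := by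
      rcases hab with ⟨rfl, rfl⟩ | ⟨rfl, rfl⟩ <;> decide
    refine ⟨Q, fun u => ?_, ?_, ?_⟩
    · rw [hQ, hQ, hl, hl, hl, hl, mulVec_pw hC]
      exact and_congr (h0q _) (h0q _)
    · ext v
      rw [mem_wperp, hQ]
      constructor
      · intro hv
        obtain ⟨x, hx⟩ := hsurj (Pi.single 0 1)
        obtain ⟨y, hy⟩ := hsurj (Pi.single b 1)
        have h1 := hv x ((hQ x).2 ⟨by simp [hl, hx], by simp [hl, hx, hb1.2.2.1]⟩)
        have h2 := hv y ((hQ y).2 ⟨by simp [hl, hy, hb1.1], by simp [hl, hy, hb1.2.1]⟩)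
        rw [hpol'] at h1 h2
        simp [hl, hx, hb1] at h1
        simp [hl, hy, hb1, hb1.2.2.2.symm] at h2
        exact ⟨h1, h2⟩
      · rintro ⟨h1, h2⟩ u hu
        rw [hQ] at hu
        rw [hpol', h1, h2, hu.1, hu.2]; ring
    · obtain ⟨u₀, hu₀, hne, hu⟩ := h
      refine ⟨u₀, hu₀, fun h => ?_, fun u hu' => ?_⟩
      · rw [hQ] at h
        exact hne.elim (fun h' => h' h.1) (fun h' => h' h.2)
      · obtain ⟨c, hc⟩ := hu u hu'
        exact ⟨c, (hQ _).2 hc⟩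
  let f : U →ₗ[k] (Fin 2 → k) := LinearMap.pi ![(l 1).comp U.subtype, (l 2).comp U.subtype]
  have hf0 : ∀ u, f u 0 = l 1 u := fun _ => rfl
  have hf1 : ∀ u, f u 1 = l 2 u := fun _ => rfl
  have hrange : Module.finrank k (LinearMap.range f) ≤ 2 := by
    have := Submodule.finrank_le (LinearMap.range f)
    rwa [Module.finrank_fin_fun] at this
  -- The rank of (l₁, l₂) on U measures its intersection with the rational plane l₁ = l₂ = 0. Rank 1
  -- means a line. In ranks 0 and 2 the plane l₁ = l₃ = 0, from the opposite family, meets U in a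
  -- line instead.
  interval_cases hr : Module.finrank k (LinearMap.range f)
  · have hf : ∀ u : U, l 1 u = 0 ∧ l 2 u = 0 := by
      intro u
      have h3 := Submodule.finrank_eq_zero.1 hr
      have h4 : f u = 0 := by
        rw [LinearMap.range_eq_bot.1 h3]; rfl
      exact ⟨by rw [← hf0, h4]; rfl, by rw [← hf1, h4]; rfl⟩
    refine plane 3 2 (Or.inr ⟨rfl, rfl⟩) ?_
    obtain ⟨u₀, hu₀, hne⟩ : ∃ u₀ ∈ U, l 3 u₀ ≠ 0 := by
      by_contra hcon
      push Not at hcon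
      have hinj0 : Function.Injective ((l 0).comp U.subtype) := by
        rw [injective_iff_map_eq_zero]
        intro u hu
        refine Subtype.ext (hinj _ ?_)
        ext j
        fin_cases j
        · exact hu
        · exact (hf u).1
        · exact (hf u).2
        · exact hcon u u.2
      have := LinearMap.finrank_le_finrank_of_injective hinj0
      rw [hrank, Module.finrank_self] at this
      omega
    refine ⟨u₀, hu₀, Or.inr hne, fun u hu => ⟨l 3 u / l 3 u₀, ?_, ?_⟩⟩
    · rw [map_sub, map_smul, (hf ⟨u, hu⟩).1, (hf ⟨u₀, hu₀⟩).1]; simp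
    · rw [map_sub, map_smul, smul_eq_mul, div_mul_cancel₀ _ hne, sub_self]
  · refine plane 2 3 (Or.inl ⟨rfl, rfl⟩) ?_
    obtain ⟨⟨_, u₀, rfl⟩, hv, hv1⟩ := finrank_eq_one_iff'.1 hr
    refine ⟨u₀, u₀.2, ?_, fun u hu => ?_⟩
    · by_contra hcon
      push Not at hcon
      apply hv
      refine Subtype.ext (funext fun j => ?_)
      fin_cases j
      · exact hcon.1
      · exact hcon.2
    · obtain ⟨c, hc⟩ := hv1 ⟨f ⟨u, hu⟩, _, rfl⟩
      have hc' : c • f u₀ = f ⟨u, hu⟩ := congrArg Subtype.val hc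
      refine ⟨c, ?_, ?_⟩
      · rw [map_sub, map_smul, sub_eq_zero]
        exact (congrFun hc' 0).symm
      · rw [map_sub, map_smul, sub_eq_zero]
        exact (congrFun hc' 1).symm
  · have hfs : Function.Surjective f := by
      rw [← LinearMap.range_eq_top]
      exact Submodule.eq_top_of_finrank_eq (by rw [hr, Module.finrank_fin_fun])
    have hfi : Function.Injective f :=
      (LinearMap.injective_iff_surjective_of_finrank_eq_finrank
        (by rw [hrank, Module.finrank_fin_fun])).2 hfs
    obtain ⟨u, hu⟩ := hfs ![1, 0]
    obtain ⟨v, hv⟩ := hfs ![0, 1]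
    have hu0 : l 1 u = 1 := by rw [← hf0, hu]; rfl
    have hu1 : l 2 u = 0 := by rw [← hf1, hu]; rfl
    have hv0 : l 1 v = 0 := by rw [← hf0, hv]; rfl
    have hv1 : l 2 v = 1 := by rw [← hf1, hv]; rfl
    -- Isotropy of v reads l₀l₁ + l₂l₃ = 0, and here l₁ = 0 and l₂ = 1. So v spans the intersection
    -- of U with l₁ = l₃ = 0.
    have hv3 : l 3 v = 0 := by
      have := hself v v.2
      rw [hv0, hv1] at this
      linear_combination this
    refine plane 3 2 (Or.inr ⟨rfl, rfl⟩) ⟨u, u.2, Or.inl (by rw [hu0]; exact one_ne_zero), ?_⟩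
    intro x hx
    have hx' : (⟨x, hx⟩ : U) = l 1 x • u + l 2 x • v := by
      apply hfi
      ext j
      fin_cases j
      · change l 1 x = l 1 (l 1 x • (u : Fin 4 → k) + l 2 x • (v : Fin 4 → k))
        rw [map_add, map_smul, map_smul, hu0, hv0]; simp
      · change l 2 x = l 2 (l 1 x • (u : Fin 4 → k) + l 2 x • (v : Fin 4 → k))
        rw [map_add, map_smul, map_smul, hu1, hv1]; simp
    have hx2 : x = l 1 x • (u : Fin 4 → k) + l 2 x • (v : Fin 4 → k) := congrArg Subtype.val hx'
    have hx3 : x - l 1 x • (u : Fin 4 → k) = l 2 x • (v : Fin 4 → k) := by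
      rw [sub_eq_iff_eq_add']; exact hx2
    refine ⟨l 1 x, ?_, ?_⟩
    · rw [hx3, map_smul, hv0, smul_zero]
    · rw [hx3, map_smul, hv3, smul_zero]

end Quadratic

end SymmDieudonne

namespace SymmDieudonne

/-! ### Equations over the fraction field -/

section Equations

variable {p : ℕ} [Fact p.Prime] {k : Type*} [Field k] [IsAlgClosed k] [CharP k p]

theorem red_ne_zero_algebraMap {w : WittVector p k}
    (h : red (algebraMap (WittVector p k) K(p, k) w) ≠ 0) : WittVector.constantCoeff w ≠ 0 := by
  rwa [red_algebraMap] at h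

theorem exists_quadratic_root' {A B C : K(p, k)} (hA : A ∈ intRing p k) (hB : B ∈ intRing p k)
    (hC : C ∈ intRing p k) (hB0 : red B ≠ 0) :
    ∃ c ∈ intRing p k, A + B * c + p * C * c ^ 2 = 0 := by
  obtain ⟨A, rfl⟩ := hA
  obtain ⟨B, rfl⟩ := hB
  obtain ⟨C, rfl⟩ := hC
  obtain ⟨c, hc⟩ := exists_quadratic_root A B C (red_ne_zero_algebraMap hB0)
  refine ⟨_, ⟨c, rfl⟩, ?_⟩
  have := congrArg (algebraMap (WittVector p k) K(p, k)) hc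
  simpa only [map_add, map_mul, map_pow, map_natCast, map_zero] using this

theorem quadratic_root_unique' {A B C c d : K(p, k)} (hB : B ∈ intRing p k)
    (hC : C ∈ intRing p k) (hB0 : red B ≠ 0) (hc : c ∈ intRing p k) (hd : d ∈ intRing p k)
    (hc0 : A + B * c + p * C * c ^ 2 = 0) (hd0 : A + B * d + p * C * d ^ 2 = 0) : c = d := by
  have h : (B + p * (C * (c + d))) * (c - d) = 0 := by linear_combination hc0 - hd0
  rcases mul_eq_zero.1 h with h | h
  · refine absurd ?_ hB0
    have := congrArg red h
    rwa [red_add hB (mul_mem p_mem (mul_mem hC (add_mem hc hd))),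
      red_p_mul (mul_mem hC (add_mem hc hd)), add_zero, red_zero] at this
  · exact sub_eq_zero.1 h

theorem exists_norm_eq' (hp : p ≠ 2) {w : K(p, k)} (hw : w ∈ intRing p k) (hw0 : red w ≠ 0)
    (hfix : WittVector.FractionRing.frobenius p k w = w) :
    ∃ u ∈ intRing p k, u * WittVector.FractionRing.frobenius p k u = w := by
  obtain ⟨w, rfl⟩ := hw
  rw [frobenius_algebraMap] at hfix
  obtain ⟨u, hu⟩ := exists_norm_eq hp w (red_ne_zero_algebraMap hw0)
    (algebraMap_witt_injective hfix)
  exact ⟨_, ⟨u, rfl⟩, by rw [frobenius_algebraMap, ← map_mul, hu]⟩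

theorem red_two (hp : p ≠ 2) : red (2 : K(p, k)) ≠ 0 := by
  rw [← map_ofNat (algebraMap (WittVector p k) K(p, k)) 2, red_algebraMap, map_ofNat]
  exact two_ne_zero_of_odd hp

theorem two_mem : (2 : K(p, k)) ∈ intRing p k := ⟨2, map_ofNat _ 2⟩

end Equations

/-! ### Diagonalization -/

section Diagonalization

variable {p : ℕ} [Fact p.Prime] {k : Type*} [Field k] [IsAlgClosed k] [CharP k p]
variable {E : Type*} [AddCommGroup E] [WittVector.Isocrystal p k E]

variable (p k) in
/-- A vector `x` such that `x, Fx` span a module in normal form of the first type. -/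
def IsEvenVec (φ : LinearMap.BilinForm K(p, k) E) (x : E) (n : ℤ) : Prop :=
  φ x x = 0 ∧ φ x (frob p k x) = (p : K(p, k)) ^ n

variable (p k) in
/-- A vector `x` such that `x, Fx` span a module in normal form of the second type. -/
def IsOddVec (φ : LinearMap.BilinForm K(p, k) E) (x : E) (n : ℤ) (ε : K(p, k)) : Prop :=
  φ x (frob p k x) = 0 ∧ φ x x = ε * (p : K(p, k)) ^ n ∧ ε ∈ intRing p k ∧ red ε ≠ 0 ∧
    WittVector.FractionRing.frobenius p k (WittVector.FractionRing.frobenius p k ε) = ε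

variable (p k) in
/-- A fixed vector `x` such that `x, Fx` span a module in normal form. -/
def IsNormalVec (φ : LinearMap.BilinForm K(p, k) E) (x : E) : Prop :=
  psi p k x = x ∧ ∃ n : ℤ, IsEvenVec p k φ x n ∨ ∃ ε, IsOddVec p k φ x n ε

variable {φ : LinearMap.BilinForm K(p, k) E} (hφ : IsPairing p k φ)
  (hsymm : ∀ x y : E, φ x y = φ y x)
include hφ

theorem IsPairing.apply_frob_of_fixed {x : E} (hx : psi p k x = x) (y : E) :
    φ x (frob p k y) = WittVector.FractionRing.frobenius p k (φ (frob p k x) y) := by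
  rw [hφ, (psi_eq_self_iff_ver p k x).1 hx]

include hsymm

/-- Adjunction gives φ(x, Fx) = σφ(Fx, x) when Vx = Fx, and symmetry identifies the two pairings. -/
theorem IsPairing.frobenius_apply_frob_self {x : E} (hx : psi p k x = x) :
    WittVector.FractionRing.frobenius p k (φ x (frob p k x)) = φ x (frob p k x) := by
  conv_rhs => rw [hφ.apply_frob_of_fixed hx, hsymm]

/-- The form on a vector `x + c Fx`. -/
theorem IsPairing.apply_add_smul_frob {x : E} (hx : psi p k x = x) (c : K(p, k)) :
    φ (x + c • frob p k x) (x + c • frob p k x) = φ x x + 2 * φ x (frob p k x) * c +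
      p * WittVector.FractionRing.frobenius p k (φ x x) * c ^ 2 ∧
    φ (x + c • frob p k x) (frob p k (x + c • frob p k x)) = φ x (frob p k x) +
      p * (WittVector.FractionRing.frobenius p k c * φ x x +
        c * WittVector.FractionRing.frobenius p k (φ x x)) +
      p * (c * WittVector.FractionRing.frobenius p k c) * φ x (frob p k x) := by
  have h1 := hφ.frob_frob x x
  have h2 := hsymm (frob p k x) x
  constructor
  · simp only [map_add, map_smul, LinearMap.add_apply, LinearMap.smul_apply, smul_eq_mul, h1, h2]
    ring
  · rw [map_add (frob p k), frob_smul', frob_frob_of_psi p k hx]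
    simp only [map_add, map_smul, LinearMap.add_apply, LinearMap.smul_apply, smul_eq_mul, h1, h2]
    ring

variable [Module (WittVector p k) E] [IsScalarTower (WittVector p k) K(p, k) E]

/-- A lattice on which `φ` is nondegenerate contains a vector in normal form spanning, together
with its image under `F`, an orthogonal direct summand. -/
theorem exists_normal_summand (hp : p ≠ 2) {L : Submodule (WittVector p k) E}
    (hspan : Submodule.span (WittVector p k) {x | x ∈ L ∧ psi p k x = x} = L)
    (hF : ∀ x ∈ L, frob p k x ∈ L) (hne : L ≠ ⊥)
    (hnd : ∀ x ∈ L, (∀ y ∈ L, φ x y = 0) → x = 0)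
    (hbdd : ∃ a : ℤ, ∀ x ∈ L, ∀ y ∈ L, (p : K(p, k)) ^ a * φ x y ∈ intRing p k) :
    ∃ x ∈ L, IsNormalVec p k φ x ∧ ∃ x' y' : E, psi p k x' = x' ∧ psi p k y' = y' ∧
      φ x x' = 1 ∧ φ (frob p k x) x' = 0 ∧ φ x y' = 0 ∧ φ (frob p k x) y' = 1 ∧
      (∀ l ∈ L, φ l x' ∈ intRing p k ∧ φ l y' ∈ intRing p k) ∧
      ∀ z, (φ z x' = 0 ∧ φ z y' = 0) ↔ (φ z x = 0 ∧ φ z (frob p k x) = 0) := by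
  have hp0 : (p : K(p, k)) ≠ 0 := p_ne_zero
  have hLmem : ∀ {a : K(p, k)} {x : E}, a ∈ intRing p k → x ∈ L → a • x ∈ L :=
    fun ha hx => smul_mem_of_mem ha hx
  -- bounds on `φ` can be checked on fixed vectors
  have hext1 : ∀ (c : K(p, k)) (y : E),
      (∀ x ∈ L, psi p k x = x → c * φ x y ∈ intRing p k) → ∀ x ∈ L, c * φ x y ∈ intRing p k := by
    intro c y h x hx
    rw [← hspan] at hx
    induction hx using Submodule.span_induction with
    | mem x hx => exact h x hx.1 hx.2
    | zero => simp
    | add a b _ _ ha hb =>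
      rw [map_add, LinearMap.add_apply, mul_add]
      exact add_mem ha hb
    | smul w a _ ha =>
      rw [witt_smul_eq, map_smul, LinearMap.smul_apply, smul_eq_mul, mul_left_comm]
      exact mul_mem ⟨w, rfl⟩ ha
  have hext : ∀ c : K(p, k),
      (∀ x ∈ L, psi p k x = x → ∀ y ∈ L, psi p k y = y → c * φ x y ∈ intRing p k) →
      ∀ x ∈ L, ∀ y ∈ L, c * φ x y ∈ intRing p k := by
    intro c h x hx y hy
    refine hext1 c y (fun x hx hx' => ?_) x hx
    rw [hsymm]
    refine hext1 c x (fun y hy hy' => ?_) y hy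
    rw [hsymm]
    exact h x hx hx' y hy hy'
  -- the scale of the lattice
  obtain ⟨s, hs, hs'⟩ : ∃ s : ℤ, (∀ x ∈ L, ∀ y ∈ L, (p : K(p, k)) ^ (-s) * φ x y ∈ intRing p k) ∧
      ¬ ∀ x ∈ L, ∀ y ∈ L, (p : K(p, k)) ^ (-(s + 1)) * φ x y ∈ intRing p k := by
    obtain ⟨a, ha⟩ := hbdd
    obtain ⟨x, hx, hx0⟩ := Submodule.exists_mem_ne_zero_of_ne_bot hne
    obtain ⟨y, hy, hxy⟩ : ∃ y ∈ L, φ x y ≠ 0 := by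
      by_contra hcon
      push Not at hcon
      exact hx0 (hnd x hx hcon)
    obtain ⟨m, u, hu, hm⟩ := exists_eq_zpow_mul hxy
    obtain ⟨s, hs, hmax⟩ := Int.exists_greatest_of_bdd
      (P := fun s => ∀ x ∈ L, ∀ y ∈ L, (p : K(p, k)) ^ (-s) * φ x y ∈ intRing p k)
      ⟨m, fun z hz => by
        have := hz x hx y hy
        rw [hm, ← mul_assoc, ← zpow_add₀ hp0, zpow_mul_unit_mem_iff hu] at this
        omega⟩ ⟨-a, by simpa using ha⟩
    exact ⟨s, hs, fun h => by have := hmax _ h; omega⟩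
  obtain ⟨ψ, hψ⟩ : ∃ ψ : E → E → K(p, k), ∀ x y, ψ x y = (p : K(p, k)) ^ (-s) * φ x y :=
    ⟨_, fun _ _ => rfl⟩
  simp only [← hψ] at hs
  have hpow : ∀ x y, (p : K(p, k)) ^ (-(s + 1)) * φ x y = (p : K(p, k))⁻¹ * ψ x y := by
    intro x y
    rw [hψ, ← mul_assoc, ← zpow_neg_one, ← zpow_add₀ hp0]
    congr 2; ring
  have hps : WittVector.FractionRing.frobenius p k ((p : K(p, k)) ^ (-s)) = (p : K(p, k)) ^ (-s) := by
    rw [map_zpow₀, frobenius_p]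
  have hcancel : ∀ a : K(p, k), (p : K(p, k)) ^ s * ((p : K(p, k)) ^ (-s) * a) = a := by
    intro a
    rw [← mul_assoc, ← zpow_add₀ hp0, add_neg_cancel, zpow_zero, one_mul]
  set σ := WittVector.FractionRing.frobenius p k with hσ
  have hψfix : ∀ {x y : E}, psi p k x = x → psi p k y = y → σ (σ (ψ x y)) = ψ x y := by
    intro x y hx hy
    rw [hψ, map_mul, map_mul, hps, hps, hφ.fixed_fixed hx hy]
  have hψself : ∀ {x : E}, psi p k x = x → σ (ψ x (frob p k x)) = ψ x (frob p k x) := by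
    intro x hx
    rw [hψ, map_mul, hps, hφ.frobenius_apply_frob_self hsymm hx]
  have hφψ : ∀ x y, φ x y = (p : K(p, k)) ^ s * ψ x y := fun x y => by rw [hψ, hcancel]
  have hψc : ∀ {x : E}, psi p k x = x → ∀ c, 
      ψ (x + c • frob p k x) (x + c • frob p k x) = ψ x x + 2 * ψ x (frob p k x) * c +
        p * σ (ψ x x) * c ^ 2 ∧
      ψ (x + c • frob p k x) (frob p k (x + c • frob p k x)) = ψ x (frob p k x) +
        p * (σ c * ψ x x + c * σ (ψ x x)) + p * (c * σ c) * ψ x (frob p k x) := by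
    intro x hx c
    obtain ⟨h1, h2⟩ := hφ.apply_add_smul_frob hsymm hx c
    simp only [hψ, h1, h2, map_mul, hps]
    constructor <;> ring
  have hfixc : ∀ {x : E} {c : K(p, k)}, psi p k x = x → σ (σ c) = c →
      psi p k (x + c • frob p k x) = x + c • frob p k x := by
    intro x c hx hc
    rw [map_add, psi_smul', hx, psi_frob_of_psi p k hx, hc]
  -- If some φ(x, Fy) attains the scale pˢ, a plane of the first type splits off; otherwise some
  -- φ(x, x) attains it and a plane of the second type splits off.
  by_cases hcase : ∃ x ∈ L, psi p k x = x ∧ ∃ y ∈ L, psi p k y = y ∧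
      red (ψ x (frob p k y)) ≠ 0
  · obtain ⟨x, hx, hxf, hxu⟩ : ∃ x ∈ L, psi p k x = x ∧ red (ψ x (frob p k x)) ≠ 0 := by
      obtain ⟨x, hx, hxf, y, hy, hyf, hxy⟩ := hcase
      by_contra hcon
      push Not at hcon
      have hyx : ψ x (frob p k y) = σ (ψ y (frob p k x)) := by
        rw [hψ, hψ, map_mul, hps, hsymm y, hφ.apply_frob_of_fixed hxf]
      have hmem := hs _ hy _ (hF x hx)
      have htmem := hs _ hx _ (hF y hy)
      set t := red (ψ y (frob p k x)) with ht
      have ht' : red (ψ x (frob p k y)) = t ^ p := by rw [hyx, red_frobenius hmem]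
      have ht0 : t ≠ 0 := by
        intro h
        rw [ht', h, zero_pow (Fact.out : p.Prime).ne_zero] at hxy
        exact hxy rfl
      have htq : t ^ p ^ 2 = t := by
        rw [sq, pow_mul, ← ht', ← red_frobenius htmem, hyx,
          hψfix hyf (psi_frob_of_psi p k hxf)]
      -- Polarisation: if the diagonal values of x and y vanish modulo p, the value at x + cy
      -- reduces to (ct)^p + ct = 2.
      obtain ⟨c, hc, hct, hcf⟩ := intRing_fixed_lift (p := p) (k := k) (c := t⁻¹)
        (by rw [inv_pow, htq])
      have hz := hcon (x + c • y) (L.add_mem hx (hLmem hc hy))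
        (by rw [map_add, psi_smul', hxf, hyf, hcf])
      have hexp : ψ (x + c • y) (frob p k (x + c • y)) = ψ x (frob p k x) +
          (σ c * ψ x (frob p k y) + (c * ψ y (frob p k x) + c * σ c * ψ y (frob p k y))) := by
        rw [map_add (frob p k), frob_smul']
        simp only [hψ, map_add, map_smul, LinearMap.add_apply, LinearMap.smul_apply, smul_eq_mul]
        ring
      have hσc : σ c ∈ intRing p k := frobenius_mem_iff.2 hc
      have hxx := hs _ hx _ (hF x hx)
      have hyy := hs _ hy _ (hF y hy)
      rw [hexp, red_add hxx (add_mem (mul_mem hσc htmem) (add_mem (mul_mem hc hmem)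
        (mul_mem (mul_mem hc hσc) hyy))), red_add (mul_mem hσc htmem) (add_mem (mul_mem hc hmem)
        (mul_mem (mul_mem hc hσc) hyy)), red_add (mul_mem hc hmem)
        (mul_mem (mul_mem hc hσc) hyy), red_mul hσc htmem, red_mul hc hmem,
        red_mul (mul_mem hc hσc) hyy, hcon x hx hxf, hcon y hy hyf, red_frobenius hc, hct,
        ht', ← ht, ← mul_pow, inv_mul_cancel₀ ht0, one_pow, mul_zero, add_zero, zero_add] at hz
      exact two_ne_zero_of_odd (k := k) hp (by linear_combination hz)
    have ha := hs _ hx _ hx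
    have hb := hs _ hx _ (hF x hx)
    have hσa : σ (ψ x x) ∈ intRing p k := frobenius_mem_iff.2 ha
    have h2b : red (2 * ψ x (frob p k x)) ≠ 0 := by
      rw [red_mul two_mem hb]
      exact mul_ne_zero (red_two hp) hxu
    -- A root makes x + cFx isotropic. The equation has σ²-fixed coefficients, so uniqueness of its
    -- root gives σ²c = c and the new vector is still ψ-fixed.
    obtain ⟨c, hc, hc0⟩ := exists_quadratic_root' ha (mul_mem two_mem hb) hσa h2b
    have hcf : σ (σ c) = c := by
      refine quadratic_root_unique' (mul_mem two_mem hb) hσa h2b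
        (frobenius_mem_iff.2 (frobenius_mem_iff.2 hc)) hc ?_ hc0
      have := congrArg (fun z => σ (σ z)) hc0
      simpa only [map_add, map_mul, map_pow, map_ofNat, map_natCast, map_zero,
        hψfix hxf hxf, hψself hxf] using this
    set x₁ := x + c • frob p k x with hx₁
    have hx₁L : x₁ ∈ L := L.add_mem hx (hLmem hc (hF x hx))
    have hx₁f : psi p k x₁ = x₁ := hfixc hxf hcf
    obtain ⟨hq1, hq2⟩ := hψc hxf c
    rw [hc0] at hq1
    have hb₁ : ψ x₁ (frob p k x₁) ∈ intRing p k := hs _ hx₁L _ (hF _ hx₁L)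
    have hσc : σ c ∈ intRing p k := frobenius_mem_iff.2 hc
    have hb₁0 : red (ψ x₁ (frob p k x₁)) ≠ 0 := by
      rw [hq2, add_assoc, mul_assoc (p : K(p, k)), ← mul_add, red_add hb, red_p_mul, add_zero]
      · exact hxu
      · exact add_mem (add_mem (mul_mem hσc ha) (mul_mem hc hσa)) (mul_mem (mul_mem hc hσc) hb)
      · exact mul_mem p_mem
          (add_mem (add_mem (mul_mem hσc ha) (mul_mem hc hσa)) (mul_mem (mul_mem hc hσc) hb))
    have hb₁n : ψ x₁ (frob p k x₁) ≠ 0 := by rintro h; rw [h, red_zero] at hb₁0; exact hb₁0 rfl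
    have hinv := inv_mem_of_red_ne_zero hb₁ hb₁0
    have hinv0 : red (ψ x₁ (frob p k x₁))⁻¹ ≠ 0 := by
      intro h
      have := red_mul hb₁ hinv
      rw [mul_inv_cancel₀ hb₁n, red_one, h, mul_zero] at this
      exact one_ne_zero this
    have hinvf : σ (ψ x₁ (frob p k x₁))⁻¹ = (ψ x₁ (frob p k x₁))⁻¹ := by
      rw [map_inv₀, hψself hx₁f]
    -- Scaling x₁ by u multiplies φ(x₁, Fx₁) by uσ(u), so this norm equation normalises the value to
    -- pˢ.
    obtain ⟨u, hu, huu⟩ := exists_norm_eq' hp hinv hinv0 hinvf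
    have huf : σ (σ u) = u := by
      have h1 := congrArg σ huu
      rw [map_mul, hinvf, ← huu, mul_comm] at h1
      refine mul_right_cancel₀ ?_ h1
      intro h
      rw [show WittVector.FractionRing.frobenius p k u = σ u from rfl, h, mul_zero] at huu
      exact inv_ne_zero hb₁n huu.symm
    have hx₂ : psi p k (u • x₁) = u • x₁ := by rw [psi_smul', huf, hx₁f]
    have hself : φ (u • x₁) (u • x₁) = 0 := by
      rw [(φ (u • x₁)).map_smul, φ.map_smul, LinearMap.smul_apply, hφψ x₁, hq1]; simp
    have hcross : φ (u • x₁) (frob p k (u • x₁)) = (p : K(p, k)) ^ s := by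
      rw [frob_smul', (φ (u • x₁)).map_smul, φ.map_smul, LinearMap.smul_apply, hφψ x₁, smul_eq_mul,
        smul_eq_mul]
      rw [show σ u * (u * ((p : K(p, k)) ^ s * ψ x₁ (frob p k x₁))) =
        (u * σ u) * ψ x₁ (frob p k x₁) * (p : K(p, k)) ^ s by ring, huu, inv_mul_cancel₀ hb₁n,
        one_mul]
    have hcross' := hcross
    rw [hsymm] at hcross'
    have hff : φ (frob p k (u • x₁)) (frob p k (u • x₁)) = 0 := by
      rw [hφ.frob_frob, hself, map_zero, mul_zero]
    have hps0 : (p : K(p, k)) ^ (-s) * (p : K(p, k)) ^ s = 1 := by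
      rw [← zpow_add₀ hp0, neg_add_cancel, zpow_zero]
    have hsn : (p : K(p, k)) ^ (-s) ≠ 0 := zpow_ne_zero _ hp0
    have hx₂L : u • x₁ ∈ L := hLmem hu hx₁L
    -- The last two vectors form the basis dual to x, Fx, which swaps the two up to p⁻ˢ.
    refine ⟨u • x₁, hx₂L, ⟨hx₂, s, Or.inl ⟨hself, hcross⟩⟩,
      (p : K(p, k)) ^ (-s) • frob p k (u • x₁), (p : K(p, k)) ^ (-s) • (u • x₁), ?_, ?_, ?_, ?_,
      ?_, ?_, ?_, ?_⟩
    · rw [psi_smul', hps, hps, psi_frob_of_psi p k hx₂]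
    · rw [psi_smul', hps, hps, hx₂]
    · rw [(φ _).map_smul, hcross, smul_eq_mul, hps0]
    · rw [(φ _).map_smul, hff, smul_zero]
    · rw [(φ _).map_smul, hself, smul_zero]
    · rw [(φ _).map_smul, hcross', smul_eq_mul, hps0]
    · intro l hl
      rw [(φ l).map_smul, (φ l).map_smul, smul_eq_mul, smul_eq_mul, ← hψ, ← hψ]
      exact ⟨hs _ hl _ (hF _ hx₂L), hs _ hl _ hx₂L⟩
    · intro z
      rw [(φ z).map_smul, (φ z).map_smul, smul_eq_mul, smul_eq_mul, mul_eq_zero_iff_left hsn,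
        mul_eq_zero_iff_left hsn, and_comm]
  · push Not at hcase
    have hdiv : ∀ y ∈ L, psi p k y = y → ∀ x ∈ L,
        (p : K(p, k)) ^ (-(s + 1)) * φ x (frob p k y) ∈ intRing p k := by
      intro y hy hyf
      refine hext1 _ _ fun x hx hxf => ?_
      rw [hpow, ← red_eq_zero_iff (hs _ hx _ (hF y hy))]
      exact hcase x hx hxf y hy hyf
    -- As p is odd, divisibility of all φ(x, x) on fixed vectors would polarise to all φ(x, y),
    -- against the maximality of s.
    obtain ⟨x, hx, hxf, hxu⟩ : ∃ x ∈ L, psi p k x = x ∧ red (ψ x x) ≠ 0 := by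
      by_contra hcon
      push Not at hcon
      refine hs' (hext _ fun x hx hxf y hy hyf => ?_)
      rw [hpow, ← red_eq_zero_iff (hs _ hx _ hy)]
      have h1 := hcon (x + y) (L.add_mem hx hy) (by rw [map_add, hxf, hyf])
      have h2 : ψ (x + y) (x + y) = ψ x x + (2 * ψ x y + ψ y y) := by
        simp only [hψ, map_add, LinearMap.add_apply, hsymm y x]; ring
      have m1 := hs _ hx _ hx
      have m2 := hs _ hx _ hy
      have m3 := hs _ hy _ hy
      rw [h2, red_add m1 (add_mem (mul_mem two_mem m2) m3), red_add (mul_mem two_mem m2) m3,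
        red_mul two_mem m2, hcon x hx hxf, hcon y hy hyf, zero_add, add_zero] at h1
      exact (mul_eq_zero.1 h1).resolve_left (red_two hp)
    set a := ψ x x with ha_def
    have ha : a ∈ intRing p k := hs _ hx _ hx
    have haf : σ (σ a) = a := hψfix hxf hxf
    have ha0 : a ≠ 0 := by rintro h; rw [h, red_zero] at hxu; exact hxu rfl
    have hainv := inv_mem_of_red_ne_zero ha hxu
    have hσa : σ a ∈ intRing p k := frobenius_mem_iff.2 ha
    have hσainv : (σ a)⁻¹ ∈ intRing p k := by rw [← map_inv₀]; exact frobenius_mem_iff.2 hainv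
    have hσa0 : σ a ≠ 0 := (map_ne_zero_iff _ σ.injective).2 ha0
    set b := (p : K(p, k))⁻¹ * ψ x (frob p k x) with hb_def
    have hb : b ∈ intRing p k := by
      have := hdiv x hx hxf x hx
      rwa [hpow] at this
    have hbp : ψ x (frob p k x) = p * b := by rw [hb_def, mul_inv_cancel_left₀ hp0]
    have hbf : σ b = b := by rw [hb_def, map_mul, map_inv₀, map_natCast, hψself hxf]
    -- The vector x + dFx has to be orthogonal to its image under F. With d = c/σ(a) and c fixed by
    -- σ, that condition divided by p becomes b + 2c + p·b(aσ(a))⁻¹c² = 0.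
    obtain ⟨c, hc, hc0⟩ := exists_quadratic_root' hb two_mem
      (mul_mem hb (mul_mem hainv hσainv)) (red_two hp)
    have hcf : σ c = c := by
      refine quadratic_root_unique' two_mem (mul_mem hb (mul_mem hainv hσainv)) (red_two hp)
        (frobenius_mem_iff.2 hc) hc ?_ hc0
      have := congrArg σ hc0
      simp only [map_add, map_mul, map_pow, map_ofNat, map_natCast, map_zero, hbf, map_inv₀,
        haf] at this
      rw [mul_comm a⁻¹]
      exact this
    set d := c * (σ a)⁻¹ with hd_def
    have hd : d ∈ intRing p k := mul_mem hc hσainv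
    have hσd : σ d = c * a⁻¹ := by rw [hd_def, map_mul, map_inv₀, haf, hcf]
    have hdf : σ (σ d) = d := by rw [hσd, map_mul, map_inv₀, hcf]
    set x₁ := x + d • frob p k x with hx₁
    have hx₁L : x₁ ∈ L := L.add_mem hx (hLmem hd (hF x hx))
    have hx₁f : psi p k x₁ = x₁ := hfixc hxf hdf
    obtain ⟨hq1, hq2⟩ := hψc hxf d
    have hq2' : ψ x₁ (frob p k x₁) = 0 := by
      rw [hq2, hσd, ← ha_def, hbp, hd_def]
      have h4 : (p : K(p, k)) * b + p * (c * a⁻¹ * a + c * (σ a)⁻¹ * σ a) +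
          p * (c * (σ a)⁻¹ * (c * a⁻¹)) * (p * b) =
          p * (b + (c * (a⁻¹ * a) + c * ((σ a)⁻¹ * σ a)) +
            p * (b * (a⁻¹ * (σ a)⁻¹)) * c ^ 2) := by ring
      rw [h4, inv_mul_cancel₀ ha0, inv_mul_cancel₀ hσa0]
      linear_combination (p : K(p, k)) * hc0
    set ε := ψ x₁ x₁ with hε_def
    have hε : ε ∈ intRing p k := hs _ hx₁L _ hx₁L
    have hεf : σ (σ ε) = ε := hψfix hx₁f hx₁f
    have hε0 : red ε ≠ 0 := by
      have h4 : ε = a + p * (2 * b * d + σ a * d ^ 2) := by rw [hq1, hbp]; ring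
      have h5 : 2 * b * d + σ a * d ^ 2 ∈ intRing p k :=
        add_mem (mul_mem (mul_mem two_mem hb) hd) (mul_mem hσa (pow_mem hd 2))
      rw [h4, red_add ha (mul_mem p_mem h5), red_p_mul h5, add_zero]
      exact hxu
    have hεn : ε ≠ 0 := by rintro h; rw [h, red_zero] at hε0; exact hε0 rfl
    have hεinv := inv_mem_of_red_ne_zero hε hε0
    have hφx : φ x₁ x₁ = ε * (p : K(p, k)) ^ s := by rw [hφψ, mul_comm]
    have hφy : φ x₁ (frob p k x₁) = 0 := by rw [hφψ, hq2', mul_zero]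
    have hφy' : φ (frob p k x₁) x₁ = 0 := by rw [hsymm, hφy]
    have hσε0 : σ ε ≠ 0 := (map_ne_zero_iff _ σ.injective).2 hεn
    have hσεinv : (σ ε)⁻¹ ∈ intRing p k := by rw [← map_inv₀]; exact frobenius_mem_iff.2 hεinv
    have hps' : σ ((p : K(p, k)) ^ (-(s + 1))) = (p : K(p, k)) ^ (-(s + 1)) := by
      rw [map_zpow₀, frobenius_p]
    have hff : φ (frob p k x₁) (frob p k x₁) = σ ε * (p : K(p, k)) ^ (s + 1) := by
      rw [hφ.frob_frob, hφx, map_mul, map_zpow₀, frobenius_p, zpow_add_one₀ hp0]; ring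
    have hz1 : ε⁻¹ * (p : K(p, k)) ^ (-s) ≠ 0 := mul_ne_zero (inv_ne_zero hεn) (zpow_ne_zero _ hp0)
    have hz2 : (σ ε)⁻¹ * (p : K(p, k)) ^ (-(s + 1)) ≠ 0 :=
      mul_ne_zero (inv_ne_zero hσε0) (zpow_ne_zero _ hp0)
    refine ⟨x₁, hx₁L, ⟨hx₁f, s, Or.inr ⟨ε, hφy, hφx, hε, hε0, hεf⟩⟩,
      (ε⁻¹ * (p : K(p, k)) ^ (-s)) • x₁,
      ((σ ε)⁻¹ * (p : K(p, k)) ^ (-(s + 1))) • frob p k x₁, ?_, ?_, ?_, ?_,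
      ?_, ?_, ?_, ?_⟩
    · rw [psi_smul', ← hσ, map_mul, map_mul, hps, hps, map_inv₀, map_inv₀, hεf, hx₁f]
    · rw [psi_smul', ← hσ, map_mul, map_mul, hps', hps', map_inv₀, map_inv₀, hεf,
        psi_frob_of_psi p k hx₁f]
    · rw [(φ _).map_smul, hφx, smul_eq_mul,
        show ε⁻¹ * (p : K(p, k)) ^ (-s) * (ε * (p : K(p, k)) ^ s) =
          (ε⁻¹ * ε) * ((p : K(p, k)) ^ (-s) * (p : K(p, k)) ^ s) by ring, inv_mul_cancel₀ hεn,
        ← zpow_add₀ hp0, neg_add_cancel, zpow_zero, one_mul]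
    · rw [(φ _).map_smul, hφy', smul_zero]
    · rw [(φ _).map_smul, hφy, smul_zero]
    · rw [(φ _).map_smul, hff, smul_eq_mul,
        show (σ ε)⁻¹ * (p : K(p, k)) ^ (-(s + 1)) * (σ ε * (p : K(p, k)) ^ (s + 1)) =
          ((σ ε)⁻¹ * σ ε) * ((p : K(p, k)) ^ (-(s + 1)) * (p : K(p, k)) ^ (s + 1)) by ring,
        inv_mul_cancel₀ hσε0, ← zpow_add₀ hp0, neg_add_cancel, zpow_zero, one_mul]
    · intro l hl
      rw [(φ l).map_smul, (φ l).map_smul, smul_eq_mul, smul_eq_mul, mul_assoc, mul_assoc, ← hψ]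
      exact ⟨mul_mem hεinv (hs _ hl _ hx₁L), mul_mem hσεinv (hdiv _ hx₁L hx₁f _ hl)⟩
    · intro z
      rw [(φ z).map_smul, (φ z).map_smul, smul_eq_mul, smul_eq_mul, mul_eq_zero_iff_left hz1,
        mul_eq_zero_iff_left hz2]

/-- Orthogonal decomposition of a lattice into modules in normal form. -/
theorem exists_normal_family (hp : p ≠ 2) [FiniteDimensional K(p, k) E] (m : ℕ)
    (L : Submodule (WittVector p k) E)
    (hm : Module.finrank K(p, k) (Submodule.span K(p, k) (L : Set E)) ≤ m)
    (hspan : Submodule.span (WittVector p k) {x | x ∈ L ∧ psi p k x = x} = L)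
    (hF : ∀ x ∈ L, frob p k x ∈ L)
    (hnd : ∀ x ∈ L, (∀ y ∈ L, φ x y = 0) → x = 0)
    (hbdd : ∃ a : ℤ, ∀ x ∈ L, ∀ y ∈ L, (p : K(p, k)) ^ a * φ x y ∈ intRing p k) :
    ∃ (ι : Type) (_ : Fintype ι) (x : ι → E), (∀ i, IsNormalVec p k φ (x i)) ∧
      (∀ i j, i ≠ j → φ (x i) (x j) = 0 ∧ φ (x i) (frob p k (x j)) = 0) ∧
      Submodule.span (WittVector p k) (Set.range x ∪ Set.range (fun i => frob p k (x i))) = L := by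
  induction m generalizing L with
  | zero =>
    have hbot : L = ⊥ := by
      have h1 := Submodule.finrank_eq_zero.1 (Nat.le_zero.1 hm)
      rw [eq_bot_iff]
      intro x hx
      have : x ∈ Submodule.span K(p, k) (L : Set E) := Submodule.subset_span hx
      rwa [h1] at this
    exact ⟨Empty, inferInstance, Empty.elim, fun i => i.elim, fun i => i.elim, by simp [hbot]⟩
  | succ m ih =>
    by_cases hne : L = ⊥
    · exact ⟨Empty, inferInstance, Empty.elim, fun i => i.elim, fun i => i.elim, by simp [hne]⟩
    obtain ⟨x, hx, hxn, x', y', hx'f, hy'f, e1, e2, e3, e4, hint, hperp⟩ :=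
      exists_normal_summand hφ hsymm hp hspan hF hne hnd hbdd
    let L' : Submodule (WittVector p k) E :=
      { carrier := {l | l ∈ L ∧ φ l x = 0 ∧ φ l (frob p k x) = 0}
        add_mem' := by
          rintro a b ⟨ha, ha1, ha2⟩ ⟨hb, hb1, hb2⟩
          exact ⟨L.add_mem ha hb, by rw [map_add, LinearMap.add_apply, ha1, hb1, add_zero],
            by rw [map_add, LinearMap.add_apply, ha2, hb2, add_zero]⟩
        zero_mem' := ⟨L.zero_mem, by simp, by simp⟩
        smul_mem' := by
          rintro w a ⟨ha, ha1, ha2⟩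
          refine ⟨L.smul_mem w ha, ?_, ?_⟩
          · rw [witt_smul_eq, map_smul, LinearMap.smul_apply, ha1, smul_zero]
          · rw [witt_smul_eq, map_smul, LinearMap.smul_apply, ha2, smul_zero] }
    have hL' : ∀ l, l ∈ L' ↔ l ∈ L ∧ φ l x = 0 ∧ φ l (frob p k x) = 0 := fun _ => Iff.rfl
    have hle : L' ≤ L := fun l hl => hl.1
    -- Projection onto the orthogonal complement of the plane. It maps L into L because the dual
    -- vectors x', y' pair integrally with L, and it preserves ψ-fixed vectors because x' and y' are
    -- fixed.
    let π : E → E := fun l => l - φ l x' • x - φ l y' • frob p k x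
    have hπadd : ∀ a b, π (a + b) = π a + π b := by
      intro a b
      simp only [π, map_add, LinearMap.add_apply, add_smul]; abel
    have hπsmul : ∀ (c : K(p, k)) a, π (c • a) = c • π a := by
      intro c a
      simp only [π, map_smul, LinearMap.smul_apply, smul_sub, smul_eq_mul, mul_smul]
    have hπL : ∀ l ∈ L, π l ∈ L' := by
      intro l hl
      rw [hL']
      refine ⟨L.sub_mem (L.sub_mem hl (smul_mem_of_mem (hint l hl).1 hx))
        (smul_mem_of_mem (hint l hl).2 (hF x hx)), (hperp _).1 ⟨?_, ?_⟩⟩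
      · simp only [π, map_sub, map_smul, LinearMap.sub_apply, LinearMap.smul_apply, e1, e2,
          smul_eq_mul]; ring
      · simp only [π, map_sub, map_smul, LinearMap.sub_apply, LinearMap.smul_apply, e3, e4,
          smul_eq_mul]; ring
    have hL'0 : ∀ l ∈ L', φ l x' = 0 ∧ φ l y' = 0 := fun l hl => (hperp l).2 hl.2
    have hlt : Submodule.span K(p, k) (L' : Set E) < Submodule.span K(p, k) (L : Set E) := by
      refine lt_of_le_of_ne (Submodule.span_mono hle) fun heq => ?_
      have hx1 : x ∈ Submodule.span K(p, k) (L' : Set E) := by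
        rw [heq]; exact Submodule.subset_span hx
      have hall : ∀ z ∈ Submodule.span K(p, k) (L' : Set E), φ z x' = 0 := by
        intro z hz
        induction hz using Submodule.span_induction with
        | mem z hz => exact (hL'0 z hz).1
        | zero => simp
        | add a b _ _ ha hb => rw [map_add, LinearMap.add_apply, ha, hb, add_zero]
        | smul c a _ ha => rw [map_smul, LinearMap.smul_apply, ha, smul_zero]
      exact one_ne_zero (e1.symm.trans (hall x hx1))
    obtain ⟨ι, hι, z, hz1, hz2, hz3⟩ := ih L'
      (by have := Submodule.finrank_lt_finrank_of_lt hlt; omega)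
      (by
        refine le_antisymm (Submodule.span_le.2 fun l hl => hl.1) fun l hl => ?_
        have hπl : π l = l := by simp [π, hL'0 l hl]
        rw [← hπl]
        have hlL := hl.1
        rw [← hspan] at hlL
        clear hπl hl
        induction hlL using Submodule.span_induction with
        | mem l hl =>
          refine Submodule.subset_span ⟨hπL l hl.1, ?_⟩
          simp only [π, map_sub, psi_smul', hl.2, hxn.1, psi_frob_of_psi p k hxn.1,
            hφ.fixed_fixed hl.2 hx'f, hφ.fixed_fixed hl.2 hy'f]
        | zero =>
          have := hπsmul 0 0
          rw [zero_smul, zero_smul] at this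
          rw [this]; exact Submodule.zero_mem _
        | add a b _ _ ha hb => rw [hπadd]; exact Submodule.add_mem _ ha hb
        | smul w a _ ha =>
          rw [witt_smul_eq, hπsmul]; exact smul_mem_of_mem ⟨w, rfl⟩ ha)
      (by
        rintro l ⟨hl, hl1, hl2⟩
        refine ⟨hF l hl, ?_, ?_⟩
        · rw [hsymm, hφ.apply_frob_of_fixed hxn.1, hsymm, hl2, map_zero]
        · rw [hφ.frob_frob, hl1, map_zero, mul_zero])
      (by
        rintro l hl h
        refine hnd l hl.1 fun y hy => ?_
        have h1 := h _ (hπL y hy)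
        simpa only [π, map_sub, map_smul, hl.2.1, hl.2.2, smul_zero, sub_zero] using h1)
      (by
        obtain ⟨a, ha⟩ := hbdd
        exact ⟨a, fun x hx y hy => ha x hx.1 y hy.1⟩)
    have hz4 : ∀ i, z i ∈ L' ∧ frob p k (z i) ∈ L' := by
      intro i
      rw [← hz3]
      exact ⟨Submodule.subset_span (Or.inl ⟨i, rfl⟩), Submodule.subset_span (Or.inr ⟨i, rfl⟩)⟩
    refine ⟨Option ι, inferInstance, fun i => i.elim x z, ?_, ?_, ?_⟩
    · rintro (_ | i)
      · exact hxn
      · exact hz1 i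
    · rintro (_ | i) (_ | j) hij
      · exact absurd rfl hij
      · exact ⟨by rw [hsymm]; exact (hz4 j).1.2.1, by rw [hsymm]; exact (hz4 j).2.2.1⟩
      · exact ⟨(hz4 i).1.2.1, (hz4 i).1.2.2⟩
      · exact hz2 i j fun h => hij (congrArg some h)
    · apply le_antisymm
      · rw [Submodule.span_le]
        rintro _ (⟨_ | i, rfl⟩ | ⟨_ | i, rfl⟩)
        · exact hx
        · exact (hz4 i).1.1
        · exact hF x hx
        · exact (hz4 i).2.1
      · have hL'le : L' ≤ Submodule.span (WittVector p k)
            (Set.range (fun i : Option ι => i.elim x z) ∪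
              Set.range fun i : Option ι => frob p k (i.elim x z)) := by
          rw [← hz3, Submodule.span_le]
          rintro _ (⟨i, rfl⟩ | ⟨i, rfl⟩)
          · exact Submodule.subset_span (Or.inl ⟨some i, rfl⟩)
          · exact Submodule.subset_span (Or.inr ⟨some i, rfl⟩)
        intro l hl
        have h1 : l = π l + φ l x' • x + φ l y' • frob p k x := by simp only [π]; abel
        rw [h1]
        exact Submodule.add_mem _ (Submodule.add_mem _ (hL'le (hπL l hl))
          (smul_mem_of_mem (hint l hl).1 (Submodule.subset_span (Or.inl ⟨none, rfl⟩))))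
          (smul_mem_of_mem (hint l hl).2 (Submodule.subset_span (Or.inr ⟨none, rfl⟩)))

end Diagonalization

end SymmDieudonne

namespace SymmDieudonne

/-! ### Frames -/

section Frames

variable {p : ℕ} [Fact p.Prime] {k : Type*} [Field k] [IsAlgClosed k] [CharP k p]
variable {E : Type*} [AddCommGroup E] [WittVector.Isocrystal p k E]
variable [Module (WittVector p k) E] [IsScalarTower (WittVector p k) K(p, k) E]

local notation "σ" => WittVector.FractionRing.frobenius p k

variable (p k) in
/-- A decomposition of a lattice `N` into four orthogonal modules in normal form, spanned by
`xᵢ = basis (0, i)` and `Fxᵢ = basis (1, i)`. The integers `rᵢ` are those for which the dual of `N`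
is `⨁ F^{rᵢ} Nᵢ`. -/
structure Frame (φ : LinearMap.BilinForm K(p, k) E) (N : Submodule (WittVector p k) E) where
  /-- The basis. -/
  basis : Module.Basis (Fin 2 × Fin 4) K(p, k) E
  /-- The type. -/
  r : Fin 4 → ℤ
  /-- The valuations in the normal forms. -/
  n : Fin 4 → ℤ
  /-- The units in the normal forms. -/
  ε : Fin 4 → K(p, k)
  psi_basis : ∀ i, psi p k (basis (0, i)) = basis (0, i)
  frob_basis : ∀ i, frob p k (basis (0, i)) = basis (1, i)
  ortho : ∀ i j, i ≠ j → φ (basis (0, i)) (basis (0, j)) = 0 ∧ φ (basis (0, i)) (basis (1, j)) = 0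
  eps_mem : ∀ i, ε i ∈ intRing p k
  eps_red : ∀ i, red (ε i) ≠ 0
  eps_fixed : ∀ i, σ (σ (ε i)) = ε i
  -- The dual of Nᵢ is p⁻ⁿNᵢ = F^(−2n)Nᵢ in the first case. In the second it is spanned by p⁻ⁿx and
  -- p⁻ⁿ⁻¹Fx, which is F^(−2n−1)Nᵢ.
  normal : ∀ i, (r i = -2 * n i ∧ ε i = 1 ∧ IsEvenVec p k φ (basis (0, i)) (n i)) ∨
    (r i = -2 * n i - 1 ∧ IsOddVec p k φ (basis (0, i)) (n i) (ε i))
  mem_iff : ∀ z, z ∈ N ↔ ∀ j, basis.repr z j ∈ intRing p k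

/-! ### Coordinates, the lattices ⨁ F^{sᵢ} Nᵢ and their duals. -/

namespace Frame

variable {φ : LinearMap.BilinForm K(p, k) E} {N : Submodule (WittVector p k) E}
  (f : Frame p k φ N)

/-- The coordinate along `xᵢ`. -/
def a (i : Fin 4) : E →ₗ[K(p, k)] K(p, k) := f.basis.coord (0, i)

/-- The coordinate along `Fxᵢ`. -/
def b (i : Fin 4) : E →ₗ[K(p, k)] K(p, k) := f.basis.coord (1, i)

/-- The vector with given coordinates. -/
def vec (c d : Fin 4 → K(p, k)) : E :=
  ∑ i, (c i • f.basis (0, i) + d i • f.basis (1, i))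

theorem a_basis (i j : Fin 4) : f.a i (f.basis (0, j)) = if j = i then 1 else 0 := by
  simp [a, Finsupp.single_apply]

theorem a_basis' (i j : Fin 4) : f.a i (f.basis (1, j)) = 0 := by
  simp [a]

theorem b_basis (i j : Fin 4) : f.b i (f.basis (0, j)) = 0 := by
  simp [b]

theorem b_basis' (i j : Fin 4) : f.b i (f.basis (1, j)) = if j = i then 1 else 0 := by
  simp [b, Finsupp.single_apply]

@[simp] theorem a_vec (c d : Fin 4 → K(p, k)) (i : Fin 4) : f.a i (f.vec c d) = c i := by
  simp [vec, a_basis, a_basis']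

@[simp] theorem b_vec (c d : Fin 4 → K(p, k)) (i : Fin 4) : f.b i (f.vec c d) = d i := by
  simp [vec, b_basis, b_basis']

theorem vec_coord (z : E) : f.vec (fun i => f.a i z) (fun i => f.b i z) = z := by
  conv_rhs => rw [← f.basis.sum_repr z, Fintype.sum_prod_type, Fin.sum_univ_two,
    ← Finset.sum_add_distrib]
  rfl

theorem ext_coord {z w : E} (ha : ∀ i, f.a i z = f.a i w) (hb : ∀ i, f.b i z = f.b i w) :
    z = w := by
  rw [← f.vec_coord z, ← f.vec_coord w]
  congr 1
  · exact funext ha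
  · exact funext hb

theorem mem_iff' (z : E) : z ∈ N ↔ ∀ i, f.a i z ∈ intRing p k ∧ f.b i z ∈ intRing p k := by
  rw [f.mem_iff]
  constructor
  · exact fun h i => ⟨h (0, i), h (1, i)⟩
  · rintro h ⟨j, i⟩
    fin_cases j
    · exact (h i).1
    · exact (h i).2

theorem frob_vec (c d : Fin 4 → K(p, k)) :
    frob p k (f.vec c d) = f.vec (fun i => p * σ (d i)) (fun i => σ (c i)) := by
  rw [vec, map_sum, vec]
  refine Finset.sum_congr rfl fun i _ => ?_
  rw [map_add, frob_smul', frob_smul', f.frob_basis, ← f.frob_basis i,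
    frob_frob_of_psi p k (f.psi_basis i), smul_smul, mul_comm (σ (d i)), add_comm]

theorem a_frob (z : E) (i : Fin 4) : f.a i (frob p k z) = p * σ (f.b i z) := by
  conv_lhs => rw [← f.vec_coord z, frob_vec, a_vec]

theorem b_frob (z : E) (i : Fin 4) : f.b i (frob p k z) = σ (f.a i z) := by
  conv_lhs => rw [← f.vec_coord z, frob_vec, b_vec]

theorem a_psi (z : E) (i : Fin 4) : f.a i (psi p k z) = σ (σ (f.a i z)) := by
  rw [psi_apply, map_smul, a_frob, b_frob, smul_eq_mul, inv_mul_cancel_left₀ p_ne_zero]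

theorem b_psi (z : E) (i : Fin 4) : f.b i (psi p k z) = σ (σ (f.b i z)) := by
  rw [psi_apply, map_smul, b_frob, a_frob, smul_eq_mul, map_mul, frobenius_p,
    inv_mul_cancel_left₀ p_ne_zero]

/-- The diagonal entries of the Gram matrix. -/
def al (i : Fin 4) : K(p, k) := φ (f.basis (0, i)) (f.basis (0, i))

/-- The off-diagonal entries of the Gram matrix. -/
def be (i : Fin 4) : K(p, k) := φ (f.basis (0, i)) (f.basis (1, i))

theorem cases (i : Fin 4) :
    (f.r i = -2 * f.n i ∧ f.ε i = 1 ∧ f.al i = 0 ∧ f.be i = (p : K(p, k)) ^ f.n i) ∨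
    (f.r i = -2 * f.n i - 1 ∧ f.be i = 0 ∧ f.al i = f.ε i * (p : K(p, k)) ^ f.n i) := by
  rcases f.normal i with ⟨h1, h2, h3, h4⟩ | ⟨h1, h2, h3, -⟩
  · exact Or.inl ⟨h1, h2, h3, by rw [be, ← f.frob_basis, h4]⟩
  · exact Or.inr ⟨h1, by rw [be, ← f.frob_basis, h2], h3⟩

variable (hφ : IsPairing p k φ) (hsymm : ∀ x y : E, φ x y = φ y x)
include hφ hsymm

/-- The Gram matrix is block diagonal, and the last entry of each block follows from φ(Fx, Fx) =
pσφ(x, x). -/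
theorem form_eq (z w : E) : φ z w = ∑ i, (f.a i z * f.a i w * f.al i +
    (f.a i z * f.b i w + f.b i z * f.a i w) * f.be i +
    f.b i z * f.b i w * (p * σ (f.al i))) := by
  have h0 : ∀ i j, i ≠ j → φ (f.basis (1, i)) (f.basis (1, j)) = 0 := by
    intro i j hij
    rw [← f.frob_basis, ← f.frob_basis, hφ.frob_frob, (f.ortho i j hij).1, map_zero, mul_zero]
  have h1 : ∀ i, φ (f.basis (1, i)) (f.basis (1, i)) = p * σ (f.al i) := by
    intro i
    rw [← f.frob_basis, hφ.frob_frob, al]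
  conv_lhs => rw [← f.vec_coord z, ← f.vec_coord w, vec, vec, LinearMap.map_sum₂]
  refine Finset.sum_congr rfl fun i _ => ?_
  rw [map_sum, Finset.sum_eq_single i]
  · simp only [map_add, map_smul, LinearMap.add_apply, LinearMap.smul_apply, smul_eq_mul, h1,
      hsymm (f.basis (1, i)) (f.basis (0, i))]
    rw [al, be]
    ring
  · intro j _ hji
    have h2 := (f.ortho i j hji.symm).1
    have h3 := (f.ortho i j hji.symm).2
    have h4 := (f.ortho j i hji).2
    rw [hsymm] at h4
    simp only [map_add, map_smul, LinearMap.add_apply, LinearMap.smul_apply, smul_eq_mul,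
      h0 i j hji.symm, h2, h3, h4]
    ring
  · intro h
    exact absurd (Finset.mem_univ i) h

omit hφ hsymm

/-- The lattice `⨁ F^{sᵢ} Nᵢ`. -/
def lat (s : Fin 4 → ℤ) : Submodule (WittVector p k) E where
  -- Since F² = p on fixed vectors, F^s Nᵢ is spanned by p^⌈s/2⌉xᵢ and p^⌊s/2⌋Fxᵢ. Integer division
  -- rounds down for negative s as well.
  carrier := {z | ∀ i, (p : K(p, k)) ^ (-((s i + 1) / 2)) * f.a i z ∈ intRing p k ∧
    (p : K(p, k)) ^ (-(s i / 2)) * f.b i z ∈ intRing p k}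
  add_mem' := by
    intro z w hz hw i
    rw [map_add, map_add, mul_add, mul_add]
    exact ⟨add_mem (hz i).1 (hw i).1, add_mem (hz i).2 (hw i).2⟩
  zero_mem' := by
    intro i
    simp
  smul_mem' := by
    intro c z hz i
    rw [witt_smul_eq, map_smul, map_smul, smul_eq_mul, smul_eq_mul, mul_left_comm,
      mul_left_comm _ _ (f.b i z)]
    exact ⟨mul_mem ⟨c, rfl⟩ (hz i).1, mul_mem ⟨c, rfl⟩ (hz i).2⟩

theorem mem_lat {s : Fin 4 → ℤ} {z : E} : z ∈ f.lat s ↔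
    ∀ i, (p : K(p, k)) ^ (-((s i + 1) / 2)) * f.a i z ∈ intRing p k ∧
      (p : K(p, k)) ^ (-(s i / 2)) * f.b i z ∈ intRing p k := Iff.rfl

theorem lat_zero : f.lat 0 = N := by
  ext z
  rw [mem_lat, f.mem_iff']
  simp

theorem zpow_mul_mem_of_le {m n : ℤ} (h : m ≤ n) {c : K(p, k)}
    (hc : (p : K(p, k)) ^ m * c ∈ intRing p k) : (p : K(p, k)) ^ n * c ∈ intRing p k := by
  rw [show n = (n - m) + m by ring, zpow_add₀ p_ne_zero, mul_assoc]
  exact mul_mem (zpow_mem (by omega)) hc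

theorem lat_anti {s t : Fin 4 → ℤ} (h : ∀ i, s i ≤ t i) : f.lat t ≤ f.lat s := by
  intro z hz i
  have := h i
  exact ⟨zpow_mul_mem_of_le (by omega) (hz i).1, zpow_mul_mem_of_le (by omega) (hz i).2⟩

theorem smul_basis_mem_lat (s : Fin 4 → ℤ) (i : Fin 4) :
    (p : K(p, k)) ^ ((s i + 1) / 2) • f.basis (0, i) ∈ f.lat s := by
  intro j
  rw [map_smul, map_smul, a_basis, b_basis]
  split_ifs with h
  · subst h
    rw [smul_eq_mul, mul_one, ← zpow_add₀ p_ne_zero, neg_add_cancel, zpow_zero, smul_zero, mul_zero]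
    exact ⟨one_mem _, zero_mem _⟩
  · simp

theorem smul_basis_mem_lat' (s : Fin 4 → ℤ) (i : Fin 4) :
    (p : K(p, k)) ^ (s i / 2) • f.basis (1, i) ∈ f.lat s := by
  intro j
  rw [map_smul, map_smul, a_basis', b_basis']
  split_ifs with h
  · subst h
    rw [smul_eq_mul, smul_eq_mul, mul_one, ← zpow_add₀ p_ne_zero, neg_add_cancel, zpow_zero,
      mul_zero, mul_zero]
    exact ⟨zero_mem _, one_mem _⟩
  · simp

theorem le_of_lat_le {s t : Fin 4 → ℤ} (h : f.lat t ≤ f.lat s) (i : Fin 4) : s i ≤ t i := by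
  have h3 := (h (f.smul_basis_mem_lat t i) i).1
  have h4 := (h (f.smul_basis_mem_lat' t i) i).2
  rw [map_smul, a_basis, if_pos rfl, smul_eq_mul, mul_one, ← zpow_add₀ p_ne_zero,
    zpow_mem_iff] at h3
  rw [map_smul, b_basis', if_pos rfl, smul_eq_mul, mul_one, ← zpow_add₀ p_ne_zero,
    zpow_mem_iff] at h4
  omega

theorem lat_injective {s t : Fin 4 → ℤ} (h : f.lat s = f.lat t) : s = t :=
  funext fun i => le_antisymm (f.le_of_lat_le h.ge i) (f.le_of_lat_le h.le i)

theorem zpow_mul_frobenius_mem_iff {m : ℤ} {c : K(p, k)} :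
    (p : K(p, k)) ^ m * σ c ∈ intRing p k ↔ (p : K(p, k)) ^ m * c ∈ intRing p k := by
  rw [← frobenius_mem_iff (a := _ * c), map_mul, map_zpow₀, frobenius_p]

/-- F swaps the two coordinates of a plane up to σ and one factor p, in accordance with ⌈(s+2)/2⌉ =
⌊s/2⌋ + 1 rounded as in `lat`. -/
theorem frob_mem_lat {s : Fin 4 → ℤ} {z : E} :
    frob p k z ∈ f.lat (fun i => s i + 1) ↔ z ∈ f.lat s := by
  refine forall_congr' fun i => ?_
  rw [a_frob, b_frob, ← mul_assoc, ← zpow_add_one₀ p_ne_zero,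
    show -((s i + 1 + 1) / 2) + 1 = -(s i / 2) by omega, zpow_mul_frobenius_mem_iff,
    zpow_mul_frobenius_mem_iff, and_comm]

theorem psi_mem_lat {s : Fin 4 → ℤ} {z : E} : psi p k z ∈ f.lat s ↔ z ∈ f.lat s := by
  refine forall_congr' fun i => ?_
  rw [a_psi, b_psi, zpow_mul_frobenius_mem_iff, zpow_mul_frobenius_mem_iff,
    zpow_mul_frobenius_mem_iff, zpow_mul_frobenius_mem_iff]

theorem frob_zsmul_mem_lat (m : ℤ) {s : Fin 4 → ℤ} {z : E} :
    (m • frob p k (E := E)) z ∈ f.lat (fun i => s i + m) ↔ z ∈ f.lat s := by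
  induction m using Int.induction_on generalizing s z with
  | zero => simp
  | succ n ih =>
    rw [add_zsmul, one_zsmul, AddAut.add_apply,
      show (fun i => s i + ((n : ℤ) + 1)) = fun i => (fun i => s i + 1) i + (n : ℤ) by
        funext i; ring, ih, frob_mem_lat]
  | pred n ih =>
    rw [sub_zsmul, one_zsmul, AddAut.add_apply,
      show (fun i => s i + (-(n : ℤ) - 1)) = fun i => (fun i => s i - 1) i + (-(n : ℤ)) by
        funext i; ring, ih, ← f.frob_mem_lat]
    simp only [sub_add_cancel]
    change frob p k ((frob p k (E := E)).symm z) ∈ _ ↔ _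
    rw [AddEquiv.apply_symm_apply]

theorem span_lat (s : Fin 4 → ℤ) : Submodule.span K(p, k) (f.lat s : Set E) = ⊤ := by
  rw [eq_top_iff]
  intro z _
  rw [← f.vec_coord z]
  refine Submodule.sum_mem _ fun i _ => ?_
  refine Submodule.add_mem _ ?_ ?_
  · rw [← inv_smul_smul₀ (zpow_ne_zero ((s i + 1) / 2) (p_ne_zero (p := p) (k := k)))
      (f.basis (0, i)), smul_smul]
    exact Submodule.smul_mem _ _ (Submodule.subset_span (f.smul_basis_mem_lat s i))
  · rw [← inv_smul_smul₀ (zpow_ne_zero (s i / 2) (p_ne_zero (p := p) (k := k)))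
      (f.basis (1, i)), smul_smul]
    exact Submodule.smul_mem _ _ (Submodule.subset_span (f.smul_basis_mem_lat' s i))

include f in
theorem fg : N.FG := by
  classical
  refine ⟨Finset.univ.image f.basis, le_antisymm (Submodule.span_le.2 ?_) fun z hz => ?_⟩
  · intro z hz
    simp only [Finset.coe_image, Finset.coe_univ, Set.image_univ, Set.mem_range] at hz
    obtain ⟨j, rfl⟩ := hz
    rw [SetLike.mem_coe, f.mem_iff]
    intro i
    rw [f.basis.repr_self, Finsupp.single_apply]
    split_ifs
    · exact one_mem _
    · exact zero_mem _
  · rw [← f.basis.sum_repr z]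
    refine Submodule.sum_mem _ fun j _ => smul_mem_of_mem ((f.mem_iff z).1 hz j)
      (Submodule.subset_span (by simp))

theorem lat_fg (s : Fin 4 → ℤ) : (f.lat s).FG := by
  obtain ⟨m, hm⟩ : ∃ m : ℕ, ∀ i, -s i ≤ 2 * m :=
    ⟨∑ i, (s i).natAbs, fun i => by
      have h1 : (s i).natAbs ≤ ∑ i, (s i).natAbs :=
        Finset.single_le_sum (f := fun i => (s i).natAbs) (fun _ _ => Nat.zero_le _)
          (Finset.mem_univ i)
      omega⟩
  refine fg_of_le (scale_fg (pow_ne_zero m (p_ne_zero (p := p) (k := k))) f.fg) fun z hz => ?_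
  rw [mem_scale, f.mem_iff']
  intro i
  have := hm i
  rw [map_smul, map_smul, smul_eq_mul, smul_eq_mul, ← zpow_natCast]
  exact ⟨zpow_mul_mem_of_le (by omega) (hz i).1, zpow_mul_mem_of_le (by omega) (hz i).2⟩

theorem lat_isSuperspecial (s : Fin 4 → ℤ) : IsSuperspecial p k (f.lat s) := by
  rw [isSuperspecial_iff]
  refine ⟨f.lat_fg s, f.span_lat s, fun z hz => ?_, fun z => f.psi_mem_lat⟩
  exact f.lat_anti (fun i => by omega) (f.frob_mem_lat.2 hz)

include hφ hsymm in
-- Pairing with the two generators of F^{sᵢ}Nᵢ reads off the coordinates of a vector up to units and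
-- powers of p; the powers add up to the shift by rᵢ.
theorem dual_lat (s : Fin 4 → ℤ) : dual p k φ (f.lat s) = f.lat (fun i => f.r i - s i) := by
  have hp0 : (p : K(p, k)) ≠ 0 := p_ne_zero
  apply le_antisymm
  · intro z hz i
    have h3 := hz _ (f.smul_basis_mem_lat s i)
    have h4 := hz _ (f.smul_basis_mem_lat' s i)
    rw [f.form_eq hφ hsymm, Finset.sum_eq_single i (by
      intro j _ hj
      simp [a_basis, a_basis', b_basis, b_basis', hj.symm]) (by simp)] at h3 h4
    simp only [map_smul, a_basis, a_basis', b_basis, b_basis', if_true, smul_eq_mul, mul_one,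
      mul_zero, zero_mul, add_zero, zero_add] at h3 h4
    rcases f.cases i with ⟨hr, -, hal, hbe⟩ | ⟨hr, hbe, hal⟩
    · rw [hal, hbe, mul_zero, zero_add, mul_right_comm, ← zpow_add₀ hp0] at h3
      rw [hal, hbe, map_zero, mul_zero, mul_zero, add_zero, mul_right_comm, ← zpow_add₀ hp0] at h4
      exact ⟨zpow_mul_mem_of_le (by dsimp only; omega) h4, zpow_mul_mem_of_le (by dsimp only; omega) h3⟩
    · rw [hal, hbe, mul_zero, add_zero] at h3
      rw [hal, hbe, mul_zero, zero_add] at h4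
      have hinv := inv_mem_of_red_ne_zero (f.eps_mem i) (f.eps_red i)
      have hε0 : f.ε i ≠ 0 := by
        intro h
        exact f.eps_red i (by rw [h, red_zero])
      have hσ0 : σ (f.ε i) ≠ 0 := (map_ne_zero_iff _ (RingEquiv.injective _)).2 hε0
      have h5 := mul_mem hinv h3
      have h6 := mul_mem (frobenius_mem_iff.2 hinv) h4
      rw [show (f.ε i)⁻¹ * ((p : K(p, k)) ^ ((s i + 1) / 2) * f.a i z *
        (f.ε i * (p : K(p, k)) ^ f.n i)) = ((f.ε i)⁻¹ * f.ε i) *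
          ((p : K(p, k)) ^ ((s i + 1) / 2) * (p : K(p, k)) ^ f.n i * f.a i z) by ring,
        inv_mul_cancel₀ hε0, one_mul, ← zpow_add₀ hp0] at h5
      rw [map_mul, map_zpow₀, frobenius_p, map_inv₀,
        show (σ (f.ε i))⁻¹ * ((p : K(p, k)) ^ (s i / 2) * f.b i z *
        (p * (σ (f.ε i) * (p : K(p, k)) ^ f.n i))) = ((σ (f.ε i))⁻¹ * σ (f.ε i)) *
          ((p : K(p, k)) ^ (s i / 2) * (p : K(p, k)) ^ f.n i * p * f.b i z) by ring,
        inv_mul_cancel₀ hσ0, one_mul, ← zpow_add₀ hp0, ← zpow_add_one₀ hp0] at h6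
      exact ⟨zpow_mul_mem_of_le (by dsimp only; omega) h5, zpow_mul_mem_of_le (by dsimp only; omega) h6⟩
  · intro z hz w hw
    rw [f.form_eq hφ hsymm]
    refine sum_mem fun i _ => ?_
    obtain ⟨z1, z2⟩ := hz i
    dsimp only at z1 z2
    obtain ⟨w1, w2⟩ := hw i
    have hmul : ∀ {m n l : ℤ} {c d : K(p, k)}, m + n ≤ l → (p : K(p, k)) ^ m * c ∈ intRing p k →
        (p : K(p, k)) ^ n * d ∈ intRing p k → c * d * (p : K(p, k)) ^ l ∈ intRing p k := by
      intro m n l c d h hc hd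
      have := zpow_mul_mem_of_le h (c := c * d) (by
        rw [zpow_add₀ hp0, mul_mul_mul_comm]; exact mul_mem hc hd)
      rwa [mul_comm] at this
    rcases f.cases i with ⟨hr, -, hal, hbe⟩ | ⟨hr, hbe, hal⟩
    · rw [hal, hbe, map_zero, mul_zero, mul_zero, mul_zero, zero_add, add_zero, add_mul]
      exact add_mem (hmul (by omega) w1 z2) (hmul (by omega) w2 z1)
    · rw [hal, hbe, mul_zero, add_zero, map_mul, map_zpow₀, frobenius_p,
        show f.b i w * f.b i z * (p * (σ (f.ε i) * (p : K(p, k)) ^ f.n i)) =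
          σ (f.ε i) * (f.b i w * f.b i z * ((p : K(p, k)) ^ f.n i * p)) by ring,
        mul_left_comm _ (f.ε i), ← zpow_add_one₀ hp0]
      exact add_mem (mul_mem (f.eps_mem i) (hmul (by omega) w1 z1))
        (mul_mem (frobenius_mem_iff.2 (f.eps_mem i)) (hmul (by omega) w2 z2))

include hφ hsymm in
theorem dual_eq_lat : dual p k φ N = f.lat f.r := by
  conv_lhs => rw [← f.lat_zero, f.dual_lat hφ hsymm]
  simp

end Frame

end Frames

end SymmDieudonne

namespace SymmDieudonne

/-! ### Frames and decompositions -/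

section Decompositions

variable {p : ℕ} [Fact p.Prime] {k : Type*} [Field k] [IsAlgClosed k] [CharP k p]
variable {E : Type*} [AddCommGroup E] [WittVector.Isocrystal p k E]
variable {φ : LinearMap.BilinForm K(p, k) E}

local notation "σ" => WittVector.FractionRing.frobenius p k

section

variable (hφ : IsPairing p k φ) (hsymm : ∀ x y : E, φ x y = φ y x)
include hφ hsymm

/-- The Gram matrix consists of invertible 2 × 2 blocks, antidiagonal or diagonal according to the
type. -/
theorem linearIndependent_of_isNormalVec {ι : Type*} [Fintype ι] {x : ι → E}
    (hx : ∀ i, IsNormalVec p k φ (x i))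
    (hort : ∀ i j, i ≠ j → φ (x i) (x j) = 0 ∧ φ (x i) (frob p k (x j)) = 0) :
    LinearIndependent K(p, k) (fun j : Fin 2 × ι => ![x j.2, frob p k (x j.2)] j.1) := by
  have hp0 : (p : K(p, k)) ≠ 0 := p_ne_zero
  rw [Fintype.linearIndependent_iff]
  intro g hg
  rw [Fintype.sum_prod_type, Fin.sum_univ_two, ← Finset.sum_add_distrib] at hg
  simp only [Matrix.cons_val_zero, Matrix.cons_val_one] at hg
  have key : ∀ (i : ι) (w : E), (∀ j, j ≠ i → φ (x j) w = 0 ∧ φ (frob p k (x j)) w = 0) →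
      g (0, i) * φ (x i) w + g (1, i) * φ (frob p k (x i)) w = 0 := by
    intro i w hw
    have h1 := congrArg (fun z => φ z w) hg
    simp only [LinearMap.map_sum₂, map_zero, LinearMap.zero_apply] at h1
    rw [Finset.sum_eq_single i] at h1
    · simpa only [map_add, map_smul, LinearMap.add_apply, LinearMap.smul_apply, smul_eq_mul]
        using h1
    · intro j _ hj
      simp only [map_add, map_smul, LinearMap.add_apply, LinearMap.smul_apply, (hw j hj).1,
        (hw j hj).2, smul_zero, add_zero]
    · intro h
      exact absurd (Finset.mem_univ i) h
  have hmain : ∀ i, g (0, i) = 0 ∧ g (1, i) = 0 := by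
    intro i
    have h1 := key i (x i) fun j hj => ⟨(hort j i hj).1, by
      rw [hsymm]; exact (hort i j hj.symm).2⟩
    have h2 := key i (frob p k (x i)) fun j hj => ⟨(hort j i hj).2, by
      rw [hφ.frob_frob, (hort j i hj).1, map_zero, mul_zero]⟩
    rw [hsymm (frob p k (x i))] at h1
    rw [hφ.frob_frob] at h2
    obtain ⟨-, n, ⟨h3, h4⟩ | ⟨ε, h3, h4, -, h5, -⟩⟩ := hx i
    · rw [h3, h4, mul_zero, zero_add] at h1
      rw [h3, h4, map_zero, mul_zero, mul_zero, add_zero] at h2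
      have := zpow_ne_zero n hp0
      exact ⟨(mul_eq_zero.1 h2).resolve_right this, (mul_eq_zero.1 h1).resolve_right this⟩
    · rw [h3, h4, mul_zero, add_zero] at h1
      rw [h3, h4, mul_zero, zero_add] at h2
      have hne : ε * (p : K(p, k)) ^ n ≠ 0 :=
        mul_ne_zero (fun h => h5 (by rw [h, red_zero])) (zpow_ne_zero n hp0)
      exact ⟨(mul_eq_zero.1 h1).resolve_right hne, (mul_eq_zero.1 h2).resolve_right
        (mul_ne_zero hp0 ((map_ne_zero_iff _ (RingEquiv.injective _)).2 hne))⟩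
  rintro ⟨j, i⟩
  fin_cases j
  · exact (hmain i).1
  · exact (hmain i).2

end

variable [Module (WittVector p k) E] [IsScalarTower (WittVector p k) K(p, k) E]

theorem range_pair {ι : Type*} (x : ι → E) :
    Set.range (fun j : Fin 2 × ι => ![x j.2, frob p k (x j.2)] j.1) =
      Set.range x ∪ Set.range fun i => frob p k (x i) := by
  ext z
  constructor
  · rintro ⟨⟨j, i⟩, rfl⟩
    fin_cases j
    · exact Or.inl ⟨i, rfl⟩
    · exact Or.inr ⟨i, rfl⟩
  · rintro (⟨i, rfl⟩ | ⟨i, rfl⟩)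
    · exact ⟨(0, i), rfl⟩
    · exact ⟨(1, i), rfl⟩

theorem span_pair_eq_top {ι : Type*} {x : ι → E} {N : Submodule (WittVector p k) E}
    (hspan : Submodule.span (WittVector p k)
      (Set.range x ∪ Set.range fun i => frob p k (x i)) = N)
    (hN : Submodule.span K(p, k) (N : Set E) = ⊤) :
    ⊤ ≤ Submodule.span K(p, k)
      (Set.range fun j : Fin 2 × ι => ![x j.2, frob p k (x j.2)] j.1) := by
  rw [range_pair, ← hN, ← hspan, Submodule.span_le]
  exact Submodule.span_le_restrictScalars (WittVector p k) K(p, k) _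

section

variable (hφ : IsPairing p k φ) (hsymm : ∀ x y : E, φ x y = φ y x)
include hφ hsymm

theorem exists_frame {N : Submodule (WittVector p k) E} {x : Fin 4 → E}
    (hx : ∀ i, IsNormalVec p k φ (x i))
    (hort : ∀ i j, i ≠ j → φ (x i) (x j) = 0 ∧ φ (x i) (frob p k (x j)) = 0)
    (hspan : Submodule.span (WittVector p k)
      (Set.range x ∪ Set.range fun i => frob p k (x i)) = N)
    (hN : Submodule.span K(p, k) (N : Set E) = ⊤) :
    ∃ f : Frame p k φ N, ∀ i, f.basis (0, i) = x i := by
  have hli := linearIndependent_of_isNormalVec hφ hsymm hx hort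
  let B := Module.Basis.mk hli (span_pair_eq_top hspan hN)
  have hB0 : ∀ i, B (0, i) = x i := fun i => by simp [B]
  have hB1 : ∀ i, B (1, i) = frob p k (x i) := fun i => by simp [B]
  have hdata : ∀ i, ∃ (r n : ℤ) (ε : K(p, k)), ε ∈ intRing p k ∧ red ε ≠ 0 ∧ σ (σ ε) = ε ∧
      ((r = -2 * n ∧ ε = 1 ∧ IsEvenVec p k φ (x i) n) ∨
        (r = -2 * n - 1 ∧ IsOddVec p k φ (x i) n ε)) := by
    intro i
    obtain ⟨-, n, h | ⟨ε, h⟩⟩ := hx i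
    · exact ⟨_, n, 1, one_mem _, by rw [red_one]; exact one_ne_zero, by rw [map_one, map_one],
        Or.inl ⟨rfl, rfl, h⟩⟩
    · exact ⟨_, n, ε, h.2.2.1, h.2.2.2.1, h.2.2.2.2, Or.inr ⟨rfl, h⟩⟩
  choose r n ε h1 h2 h3 h4 using hdata
  refine ⟨⟨B, r, n, ε, ?_, ?_, ?_, h1, h2, h3, ?_, ?_⟩, hB0⟩
  · intro i
    rw [hB0, (hx i).1]
  · intro i
    rw [hB0, hB1]
  · intro i j hij
    rw [hB0, hB0, hB1]
    exact hort i j hij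
  · intro i
    rw [hB0]
    exact h4 i
  · intro z
    constructor
    · intro hz
      rw [← hspan, ← range_pair] at hz
      induction hz using Submodule.span_induction with
      | mem z hz =>
        obtain ⟨i, rfl⟩ := hz
        intro j
        have hBi : B i = ![x i.2, frob p k (x i.2)] i.1 := Module.Basis.mk_apply _ _ i
        simp only
        rw [← hBi, Module.Basis.repr_self, Finsupp.single_apply]
        split_ifs
        · exact one_mem _
        · exact zero_mem _
      | zero => intro j; rw [map_zero]; exact zero_mem _
      | add z w _ _ hz hw => intro j; rw [map_add]; exact add_mem (hz j) (hw j)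
      | smul c z _ hz =>
        intro j
        rw [witt_smul_eq, map_smul]
        exact mul_mem ⟨c, rfl⟩ (hz j)
    · intro hz
      rw [← B.sum_repr z, ← hspan, ← range_pair]
      refine Submodule.sum_mem _ fun j _ => smul_mem_of_mem (hz j) (Submodule.subset_span ⟨j, ?_⟩)
      rw [Module.Basis.mk_apply]

end

theorem eq_zero_of_forall_zpow_mul_mem {c : K(p, k)}
    (h : ∀ n : ℤ, (p : K(p, k)) ^ n * c ∈ intRing p k) : c = 0 := by
  by_contra hc
  obtain ⟨m, u, hu, rfl⟩ := exists_eq_zpow_mul hc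
  have := h (-m - 1)
  rw [← mul_assoc, ← zpow_add₀ p_ne_zero, zpow_mul_unit_mem_iff hu] at this
  omega

namespace Frame

variable {N : Submodule (WittVector p k) E} (f : Frame p k φ N)

/-- The `i`-th summand. -/
def plane (i : Fin 4) : Submodule (WittVector p k) E :=
  Submodule.span (WittVector p k) {f.basis (0, i), f.basis (1, i)}

/-- Letting the other sⱼ vary makes the other coordinates divisible by every power of p. The plane
is thereby described through the lattices `lat`, on which powers of F act by shifting s. -/
theorem mem_plane {i : Fin 4} {z : E} :
    z ∈ f.plane i ↔ ∀ s : Fin 4 → ℤ, s i = 0 → z ∈ f.lat s := by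
  rw [plane, Submodule.mem_span_pair]
  constructor
  · rintro ⟨c, d, rfl⟩ s hs
    refine Submodule.add_mem _ (Submodule.smul_mem _ _ ?_) (Submodule.smul_mem _ _ ?_)
    · simpa [hs] using f.smul_basis_mem_lat s i
    · simpa [hs] using f.smul_basis_mem_lat' s i
  · intro h
    have h0 : ∀ j, j ≠ i → f.a j z = 0 ∧ f.b j z = 0 := by
      intro j hj
      constructor
      · refine eq_zero_of_forall_zpow_mul_mem fun n => ?_
        have := (h (Pi.single j (-2 * n)) (by simp [hj.symm]) j).1
        rwa [Pi.single_eq_same, show -((-2 * n + 1) / 2) = n by omega] at this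
      · refine eq_zero_of_forall_zpow_mul_mem fun n => ?_
        have := (h (Pi.single j (-2 * n)) (by simp [hj.symm]) j).2
        rwa [Pi.single_eq_same, show -(-2 * n / 2) = n by omega] at this
    obtain ⟨⟨c, hc⟩, ⟨d, hd⟩⟩ := (h 0 rfl) i
    simp only [Pi.zero_apply, zero_add, Int.zero_ediv, neg_zero, zpow_zero, one_mul] at hc hd
    norm_num at hc
    refine ⟨c, d, ?_⟩
    rw [witt_smul_eq, witt_smul_eq, hc, hd]
    conv_rhs => rw [← f.vec_coord z, vec]
    rw [Finset.sum_eq_single i]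
    · intro j _ hj
      rw [(h0 j hj).1, (h0 j hj).2, zero_smul, zero_smul, add_zero]
    · intro hi
      exact absurd (Finset.mem_univ i) hi

theorem iSup_frobPow_plane (r : Fin 4 → ℤ) : ⨆ i, frobPow p k (r i) (f.plane i) = f.lat r := by
  apply le_antisymm
  · refine iSup_le fun i => ?_
    rintro _ ⟨w, hw, rfl⟩
    have := (f.frob_zsmul_mem_lat (r i)).2 (f.mem_plane.1 hw (fun j => r j - r i) (by simp))
    simpa using this
  · intro z hz
    rw [← f.vec_coord z, vec]
    refine Submodule.sum_mem _ fun i _ => Submodule.mem_iSup_of_mem i ?_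
    obtain ⟨w, hw⟩ := (r i • frob p k (E := E)).surjective
      (f.a i z • f.basis (0, i) + f.b i z • f.basis (1, i))
    refine ⟨w, f.mem_plane.2 fun s hs => ?_, hw⟩
    rw [← f.frob_zsmul_mem_lat (r i), hw]
    intro j
    rw [map_add, map_add, map_smul, map_smul, map_smul, map_smul, a_basis, a_basis', b_basis,
      b_basis']
    rcases eq_or_ne i j with rfl | hj
    · simpa [hs] using hz i
    · simp [hj]

theorem iSup_plane : ⨆ i, f.plane i = N := by
  have h := f.iSup_frobPow_plane 0
  rw [f.lat_zero] at h
  refine Eq.trans (iSup_congr fun i => ?_) h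
  ext z
  constructor
  · exact fun hz => ⟨z, hz, by simp⟩
  · rintro ⟨w, hw, rfl⟩
    simpa using hw

theorem apply_eq_zero_of_mem_plane {i j : Fin 4} (hij : j ≠ i) {z : E} (hz : z ∈ f.plane i) :
    f.a j z = 0 ∧ f.b j z = 0 := by
  rw [plane, Submodule.mem_span_pair] at hz
  obtain ⟨c, d, rfl⟩ := hz
  rw [witt_smul_eq, witt_smul_eq]
  simp [a_basis, a_basis', b_basis, b_basis', hij.symm]

theorem iSupIndep_plane : iSupIndep f.plane := by
  intro i
  rw [Submodule.disjoint_def]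
  intro z hz hz'
  have h : (⨆ j, ⨆ (_ : j ≠ i), f.plane j) ≤
      ((LinearMap.ker (f.a i)).restrictScalars (WittVector p k)) ⊓
        ((LinearMap.ker (f.b i)).restrictScalars (WittVector p k)) := by
    refine iSup₂_le fun j hj w hw => ?_
    exact f.apply_eq_zero_of_mem_plane hj.symm hw
  obtain ⟨h1, h2⟩ := h hz'
  refine f.ext_coord (fun j => ?_) fun j => ?_
  · rw [map_zero]
    rcases eq_or_ne j i with rfl | hj
    · exact h1
    · exact (f.apply_eq_zero_of_mem_plane hj hz).1
  · rw [map_zero]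
    rcases eq_or_ne j i with rfl | hj
    · exact h2
    · exact (f.apply_eq_zero_of_mem_plane hj hz).2

variable (hφ : IsPairing p k φ) (hsymm : ∀ x y : E, φ x y = φ y x)
include hφ hsymm

theorem isNormalPlane_plane (i : Fin 4) : IsNormalPlane p k φ (f.plane i) := by
  refine ⟨f.basis (0, i), f.basis (1, i), f.frob_basis i, ?_, ?_, rfl, f.n i, ?_⟩
  · rw [(psi_eq_self_iff_ver p k _).1 (f.psi_basis i), f.frob_basis]
  · have h1 := (LinearIndependent.restrict_scalars (R := WittVector p k) (by
      intro c d h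
      refine algebraMap_witt_injective ?_
      rwa [Algebra.algebraMap_eq_smul_one, Algebra.algebraMap_eq_smul_one])
      f.basis.linearIndependent).comp (fun j : Fin 2 => (j, i)) fun _ _ h => (Prod.ext_iff.1 h).1
    convert h1 using 1
    funext j
    fin_cases j <;> rfl
  · have hy : φ (f.basis (1, i)) (f.basis (1, i)) = p * σ (φ (f.basis (0, i)) (f.basis (0, i))) := by
      rw [← f.frob_basis, hφ.frob_frob]
    rw [hy]
    rcases f.cases i with ⟨-, -, hal, hbe⟩ | ⟨-, hbe, hal⟩
    · rw [al] at hal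
      rw [be] at hbe
      exact Or.inl ⟨hal, by rw [hal, map_zero, mul_zero], hbe⟩
    · rw [al] at hal
      rw [be] at hbe
      obtain ⟨e, he⟩ := f.eps_mem i
      have hfix := f.eps_fixed i
      have hred := f.eps_red i
      rw [← he, red_algebraMap] at hred
      rw [← he, frobenius_algebraMap, frobenius_algebraMap] at hfix
      have hfix' := algebraMap_witt_injective hfix
      obtain ⟨u, rfl⟩ := isUnit_of_constantCoeff_ne_zero hred
      have hfixinv : WittVector.frobenius (WittVector.frobenius (↑u⁻¹ : WittVector p k)) = ↑u⁻¹ := by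
        apply u.isUnit.mul_left_cancel
        conv_lhs => rw [← hfix', ← map_mul, ← map_mul, Units.mul_inv, map_one, map_one]
        rw [Units.mul_inv]
      refine Or.inr ⟨hbe, ⟨⟨(u : WittVector p k), hfix'⟩, ⟨↑u⁻¹, hfixinv⟩,
        Subtype.ext (Units.mul_inv u), Subtype.ext (Units.inv_mul u)⟩, ?_, ?_⟩
      · rw [hal, he]
      · rw [hal, ← he, map_mul, map_zpow₀, frobenius_p, frobenius_algebraMap,
          zpow_add_one₀ p_ne_zero]
        ring

/-- The summands of a frame, in any order, form a diagonalization. -/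
theorem isDiagonalization (π : Equiv.Perm (Fin 4)) :
    IsDiagonalization p k φ N (fun i => f.plane (π i)) where
  normal i := f.isNormalPlane_plane hφ hsymm (π i)
  orthogonal := by
    intro i j hij z hz w hw
    rw [f.form_eq hφ hsymm]
    refine Finset.sum_eq_zero fun l _ => ?_
    by_cases hl : l = π i
    · have h := f.apply_eq_zero_of_mem_plane
        (fun h => hij (π.injective (hl.symm.trans h)) : l ≠ π j) hw
      rw [h.1, h.2]
      ring
    · have h := f.apply_eq_zero_of_mem_plane hl hz
      rw [h.1, h.2]
      ring
  independent := f.iSupIndep_plane.comp π.injective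
  iSup_eq := (π.iSup_comp (g := f.plane)).trans f.iSup_plane

end Frame

variable (hφ : IsPairing p k φ) (hsymm : ∀ x y : E, φ x y = φ y x)
include hφ hsymm

/-- A diagonalization comes from a frame. -/
theorem IsDiagonalization.exists_frame {N : Submodule (WittVector p k) E}
    (hN : Submodule.span K(p, k) (N : Set E) = ⊤) {P : Fin 4 → Submodule (WittVector p k) E}
    (h : IsDiagonalization p k φ N P) : ∃ f : Frame p k φ N, ∀ i, f.plane i = P i := by
  choose x y hxy hver _ hspan n hn using h.normal
  have hxP : ∀ i, x i ∈ P i := fun i => by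
    rw [← hspan]; exact Submodule.subset_span (by simp)
  have hyP : ∀ i, y i ∈ P i := fun i => by
    rw [← hspan]; exact Submodule.subset_span (by simp)
  obtain ⟨f, hf⟩ := SymmDieudonne.exists_frame hφ hsymm (N := N) (x := x) (by
      intro i
      refine ⟨(psi_eq_self_iff_ver p k _).2 (by rw [hver, hxy]), n i, ?_⟩
      rcases hn i with ⟨h1, h2, h3⟩ | ⟨h1, ε, h2, h3⟩
      · exact Or.inl ⟨h1, by rw [hxy, h3]⟩
      · refine Or.inr ⟨algebraMap (WittVector p k) K(p, k) (ε : quadSubring p k),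
          by rw [hxy, h1], h2, ⟨_, rfl⟩, ?_, ?_⟩
        · rw [red_algebraMap]
          have h4 : IsUnit (((ε : quadSubring p k) : WittVector p k)) :=
            ε.isUnit.map (quadSubring p k).subtype
          exact (h4.map WittVector.constantCoeff).ne_zero
        · rw [frobenius_algebraMap, frobenius_algebraMap]
          exact congrArg _ (ε : quadSubring p k).2)
    (fun i j hij => ⟨h.orthogonal i j hij _ (hxP i) _ (hxP j),
      h.orthogonal i j hij _ (hxP i) _ (by rw [hxy]; exact hyP j)⟩)
    (by
      rw [← h.iSup_eq]
      apply le_antisymm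
      · rw [Submodule.span_le]
        rintro _ (⟨i, rfl⟩ | ⟨i, rfl⟩)
        · exact Submodule.mem_iSup_of_mem i (hxP i)
        · change frob p k (x i) ∈ _
          rw [hxy]
          exact Submodule.mem_iSup_of_mem i (hyP i)
      · refine iSup_le fun i => ?_
        rw [← hspan, Submodule.span_le]
        rintro _ (rfl | rfl)
        · exact Submodule.subset_span (Or.inl ⟨i, rfl⟩)
        · exact Submodule.subset_span (Or.inr ⟨i, hxy i⟩)) hN
  refine ⟨f, fun i => ?_⟩
  rw [Frame.plane, ← f.frob_basis, hf, hxy, hspan]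

/-- The dual Nᵗ determines the exponents in ⨁ F^{rᵢ}Nᵢ, so the given integers agree with those of
the frame. -/
theorem HasType.exists_frame {M : Submodule (WittVector p k) E}
    (hN : Submodule.span K(p, k) (upperS p k M : Set E) = ⊤)
    {P : Fin 4 → Submodule (WittVector p k) E} {r : Fin 4 → ℤ} (h : HasType p k φ M P r) :
    ∃ f : Frame p k φ (upperS p k M), f.r = r := by
  obtain ⟨f, hf⟩ := h.diag.exists_frame hφ hsymm hN
  refine ⟨f, f.lat_injective ?_⟩
  rw [← f.dual_eq_lat hφ hsymm, h.dual_eq, ← f.iSup_frobPow_plane]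
  simp only [hf]

/-- Existence of a decomposition of `S⁰(M)`, and of its type. -/
theorem exists_hasType (hp : p ≠ 2) (hss : IsSupersingular p k E)
    {M : Submodule (WittVector p k) E} (hfg : M.FG)
    (hspan : Submodule.span K(p, k) (M : Set E) = ⊤) (hperf : dual p k φ M = M)
    [FiniteDimensional K(p, k) E] (hrank : Module.finrank K(p, k) E = 8) :
    ∃ P r, HasType p k φ M P r := by
  have hN := upperS_isSuperspecial hss hfg hspan
  obtain ⟨a, ha⟩ := exists_pow_smul_mem hspan hN.fg
  obtain ⟨ι, hι, x, hx, hort, hx'⟩ := exists_normal_family hφ hsymm hp _ (upperS p k M) le_rfl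
    (span_fixed_eq _ hN.fg hN.psi_mem_iff) hN.frob_mem
    (fun x _ h => eq_zero_of_forall_eq_zero hsymm hfg hperf fun y => by
      obtain ⟨m, hm⟩ := exists_pow_smul_mem_single hN.span_eq_top y
      have := h _ hm
      rw [map_smul, smul_eq_mul] at this
      exact (mul_eq_zero.1 this).resolve_left (pow_ne_zero _ p_ne_zero))
    ⟨2 * a, fun x hx y hy => by
      have h1 : (p : K(p, k)) ^ a • y ∈ dual p k φ M := by
        rw [hperf]
        exact ha y hy
      have h2 := h1 _ (ha x hx)
      rw [map_smul, map_smul, LinearMap.smul_apply, smul_eq_mul, smul_eq_mul, ← mul_assoc,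
        ← pow_add] at h2
      rw [two_mul, ← Nat.cast_add, zpow_natCast]
      exact h2⟩
  have hcard : Fintype.card ι = 4 := by
    have hB := Module.finrank_eq_card_basis (Module.Basis.mk
      (linearIndependent_of_isNormalVec hφ hsymm hx hort) (span_pair_eq_top hx' hN.span_eq_top))
    rw [hrank, Fintype.card_prod, Fintype.card_fin] at hB
    omega
  let e : Fin 4 ≃ ι := (Fintype.equivFinOfCardEq hcard).symm
  obtain ⟨f, -⟩ := SymmDieudonne.exists_frame hφ hsymm (N := upperS p k M) (x := x ∘ e)
    (fun i => hx (e i)) (fun i j hij => hort _ _ fun h => hij (e.injective h))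
    (by
      rw [← hx', e.surjective.range_comp]
      congr 2
      exact e.surjective.range_comp fun i => frob p k (x i)) hN.span_eq_top
  refine ⟨fun i => f.plane (Tuple.sort f.r i), fun i => f.r (Tuple.sort f.r i),
    f.isDiagonalization hφ hsymm _, Tuple.monotone_sort f.r,
    lowerS_eq_dual_upperS hsymm hφ hss hfg hspan hperf, ?_⟩
  rw [f.dual_eq_lat hφ hsymm, ← f.iSup_frobPow_plane]
  exact ((Tuple.sort f.r).iSup_comp (g := fun i => frobPow p k (f.r i) (f.plane i))).symm

end Decompositions

end SymmDieudonne

namespace SymmDieudonne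

/-! ### The crystalline discriminant -/

section Discriminant

variable {p : ℕ} [Fact p.Prime] {k : Type*} [Field k] [IsAlgClosed k] [CharP k p]

local notation "σ" => WittVector.FractionRing.frobenius p k

theorem frobenius_baseEmb (c : K(p, ZMod p)) : σ (baseEmb p k c) = baseEmb p k c := by
  have h : (σ : K(p, k) →+* K(p, k)).comp (baseEmb p k) = baseEmb p k := by
    refine IsLocalization.ringHom_ext (nonZeroDivisors (WittVector p (ZMod p))) ?_
    ext w
    have h1 : baseEmb p k (algebraMap _ _ w) = algebraMap (WittVector p k) K(p, k)
        (WittVector.map (ZMod.castHom (dvd_refl p) k) w) := by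
      rw [baseEmb, IsFractionRing.map]
      exact IsLocalization.map_eq _ _
    rw [RingHom.comp_apply, RingHom.comp_apply, RingHom.comp_apply, h1]
    refine (frobenius_algebraMap _).trans (congrArg _ ?_)
    ext n
    rw [WittVector.coeff_frobenius_charP, WittVector.map_coeff, ← map_pow, ZMod.pow_card]
  exact congrArg (fun g : K(p, ZMod p) →+* K(p, k) => g c) h

variable {E : Type*} [AddCommGroup E] [WittVector.Isocrystal p k E]
variable [Module (WittVector p k) E] [IsScalarTower (WittVector p k) K(p, k) E]
variable {φ : LinearMap.BilinForm K(p, k) E}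

/-- By semilinearity the change-of-basis matrix enters twisted by σ. Hence, when F has the same
nonzero determinant in both bases, the determinant of that matrix is fixed by σ. -/
theorem toMatrix_frob {ι : Type*} [Fintype ι] [DecidableEq ι] (g b : Module.Basis ι K(p, k) E) :
    g.toMatrix (fun i => frob p k (b i)) =
      g.toMatrix (fun i => frob p k (g i)) * (g.toMatrix b).map σ := by
  ext i j
  rw [Module.Basis.toMatrix_apply, Matrix.mul_apply]
  conv_lhs => rw [← g.sum_repr (b j), map_sum, map_sum, Finsupp.finsetSum_apply]
  refine Finset.sum_congr rfl fun l _ => ?_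
  rw [frob_smul', map_smul, Finsupp.smul_apply, smul_eq_mul, mul_comm, Matrix.map_apply,
    Module.Basis.toMatrix_apply, Module.Basis.toMatrix_apply]

/-- The Gram determinants with respect to two bases in which `F` has the same determinant differ by
the square of an element of `K(k)` fixed by the Frobenius. -/
theorem exists_gram_det_eq {ι : Type*} [Fintype ι] [DecidableEq ι]
    (g b : Module.Basis ι K(p, k) E) {c : K(p, k)} (hc : c ≠ 0)
    (hg : g.det (fun i => frob p k (g i)) = c) (hb : b.det (fun i => frob p k (b i)) = c) :
    ∃ h : K(p, k), σ h = h ∧ (Matrix.of fun i j => φ (g i) (g j)).det =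
      h ^ 2 * (Matrix.of fun i j => φ (b i) (b j)).det := by
  have h1 := congrArg Matrix.det (toMatrix_frob g b)
  rw [← Module.Basis.toMatrix_mul_toMatrix (b' := b), Matrix.det_mul, Matrix.det_mul,
    ← Module.Basis.det_apply, ← Module.Basis.det_apply, ← Module.Basis.det_apply, hg, hb,
    mul_comm] at h1
  have h2 : σ (g.det b) = g.det b := by
    refine (mul_left_cancel₀ hc (h1.trans ?_)).symm
    rw [Module.Basis.det_apply]
    congr 1
    exact ((σ : K(p, k) →+* K(p, k)).map_det _).symm
  have h3 : (Matrix.of fun i j => φ (b i) (b j)) = (g.toMatrix b).transpose *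
      (Matrix.of fun i j => φ (g i) (g j)) * g.toMatrix b := by
    have := LinearMap.BilinForm.toMatrix_mul_basis_toMatrix (b := g) b φ
    refine Eq.trans ?_ (this.symm.trans ?_)
    · ext i j; rw [LinearMap.BilinForm.toMatrix_apply]; rfl
    · congr 2; ext i j; rw [LinearMap.BilinForm.toMatrix_apply]; rfl
  have h4 : g.det b ≠ 0 := (g.isUnit_det b).ne_zero
  refine ⟨(g.det b)⁻¹, by rw [map_inv₀, h2], ?_⟩
  rw [h3, Matrix.det_mul, Matrix.det_mul, Matrix.det_transpose, ← Module.Basis.det_apply]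
  field_simp

namespace Frame

variable {N : Submodule (WittVector p k) E} (f : Frame p k φ N)

/-- Each of the four planes contributes −p, so the basis of a frame is admissible for computing the
crystalline discriminant. -/
theorem det_frob : f.basis.det (fun j => frob p k (f.basis j)) = (p : K(p, k)) ^ 4 := by
  have h : f.basis.toMatrix (fun j => frob p k (f.basis j)) =
      Matrix.blockDiagonal fun _ : Fin 4 => !![0, (p : K(p, k)); 1, 0] := by
    ext ⟨i, l⟩ ⟨j, m⟩
    rw [Module.Basis.toMatrix_apply, Matrix.blockDiagonal_apply]
    fin_cases j
    · change f.basis.repr (frob p k (f.basis (0, m))) (i, l) = _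
      rw [f.frob_basis]
      fin_cases i
      · simp
      · exact (f.b_basis' l m).trans (by simp [eq_comm])
    · change f.basis.repr (frob p k (f.basis (1, m))) (i, l) = _
      rw [← f.frob_basis, frob_frob_of_psi p k (f.psi_basis m)]
      fin_cases i
      · refine ((f.a l).map_smul _ _).trans ?_
        rw [f.a_basis]
        simp [eq_comm]
      · simp
  rw [Module.Basis.det_apply, h, Matrix.det_blockDiagonal]
  simp only [Matrix.det_fin_two_of, Fin.prod_univ_four]
  ring

variable (hφ : IsPairing p k φ) (hsymm : ∀ x y : E, φ x y = φ y x)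
include hφ hsymm

theorem det_gram : (Matrix.of fun i j => φ (f.basis i) (f.basis j)).det =
    ∏ i, (f.al i * (p * σ (f.al i)) - f.be i * f.be i) := by
  have h : (Matrix.of fun i j => φ (f.basis i) (f.basis j)) = Matrix.blockDiagonal fun i : Fin 4 =>
      !![f.al i, f.be i; f.be i, p * σ (f.al i)] := by
    ext ⟨i, l⟩ ⟨j, m⟩
    rw [Matrix.of_apply, f.form_eq hφ hsymm, Matrix.blockDiagonal_apply]
    split_ifs with hlm
    · subst hlm
      rw [Finset.sum_eq_single l]
      · fin_cases i <;> fin_cases j <;> simp [a_basis, a_basis', b_basis, b_basis']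
      · intro n _ hn
        fin_cases i <;> fin_cases j <;> simp [a_basis, a_basis', b_basis, b_basis', hn.symm]
      · simp
    · refine Finset.sum_eq_zero fun n _ => ?_
      by_cases hn : l = n
      · subst hn
        fin_cases i <;> fin_cases j <;>
          simp [a_basis, a_basis', b_basis, b_basis', Ne.symm hlm]
      · fin_cases i <;> fin_cases j <;> simp [a_basis, a_basis', b_basis, b_basis', hn]
  rw [h, Matrix.det_blockDiagonal]
  simp only [Matrix.det_fin_two_of]

/-- A block of the first type contributes −p^(2n) with r = −2n, one of the second type εσ(ε)p^(2n+1)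
with r = −2n − 1. The sign and exponent in terms of r cover both. -/
theorem gram_block (i : Fin 4) : f.al i * (p * σ (f.al i)) - f.be i * f.be i =
    (-1) ^ (f.r i + 1) * (f.ε i * σ (f.ε i)) * (p : K(p, k)) ^ (-f.r i) := by
  have hp0 : (p : K(p, k)) ≠ 0 := p_ne_zero
  rcases f.cases i with ⟨hr, he, hal, hbe⟩ | ⟨hr, hbe, hal⟩
  · rw [hal, hbe, he, map_one, zero_mul, hr, Odd.neg_one_zpow ⟨-f.n i, by ring⟩, ← zpow_add₀ hp0,
      show -(-2 * f.n i) = f.n i + f.n i by ring]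
    ring
  · rw [hal, hbe, hr, Even.neg_one_zpow ⟨-f.n i, by ring⟩, map_mul, map_zpow₀, frobenius_p,
      show -(-2 * f.n i - 1) = f.n i + f.n i + 1 by ring, zpow_add_one₀ hp0, zpow_add₀ hp0]
    ring

/-- The Gram determinant of the frame is the square of a σ-fixed element. Its valuation shows that ∑
rᵢ is even; its unit part shows that the norm of ∏ εᵢ reduces to a square in 𝔽_p, and an element of
𝔽_{p²} whose norm is such a square is itself a square. -/
theorem disc (hdisc : IsCrisDisc p k 4 φ 1) :
    Even (∑ i, f.r i) ∧ ∃ d : k, d ^ 2 = ∏ i, red (f.ε i) ∧ d ^ p ^ 2 = d := by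
  have hp0 : (p : K(p, k)) ≠ 0 := p_ne_zero
  obtain ⟨h, hσ, hh⟩ : ∃ h : K(p, k), σ h = h ∧
      (Matrix.of fun i j => φ (f.basis i) (f.basis j)).det = h ^ 2 := by
    obtain ⟨b, hb, c, hc, hgram⟩ := hdisc
    obtain ⟨e, rfl⟩ := (QuotientGroup.eq_one_iff c).1 hc
    let g := f.basis.reindex (finProdFinEquiv : Fin 2 × Fin 4 ≃ Fin (2 * 4))
    have hg : g.det (fun i => frob p k (g i)) = (p : K(p, k)) ^ 4 := by
      rw [Module.Basis.det_reindex, ← f.det_frob]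
      congr 1
      funext j
      simp [g]
    obtain ⟨h, h1, h2⟩ := exists_gram_det_eq (φ := φ) g b (pow_ne_zero 4 hp0) hg hb
    refine ⟨h * baseEmb p k e, by rw [map_mul, h1, frobenius_baseEmb], ?_⟩
    have h3 : (Matrix.of fun i j => φ (g i) (g j)).det =
        (Matrix.of fun i j => φ (f.basis i) (f.basis j)).det := by
      rw [← Matrix.det_submatrix_equiv_self
        (finProdFinEquiv : Fin 2 × Fin 4 ≃ Fin (2 * 4)).symm]
      congr 1
      ext i j
      simp [g]
    rw [← h3, h2, hgram]
    simp only [powMonoidHom_apply, Units.val_pow_eq_pow_val, map_pow]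
    ring
  set D := ∏ i, f.ε i * σ (f.ε i) with hD
  set P := ∏ i, red (f.ε i) with hP
  have hDmem : ∀ i ∈ Finset.univ, f.ε i * σ (f.ε i) ∈ intRing p k := fun i _ =>
    mul_mem (f.eps_mem i) (frobenius_mem_iff.2 (f.eps_mem i))
  have hDint : D ∈ intRing p k := prod_mem hDmem
  have hDred : red D = P ^ (p + 1) := by
    obtain ⟨e, he⟩ : ∃ e : Fin 4 → WittVector p k, ∀ i, algebraMap _ _ (e i) = f.ε i :=
      ⟨fun i => (f.eps_mem i).choose, fun i => (f.eps_mem i).choose_spec⟩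
    rw [hD, hP]
    simp only [← he, frobenius_algebraMap, red_algebraMap]
    simp only [← map_mul, ← map_prod]
    rw [red_algebraMap, Finset.prod_mul_distrib, map_mul, ← map_prod, constantCoeff_frobenius]
    ring
  have hP0 : P ≠ 0 := Finset.prod_ne_zero_iff.2 fun i _ => f.eps_red i
  have hD0 : red D ≠ 0 := by
    rw [hDred]
    exact pow_ne_zero _ hP0
  have hDn : D ≠ 0 := by
    intro h0
    rw [h0, red_zero] at hD0
    exact hD0 rfl
  have hkey : h ^ 2 = (-1) ^ (∑ i, f.r i) * D * (p : K(p, k)) ^ (-∑ i, f.r i) := by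
    have h10 : (-1 : K(p, k)) ≠ 0 := by norm_num
    rw [← hh, f.det_gram hφ hsymm, Finset.prod_congr rfl fun i _ => f.gram_block hφ hsymm i,
      Finset.prod_mul_distrib, Finset.prod_mul_distrib, ← hD]
    simp only [Fin.prod_univ_four, Fin.sum_univ_four, zpow_add₀ h10, zpow_one, neg_add,
      zpow_add₀ hp0]
    ring
  have hh0 : h ≠ 0 := by
    rintro rfl
    rw [zero_pow two_ne_zero] at hkey
    exact mul_ne_zero (mul_ne_zero (zpow_ne_zero _ (by norm_num)) hDn) (zpow_ne_zero _ hp0)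
      hkey.symm
  obtain ⟨m, u, hu, hm⟩ := exists_eq_zpow_mul hh0
  have hsgn : ((-1) ^ (∑ i, f.r i) : K(p, k)) * (-1) ^ (∑ i, f.r i) = 1 := by
    rw [← zpow_add₀ (by norm_num), Even.neg_one_zpow ⟨_, rfl⟩]
  have hDeq : D = (p : K(p, k)) ^ (2 * m + ∑ i, f.r i) *
      ((-1) ^ (∑ i, f.r i) * algebraMap (WittVector p k) K(p, k) u ^ 2) := by
    have h1 : D = (-1) ^ (∑ i, f.r i) * h ^ 2 * (p : K(p, k)) ^ (∑ i, f.r i) := by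
      rw [hkey, zpow_neg]
      rw [mul_assoc, mul_assoc, inv_mul_cancel₀ (zpow_ne_zero _ hp0), mul_one, ← mul_assoc, hsgn,
        one_mul]
    rw [h1, hm, zpow_add₀ hp0, two_mul, zpow_add₀ hp0]
    ring
  have hval : 2 * m + ∑ i, f.r i = 0 := by
    obtain ⟨v, hv, hDv⟩ : ∃ v : WittVector p k, WittVector.constantCoeff v ≠ 0 ∧
        D = (p : K(p, k)) ^ (2 * m + ∑ i, f.r i) * algebraMap (WittVector p k) K(p, k) v := by
      rcases mul_self_eq_one_iff.1 hsgn with h1 | h1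
      · exact ⟨u ^ 2, by rw [map_pow]; exact pow_ne_zero 2 hu, by rw [hDeq, h1, map_pow, one_mul]⟩
      · exact ⟨-u ^ 2, by rw [map_neg, map_pow]; exact neg_ne_zero.2 (pow_ne_zero 2 hu),
          by rw [hDeq, h1, map_neg, map_pow, neg_one_mul]⟩
    rw [hDv] at hDint hD0
    rw [zpow_mul_unit_mem_iff hv] at hDint
    by_contra hne
    refine hD0 ?_
    rw [red_mul (zpow_mem hDint) (algebraMap_mem v), red_zpow_pos (by omega), zero_mul]
  have heven : Even (∑ i, f.r i) := ⟨-m, by omega⟩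
  refine ⟨heven, ?_⟩
  set c := WittVector.constantCoeff u with hc
  have hcc : (P ^ (p + 1)) = c ^ 2 := by
    rw [← hDred, hDeq, hval, zpow_zero, one_mul, heven.neg_one_zpow, one_mul, ← map_pow,
      red_algebraMap, map_pow]
  have hcp : c ^ p = c := by
    have h1 : σ (algebraMap (WittVector p k) K(p, k) u) = algebraMap (WittVector p k) K(p, k) u := by
      rw [hm, map_mul, map_zpow₀, frobenius_p] at hσ
      exact mul_left_cancel₀ (zpow_ne_zero m hp0) hσ
    have h2 := congrArg red h1
    rwa [red_frobenius (algebraMap_mem u), red_algebraMap] at h2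
  obtain ⟨d, hd⟩ := IsAlgClosed.exists_pow_nat_eq P (by norm_num : 0 < 2)
  refine ⟨d, hd, ?_⟩
  have hd0 : d ≠ 0 := by
    rintro rfl
    exact hP0 (by rw [← hd]; simp)
  have h1 : (d ^ (p + 1)) ^ 2 = c ^ 2 := by rw [← hcc, ← hd]; ring
  have h2 : (d ^ (p + 1)) ^ p = d ^ (p + 1) := by
    rcases sq_eq_sq_iff_eq_or_eq_neg.1 h1 with h3 | h3
    · rw [h3, hcp]
    · rw [h3]
      have := neg_pow_p_pow (p := p) 1 c
      rwa [pow_one, hcp] at this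
  -- As d^(p+1) = ±c lies in 𝔽_p, its p-th power is itself; cancelling d^p leaves d^(p²) = d.
  refine mul_right_cancel₀ (pow_ne_zero p hd0) ?_
  calc d ^ p ^ 2 * d ^ p = (d ^ (p + 1)) ^ p := by ring
    _ = d * d ^ p := by rw [h2]; ring

end Frame

end Discriminant

end SymmDieudonne

namespace SymmDieudonne

/-! ### Reduction modulo `p` -/

section Reduction

variable {p : ℕ} [Fact p.Prime] {k : Type*} [Field k] [IsAlgClosed k] [CharP k p]

local notation "σ" => WittVector.FractionRing.frobenius p k

theorem red_zpow_mul {m : ℤ} (hm : 0 ≤ m) {c : K(p, k)} (hc : c ∈ intRing p k) :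
    (p : K(p, k)) ^ m * c ∈ intRing p k ∧
      red ((p : K(p, k)) ^ m * c) = if m = 0 then red c else 0 := by
  refine ⟨mul_mem (zpow_mem hm) hc, ?_⟩
  split_ifs with h
  · rw [h, zpow_zero, one_mul]
  · rw [red_mul (zpow_mem hm) hc, red_zpow_pos (by omega), zero_mul]

variable {E : Type*} [AddCommGroup E] [WittVector.Isocrystal p k E]
variable [Module (WittVector p k) E] [IsScalarTower (WittVector p k) K(p, k) E]
variable {φ : LinearMap.BilinForm K(p, k) E}

namespace Frame

variable {N : Submodule (WittVector p k) E} (f : Frame p k φ N)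

/-- The coordinates along the `xᵢ`, modulo `p`. -/
def redA (z : E) : Fin 4 → k := fun i => red (f.a i z)

theorem redA_zero : f.redA 0 = 0 := funext fun i => by rw [redA, map_zero, red_zero]; rfl

variable {z w : E} (hz : z ∈ N) (hw : w ∈ N)
include hz

theorem redA_frob : f.redA (frob p k z) = 0 := by
  funext i
  rw [redA, a_frob, red_p_mul (frobenius_mem_iff.2 ((f.mem_iff' z).1 hz i).2)]
  rfl

theorem redA_psi : f.redA (psi p k z) = pw p 2 (f.redA z) := by
  funext i
  have := ((f.mem_iff' z).1 hz i).1
  rw [redA, a_psi, red_frobenius (frobenius_mem_iff.2 this), red_frobenius this, pw, redA,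
    ← pow_mul, sq]

theorem redA_smul {c : K(p, k)} (hc : c ∈ intRing p k) : f.redA (c • z) = red c • f.redA z := by
  funext i
  rw [redA, map_smul, smul_eq_mul, red_mul hc ((f.mem_iff' z).1 hz i).1]
  rfl

include hw

theorem redA_add : f.redA (z + w) = f.redA z + f.redA w := by
  funext i
  rw [redA, map_add, red_add ((f.mem_iff' z).1 hz i).1 ((f.mem_iff' w).1 hw i).1]
  rfl

theorem redA_sub : f.redA (z - w) = f.redA z - f.redA w := by
  funext i
  rw [redA, map_sub, red_sub ((f.mem_iff' z).1 hz i).1 ((f.mem_iff' w).1 hw i).1]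
  rfl

omit hz hw

include f in
theorem psi_mem_iff : psi p k z ∈ N ↔ z ∈ N := by
  have := f.psi_mem_lat (s := 0) (z := z)
  rwa [f.lat_zero] at this

include f in
theorem frob_mem (hz : z ∈ N) : frob p k z ∈ N := by
  rw [← f.lat_zero] at hz ⊢
  exact (f.lat_isSuperspecial 0).frob_mem z hz

theorem exists_redA_eq (u : Fin 4 → k) : ∃ z ∈ N, f.redA z = u := by
  choose c hc hcu using fun i => red_surjective (p := p) (u i)
  refine ⟨f.vec c 0, (f.mem_iff' _).2 fun i => ?_, funext fun i => ?_⟩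
  · rw [a_vec, b_vec]
    exact ⟨hc i, zero_mem _⟩
  · rw [redA, a_vec, hcu]

/-- The vectors of `N` whose coordinates along the `xᵢ` reduce to a vector of `S`. -/
def comap (S : Submodule k (Fin 4 → k)) : Submodule (WittVector p k) E where
  carrier := {z | z ∈ N ∧ f.redA z ∈ S}
  add_mem' := by
    rintro z w ⟨hz, hz'⟩ ⟨hw, hw'⟩
    refine ⟨N.add_mem hz hw, ?_⟩
    rw [f.redA_add hz hw]
    exact S.add_mem hz' hw'
  zero_mem' := ⟨N.zero_mem, by rw [f.redA_zero]; exact S.zero_mem⟩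
  smul_mem' := by
    rintro c z ⟨hz, hz'⟩
    refine ⟨N.smul_mem c hz, ?_⟩
    rw [witt_smul_eq, f.redA_smul hz ⟨c, rfl⟩]
    exact S.smul_mem _ hz'

theorem mem_comap {S : Submodule k (Fin 4 → k)} : z ∈ f.comap S ↔ z ∈ N ∧ f.redA z ∈ S := Iff.rfl

/-- On the coordinates modulo p, F acts as zero and ψ as the p²-Frobenius, so rational subspaces
have superspecial preimages. -/
theorem comap_isSuperspecial {S : Submodule k (Fin 4 → k)} (hS : ∀ u, pw p 2 u ∈ S ↔ u ∈ S) :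
    IsSuperspecial p k (f.comap S) := by
  have hle : f.comap S ≤ N := fun z hz => hz.1
  rw [isSuperspecial_iff]
  refine ⟨fg_of_le f.fg hle, ?_, ?_, ?_⟩
  · rw [eq_top_iff, ← f.span_lat 0, f.lat_zero, Submodule.span_le]
    intro z hz
    have h1 : (p : K(p, k)) • z ∈ f.comap S := by
      refine ⟨smul_mem_of_mem p_mem hz, ?_⟩
      have h2 : red (p : K(p, k)) = 0 := by
        have := red_p_mul (p := p) (k := k) (one_mem _)
        rwa [mul_one] at this
      rw [f.redA_smul hz p_mem, h2, zero_smul]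
      exact S.zero_mem
    rw [← inv_smul_smul₀ (p_ne_zero (p := p) (k := k)) z]
    exact Submodule.smul_mem _ _ (Submodule.subset_span h1)
  · rintro z ⟨hz, -⟩
    refine ⟨f.frob_mem hz, ?_⟩
    rw [f.redA_frob hz]
    exact S.zero_mem
  · intro z
    rw [mem_comap, mem_comap, f.psi_mem_iff]
    refine and_congr_right fun hz => ?_
    rw [f.redA_psi hz, hS]

/-- The image of a lattice in the reduction, restricted to some of the coordinates. -/
def redImage (M : Submodule (WittVector p k) E) {ι : Type*} (g : ι → Fin 4) :
    Submodule k (ι → k) where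
  carrier := {u | ∃ z ∈ M, z ∈ N ∧ f.redA z ∘ g = u}
  add_mem' := by
    rintro _ _ ⟨z, hz, hz', rfl⟩ ⟨w, hw, hw', rfl⟩
    exact ⟨z + w, M.add_mem hz hw, N.add_mem hz' hw', by rw [f.redA_add hz' hw']; rfl⟩
  zero_mem' := ⟨0, M.zero_mem, N.zero_mem, by rw [f.redA_zero]; rfl⟩
  smul_mem' := by
    rintro c _ ⟨z, hz, hz', rfl⟩
    obtain ⟨c, hc, rfl⟩ := red_surjective (p := p) c
    exact ⟨c • z, smul_mem_of_mem hc hz, smul_mem_of_mem hc hz', by rw [f.redA_smul hz' hc]; rfl⟩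

/-- If `N` is the smallest superspecial lattice containing `M`, the image of `M` is not contained
in a hyperplane defined over `𝔽_{p²}`. -/
theorem nonrational_redImage {M : Submodule (WittVector p k) E} (hMN : M ≤ N)
    (hmin : ∀ L, IsSuperspecial p k L → M ≤ L → N ≤ L) {ι : Type*} [Fintype ι] {g : ι → Fin 4}
    (hg : Function.Injective g) : Nonrational p (f.redImage M g) := by
  classical
  intro c hc hU
  let S : Submodule k (Fin 4 → k) := LinearMap.ker
    (∑ i, c i • (LinearMap.proj (g i) : (Fin 4 → k) →ₗ[k] k))
  have hS : ∀ u, u ∈ S ↔ ∑ i, c i * u (g i) = 0 := by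
    intro u
    simp [S]
  -- The preimage of a rational hyperplane containing the image of M is superspecial and contains M,
  -- hence contains N; so the linear form is zero.
  have hsup : IsSuperspecial p k (f.comap S) := by
    refine f.comap_isSuperspecial fun u => ?_
    have : ∑ i, c i * pw p 2 u (g i) = (∑ i, c i * u (g i)) ^ p ^ 2 := by
      rw [sum_pow_p_pow]
      refine Finset.sum_congr rfl fun i _ => ?_
      rw [mul_pow, hc, pw]
    rw [hS, hS, this, pow_eq_zero_iff (pow_pos (Fact.out : p.Prime).pos 2).ne']
  have hle := hmin _ hsup fun z hz => ⟨hMN hz, (hS _).2 (hU _ ⟨z, hz, hMN hz, rfl⟩)⟩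
  funext i
  obtain ⟨z, hz, hzu⟩ := f.exists_redA_eq (Pi.single (g i) 1)
  have h1 := (hS _).1 (hle hz).2
  rw [hzu, Finset.sum_eq_single i] at h1
  · simpa using h1
  · intro j _ hj
    rw [Pi.single_eq_of_ne (fun h => hj (hg h)), mul_zero]
  · intro hi
    exact absurd (Finset.mem_univ i) hi

variable (hφ : IsPairing p k φ) (hsymm : ∀ x y : E, φ x y = φ y x)
include hφ hsymm hz hw

/-- The i-th summand carries the factor p^(s+nᵢ) for the first type and p^(s+nᵢ+1) for the second.
Modulo p only planes of the first type with rᵢ = 2s survive, and they give a Hermitian form. -/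
theorem red_apply_frob {s : ℤ} (hs : ∀ i, f.r i ≤ 2 * s) :
    (p : K(p, k)) ^ s * φ z (frob p k w) ∈ intRing p k ∧
    red ((p : K(p, k)) ^ s * φ z (frob p k w)) =
      ∑ i, if f.r i = 2 * s then f.redA z i * f.redA w i ^ p else 0 := by
  have hp0 : (p : K(p, k)) ≠ 0 := p_ne_zero
  have key : ∀ i, ∃ t : K(p, k), t ∈ intRing p k ∧
      (p : K(p, k)) ^ s * (f.a i z * f.a i (frob p k w) * f.al i +
        (f.a i z * f.b i (frob p k w) + f.b i z * f.a i (frob p k w)) * f.be i +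
        f.b i z * f.b i (frob p k w) * (p * σ (f.al i))) = t ∧
      red t = if f.r i = 2 * s then f.redA z i * f.redA w i ^ p else 0 := by
    intro i
    have hsi := hs i
    obtain ⟨z1, z2⟩ := (f.mem_iff' z).1 hz i
    obtain ⟨w1, w2⟩ := (f.mem_iff' w).1 hw i
    have w1' := frobenius_mem_iff.2 w1
    have w2' := frobenius_mem_iff.2 w2
    rw [a_frob, b_frob]
    rcases f.cases i with ⟨hr, -, hal, hbe⟩ | ⟨hr, hbe, hal⟩
    · have h1 : f.a i z * σ (f.a i w) + p * (f.b i z * σ (f.b i w)) ∈ intRing p k :=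
        add_mem (mul_mem z1 w1') (mul_mem p_mem (mul_mem z2 w2'))
      obtain ⟨h2, h3⟩ := red_zpow_mul (m := s + f.n i) (by omega) h1
      refine ⟨_, h2, ?_, ?_⟩
      · rw [hal, hbe, zpow_add₀ hp0, map_zero]
        ring
      · rw [h3, red_add (mul_mem z1 w1') (mul_mem p_mem (mul_mem z2 w2')),
          red_p_mul (mul_mem z2 w2'), red_mul z1 w1', red_frobenius w1, add_zero]
        exact if_congr (by omega) rfl rfl
    · have h1 : f.ε i * (f.a i z * σ (f.b i w)) + σ (f.ε i) * (f.b i z * σ (f.a i w)) ∈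
          intRing p k := add_mem (mul_mem (f.eps_mem i) (mul_mem z1 w2'))
        (mul_mem (frobenius_mem_iff.2 (f.eps_mem i)) (mul_mem z2 w1'))
      obtain ⟨h2, h3⟩ := red_zpow_mul (m := s + f.n i + 1) (by omega) h1
      refine ⟨_, h2, ?_, ?_⟩
      · rw [hal, hbe, zpow_add_one₀ hp0, zpow_add₀ hp0, map_mul, map_zpow₀, frobenius_p]
        ring
      · rw [h3, if_neg (by omega), if_neg (by omega)]
  choose t ht1 ht2 ht3 using key
  rw [f.form_eq hφ hsymm, Finset.mul_sum, Finset.sum_congr rfl fun i _ => ht2 i]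
  refine ⟨sum_mem fun i _ => ht1 i, ?_⟩
  rw [red_sum _ _ fun i _ => ht1 i]
  exact Finset.sum_congr rfl fun i _ => ht3 i

/-- Here the factor is p^(s+1+nᵢ), and only planes of the second type with rᵢ = 2s + 1 survive, with
the quadratic form given by the εᵢ. -/
theorem red_apply {s : ℤ} (hs : ∀ i, f.r i ≤ 2 * s + 1) :
    (p : K(p, k)) ^ (s + 1) * φ z w ∈ intRing p k ∧
    red ((p : K(p, k)) ^ (s + 1) * φ z w) =
      ∑ i, if f.r i = 2 * s + 1 then red (f.ε i) * f.redA z i * f.redA w i else 0 := by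
  have hp0 : (p : K(p, k)) ≠ 0 := p_ne_zero
  have key : ∀ i, ∃ t : K(p, k), t ∈ intRing p k ∧
      (p : K(p, k)) ^ (s + 1) * (f.a i z * f.a i w * f.al i +
        (f.a i z * f.b i w + f.b i z * f.a i w) * f.be i +
        f.b i z * f.b i w * (p * σ (f.al i))) = t ∧
      red t = if f.r i = 2 * s + 1 then red (f.ε i) * f.redA z i * f.redA w i else 0 := by
    intro i
    have hsi := hs i
    obtain ⟨z1, z2⟩ := (f.mem_iff' z).1 hz i
    obtain ⟨w1, w2⟩ := (f.mem_iff' w).1 hw i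
    rcases f.cases i with ⟨hr, -, hal, hbe⟩ | ⟨hr, hbe, hal⟩
    · have h1 : f.a i z * f.b i w + f.b i z * f.a i w ∈ intRing p k :=
        add_mem (mul_mem z1 w2) (mul_mem z2 w1)
      obtain ⟨h2, h3⟩ := red_zpow_mul (m := s + 1 + f.n i) (by omega) h1
      refine ⟨_, h2, ?_, ?_⟩
      · rw [hal, hbe, zpow_add₀ hp0 (s + 1), map_zero]
        ring
      · rw [h3, if_neg (by omega), if_neg (by omega)]
    · have m1 := mul_mem (mul_mem (f.eps_mem i) z1) w1
      have m2 := mul_mem (frobenius_mem_iff.2 (f.eps_mem i)) (mul_mem z2 w2)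
      obtain ⟨h2, h3⟩ := red_zpow_mul (m := s + 1 + f.n i) (by omega)
        (add_mem m1 (mul_mem p_mem m2))
      refine ⟨_, h2, ?_, ?_⟩
      · rw [hal, hbe, zpow_add₀ hp0 (s + 1), map_mul, map_zpow₀, frobenius_p]
        ring
      · rw [h3, red_add m1 (mul_mem p_mem m2), red_p_mul m2, red_mul (mul_mem (f.eps_mem i) z1) w1,
          red_mul (f.eps_mem i) z1, add_zero]
        exact if_congr (by omega) rfl rfl
  choose t ht1 ht2 ht3 using key
  rw [f.form_eq hφ hsymm, Finset.mul_sum, Finset.sum_congr rfl fun i _ => ht2 i]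
  refine ⟨sum_mem fun i _ => ht1 i, ?_⟩
  rw [red_sum _ _ fun i _ => ht1 i]
  exact Finset.sum_congr rfl fun i _ => ht3 i

end Frame

end Reduction

/-! ### The possible types -/

section Types

variable {p : ℕ} [Fact p.Prime] {k : Type*} [Field k] [IsAlgClosed k] [CharP k p]
variable {E : Type*} [AddCommGroup E] [WittVector.Isocrystal p k E]
variable [Module (WittVector p k) E] [IsScalarTower (WittVector p k) K(p, k) E]
variable {φ : LinearMap.BilinForm K(p, k) E}

local notation "σ" => WittVector.FractionRing.frobenius p k

theorem sum_ite_eq_sum_subtype {R : Type*} [AddCommMonoid R] {ι : Type*} [Fintype ι]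
    (P : ι → Prop) [DecidablePred P] (g : ι → R) :
    ∑ i, (if P i then g i else 0) = ∑ i : {i // P i}, g i := by
  rw [← Finset.sum_filter]
  exact Finset.sum_subtype _ (by simp) g

namespace Frame

variable {N : Submodule (WittVector p k) E} (f : Frame p k φ N)
variable (hφ : IsPairing p k φ) (hsymm : ∀ x y : E, φ x y = φ y x)
variable {M : Submodule (WittVector p k) E} (hMN : M ≤ N)
  (hmin : ∀ L, IsSuperspecial p k L → M ≤ L → N ≤ L) (hperf : dual p k φ M = M)
  (hF : ∀ z ∈ M, frob p k z ∈ M)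
include hφ hsymm hMN hperf

theorem r_nonneg (i : Fin 4) : 0 ≤ f.r i := by
  refine f.le_of_lat_le (s := 0) ?_ i
  rw [f.lat_zero, ← f.dual_eq_lat hφ hsymm]
  exact ((dual_anti hMN).trans hperf.le).trans hMN

include hF

/-- φ(M, FM) is integral because M is self-dual and F-stable, so multiplying by pˢ with s > 0 kills
it modulo p. -/
theorem sum_mul_pow_eq_zero {s : ℤ} (hs : 0 < s) (hr : ∀ i, f.r i ≤ 2 * s) {z w : E} (hz : z ∈ M)
    (hw : w ∈ M) :
    (∑ i, if f.r i = 2 * s then f.redA z i * f.redA w i ^ p else 0) = 0 := by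
  have hint : φ z (frob p k w) ∈ intRing p k := by
    have h := hF w hw
    rw [← hperf] at h
    exact h z hz
  rw [← (f.red_apply_frob (hMN hz) (hMN hw) hφ hsymm hr).2, (red_zpow_mul hs.le hint).2,
    if_neg hs.ne']

/-- Since F³w = pF(ψw), one has pˢφ(z, Fψw) = pˢ⁻¹φ(z, F³w), which vanishes modulo p for s > 1.
Applying ψ raises the coordinates modulo p to the p²-th power. -/
theorem sum_mul_pow_cube_eq_zero {s : ℤ} (hs : 1 < s) (hr : ∀ i, f.r i ≤ 2 * s) {z w : E}
    (hz : z ∈ M) (hw : w ∈ M) :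
    (∑ i, if f.r i = 2 * s then f.redA z i * f.redA w i ^ p ^ 3 else 0) = 0 := by
  have hint : φ z (frob p k (frob p k (frob p k w))) ∈ intRing p k := by
    have h := hF _ (hF _ (hF w hw))
    rw [← hperf] at h
    exact h z hz
  have h1 := (f.red_apply_frob (hMN hz) (f.psi_mem_iff.2 (hMN hw)) hφ hsymm hr).2
  rw [f.redA_psi (hMN hw)] at h1
  rw [← p_smul_psi, ← frob_psi, map_smul, smul_eq_mul] at hint
  rw [show s = s - 1 + 1 by ring, zpow_add_one₀ p_ne_zero, mul_assoc,
    (red_zpow_mul (by omega) hint).2, if_neg (by omega), sub_add_cancel] at h1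
  refine Eq.trans (Finset.sum_congr rfl fun i _ => ?_) h1.symm
  rw [pw, ← pow_mul, ← pow_succ]

theorem sum_eps_mul_eq_zero {s : ℤ} (hs : 0 ≤ s) (hr : ∀ i, f.r i ≤ 2 * s + 1) {z w : E}
    (hz : z ∈ M) (hw : w ∈ M) :
    (∑ i, if f.r i = 2 * s + 1 then red (f.ε i) * f.redA z i * f.redA w i else 0) = 0 := by
  have hint : φ z w ∈ intRing p k := by
    rw [← hperf] at hw
    exact hw z hz
  rw [← (f.red_apply (hMN hz) (hMN hw) hφ hsymm hr).2, (red_zpow_mul (by omega) hint).2,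
    if_neg (by omega)]

/-- Since F²w = pψw, pˢ⁺¹φ(z, ψw) is pˢ times the integral value φ(z, F²w). -/
theorem sum_eps_mul_pow_eq_zero {s : ℤ} (hs : 0 < s) (hr : ∀ i, f.r i ≤ 2 * s + 1) {z w : E}
    (hz : z ∈ M) (hw : w ∈ M) :
    (∑ i, if f.r i = 2 * s + 1 then red (f.ε i) * f.redA z i * f.redA w i ^ p ^ 2 else 0) = 0 := by
  have hint : φ z (frob p k (frob p k w)) ∈ intRing p k := by
    have h := hF _ (hF w hw)
    rw [← hperf] at h
    exact h z hz
  rw [← p_smul_psi, map_smul, smul_eq_mul] at hint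
  have h1 := (f.red_apply (hMN hz) (f.psi_mem_iff.2 (hMN hw)) hφ hsymm hr).2
  rw [f.redA_psi (hMN hw), zpow_add_one₀ p_ne_zero, mul_assoc, (red_zpow_mul hs.le hint).2,
    if_neg hs.ne'] at h1
  exact h1.symm

theorem eps_red_pow (i : Fin 4) : red (f.ε i) ^ p ^ 2 = red (f.ε i) := by
  have h := congrArg red (f.eps_fixed i)
  rwa [red_frobenius (frobenius_mem_iff.2 (f.eps_mem i)), red_frobenius (f.eps_mem i), ← pow_mul,
    ← sq] at h

include hmin

/-- The image of M is nonrational and Hermitian isotropic, which fixes its dimension; s > 1 would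
make it isotropic for the p³-twisted form too, which is impossible. -/
theorem redImage_of_even {s : ℤ} (hs : 0 < s) (hr : ∀ i, f.r i ≤ 2 * s)
    (hne : ∃ i, f.r i = 2 * s) : s = 1 ∧ 3 ≤ Fintype.card {i // f.r i = 2 * s} ∧
      Module.finrank k (f.redImage M (Subtype.val : {i // f.r i = 2 * s} → Fin 4)) = 1 := by
  have : Nonempty {i // f.r i = 2 * s} := nonempty_subtype.2 hne
  have hcard : Fintype.card {i // f.r i = 2 * s} ≤ 4 := Fintype.card_subtype_le _
  have hnr := f.nonrational_redImage hMN hmin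
    (Subtype.val_injective : Function.Injective (Subtype.val : {i // f.r i = 2 * s} → Fin 4))
  have hU : ∀ u ∈ f.redImage M (Subtype.val : {i // f.r i = 2 * s} → Fin 4),
      ∀ v ∈ f.redImage M (Subtype.val : {i // f.r i = 2 * s} → Fin 4),
        ∑ i, u i * v i ^ p = 0 := by
    rintro _ ⟨z, hz, -, rfl⟩ _ ⟨w, hw, -, rfl⟩
    rw [← f.sum_mul_pow_eq_zero hφ hsymm hMN hperf hF hs hr hz hw, sum_ite_eq_sum_subtype]
    rfl
  refine ⟨?_, hnr.hermitian hcard hU⟩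
  by_contra hs1
  refine hnr.not_hermitian_hermitian hcard hU ?_
  rintro _ ⟨z, hz, -, rfl⟩ _ ⟨w, hw, -, rfl⟩
  rw [← f.sum_mul_pow_cube_eq_zero hφ hsymm hMN hperf hF (by omega) hr hz hw,
    sum_ite_eq_sum_subtype]
  rfl

/-- For s > 0 the image of M and its p²-twist are isotropic together, which requires all four
coordinates. The square discriminant then excludes this case. -/
theorem not_odd (hp : p ≠ 2) (hdisc : IsCrisDisc p k 4 φ 1) {s : ℤ} (hs : 0 < s)
    (hr : ∀ i, f.r i ≤ 2 * s + 1) (hne : ∃ i, f.r i = 2 * s + 1) : False := by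
  have : Nonempty {i // f.r i = 2 * s + 1} := nonempty_subtype.2 hne
  have hcard : Fintype.card {i // f.r i = 2 * s + 1} ≤ 4 := Fintype.card_subtype_le _
  have h4 := ((f.nonrational_redImage hMN hmin (Subtype.val_injective :
    Function.Injective (Subtype.val : {i // f.r i = 2 * s + 1} → Fin 4))).quadratic hcard
      (w := fun i => red (f.ε i)) (fun i => f.eps_red i)
      (fun i => f.eps_red_pow hφ hsymm hMN hperf hF i) (by
        rintro _ ⟨z, hz, -, rfl⟩ _ ⟨w, hw, -, rfl⟩
        rw [← f.sum_eps_mul_eq_zero hφ hsymm hMN hperf hF hs.le hr hz hw, sum_ite_eq_sum_subtype]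
        rfl) (by
        rintro _ ⟨z, hz, -, rfl⟩ _ ⟨w, hw, -, rfl⟩
        rw [← f.sum_eps_mul_pow_eq_zero hφ hsymm hMN hperf hF hs hr hz hw, sum_ite_eq_sum_subtype]
        rfl)).1
  have hall : ∀ i, f.r i = 2 * s + 1 := by
    rw [Fintype.card_subtype] at h4
    have h5 := (Finset.card_eq_iff_eq_univ _).1 (h4.trans (Fintype.card_fin 4).symm)
    simpa [Finset.filter_eq_self] using h5
  obtain ⟨-, d, hd, hdq⟩ := f.disc hφ hsymm hdisc
  refine (f.nonrational_redImage hMN hmin Function.injective_id).not_quaternary hp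
    (w := fun i => red (f.ε i)) (fun i => f.eps_red i)
    (fun i => f.eps_red_pow hφ hsymm hMN hperf hF i) hd hdq ?_ ?_
  · rintro _ ⟨z, hz, -, rfl⟩ _ ⟨w, hw, -, rfl⟩
    rw [← f.sum_eps_mul_eq_zero hφ hsymm hMN hperf hF hs.le hr hz hw]
    exact Finset.sum_congr rfl fun i _ => by rw [if_pos (hall i)]; rfl
  · rintro _ ⟨z, hz, -, rfl⟩ _ ⟨w, hw, -, rfl⟩
    rw [← f.sum_eps_mul_pow_eq_zero hφ hsymm hMN hperf hF hs hr hz hw]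
    exact Finset.sum_congr rfl fun i _ => by rw [if_pos (hall i)]; rfl

/-- In type (0,0,1,1) the first two units are 1, so the discriminant condition falls on the binary
form of the last two planes. Its isotropic lines are rational, whereas the image of M is not. -/
theorem not_two_odd (hp : p ≠ 2) (hdisc : IsCrisDisc p k 4 φ 1) (h0 : f.r 0 = 0) (h1 : f.r 1 = 0)
    (h2 : f.r 2 = 1) (h3 : f.r 3 = 1) : False := by
  have hle : ∀ i, f.r i ≤ 2 * 0 + 1 := by
    intro i
    fin_cases i
    · exact h0.trans_le (by norm_num)
    · exact h1.trans_le (by norm_num)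
    · exact h2.le
    · exact h3.le
  have heps : ∀ i, f.r i = 0 → f.ε i = 1 := by
    intro i hi
    rcases f.cases i with h | h
    · exact h.2.1
    · omega
  obtain ⟨-, d, hd, hdq⟩ := f.disc hφ hsymm hdisc
  rw [Fin.prod_univ_four, heps 0 h0, heps 1 h1, red_one, one_mul, one_mul] at hd
  refine (f.nonrational_redImage hMN hmin (g := ![2, 3]) (by decide)).not_binary hp
    (w := fun i => red (f.ε ((![2, 3] : Fin 2 → Fin 4) i))) (fun i => f.eps_red _)
    (fun i => f.eps_red_pow hφ hsymm hMN hperf hF _) ?_ (i := 0) (j := 1) (by decide)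
    (fun g => Fin.sum_univ_two g) hd hdq
  rintro _ ⟨z, hz, -, rfl⟩ _ ⟨w, hw, -, rfl⟩
  rw [← f.sum_eps_mul_eq_zero hφ hsymm hMN hperf hF le_rfl hle hz hw]
  simp [Fin.sum_univ_four, h0, h1, h2, h3]

/-- The possible types. -/
theorem classification (hp : p ≠ 2) (hdisc : IsCrisDisc p k 4 φ 1) (hmono : Monotone f.r) :
    f.r = ![0, 0, 0, 0] ∨ f.r = ![1, 1, 1, 1] ∨ f.r = ![0, 2, 2, 2] ∨ f.r = ![2, 2, 2, 2] := by
  have hext : ∀ a b c d : ℤ, f.r 0 = a → f.r 1 = b → f.r 2 = c → f.r 3 = d →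
      f.r = ![a, b, c, d] := by
    intro a b c d h0 h1 h2 h3
    funext i
    fin_cases i
    exacts [h0, h1, h2, h3]
  have h01 : f.r 0 ≤ f.r 1 := hmono (by decide)
  have h12 : f.r 1 ≤ f.r 2 := hmono (by decide)
  have h23 : f.r 2 ≤ f.r 3 := hmono (by decide)
  have hnn := f.r_nonneg hφ hsymm hMN hperf 0
  have hle : ∀ i, f.r i ≤ f.r 3 := fun i => hmono (by omega)
  obtain ⟨t, ht⟩ := (f.disc hφ hsymm hdisc).1
  rw [Fin.sum_univ_four] at ht
  -- The maximum is r₃. If even, it is 0, or it is 2 and occurs at least three times; if odd, it is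
  -- 1. The parity of the sum then decides the remaining entries.
  rcases Int.even_or_odd' (f.r 3) with ⟨s, hs | hs⟩
  · rcases (show 0 ≤ s by omega).eq_or_lt with rfl | hs0
    · exact Or.inl (hext _ _ _ _ (by omega) (by omega) (by omega) (by omega))
    · obtain ⟨rfl, hcard, -⟩ := f.redImage_of_even hφ hsymm hMN hmin hperf hF hs0
        (fun i => hs ▸ hle i) ⟨3, hs⟩
      have h1 : f.r 1 = 2 := by
        by_contra h1
        have h0 : f.r 0 ≠ 2 * 1 := by omega
        rw [Fintype.card_subtype, Finset.card_filter, Fin.sum_univ_four, if_neg h0,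
          if_neg (by omega)] at hcard
        split_ifs at hcard <;> omega
      have : f.r 0 = 0 ∨ f.r 0 = 2 := by omega
      rcases this with h0 | h0
      · exact Or.inr (Or.inr (Or.inl (hext _ _ _ _ h0 (by omega) (by omega) (by omega))))
      · exact Or.inr (Or.inr (Or.inr (hext _ _ _ _ h0 (by omega) (by omega) (by omega))))
  · rcases (show 0 ≤ s by omega).eq_or_lt with rfl | hs0
    · by_cases h1 : f.r 1 = 1
      · exact Or.inr (Or.inl (hext _ _ _ _ (by omega) (by omega) (by omega) (by omega)))
      · exact (f.not_two_odd hφ hsymm hMN hmin hperf hF hp hdisc (by omega) (by omega) (by omega)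
          (by omega)).elim
    · exact (f.not_odd hφ hsymm hMN hmin hperf hF hp hdisc hs0 (fun i => hs ▸ hle i) ⟨3, hs⟩).elim

end Frame

end Types

end SymmDieudonne

namespace SymmDieudonne

/-! ### Neighbours -/

section Neighbours

variable {p : ℕ} [Fact p.Prime] {k : Type*} [Field k] [IsAlgClosed k] [CharP k p]
variable {E : Type*} [AddCommGroup E] [WittVector.Isocrystal p k E]
variable [Module (WittVector p k) E] [IsScalarTower (WittVector p k) K(p, k) E]
variable {φ : LinearMap.BilinForm K(p, k) E}

local notation "σ" => WittVector.FractionRing.frobenius p k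

theorem colength_eq_one {M Q : Submodule (WittVector p k) E} {m : E} (hm : m ∈ M) (hmQ : m ∉ Q)
    (hpm : (p : K(p, k)) • m ∈ Q) (h : ∀ z ∈ M, ∃ t ∈ intRing p k, z - t • m ∈ Q) :
    colength p k M Q = 1 := by
  rw [colength, Module.length_eq_one_iff, isSimpleModule_iff_toSpanSingleton_surjective]
  constructor
  · rw [Submodule.Quotient.nontrivial_iff]
    intro htop
    have h1 : (⟨m, hm⟩ : M) ∈ (M ⊓ Q).submoduleOf M := by rw [htop]; trivial
    exact hmQ h1.2
  · intro x hx y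
    obtain ⟨⟨z, hz⟩, rfl⟩ := Submodule.Quotient.mk_surjective _ x
    obtain ⟨⟨w, hw⟩, rfl⟩ := Submodule.Quotient.mk_surjective _ y
    have hzQ : z ∉ Q := fun hzQ => hx ((Submodule.Quotient.mk_eq_zero _).2 ⟨hz, hzQ⟩)
    obtain ⟨t, ht, htz⟩ := h z hz
    obtain ⟨u, hu, huw⟩ := h w hw
    have ht0 : red t ≠ 0 := by
      intro h0
      refine hzQ ?_
      have h1 := smul_mem_of_mem ((red_eq_zero_iff ht).1 h0) hpm
      rw [smul_smul, mul_assoc, mul_comm t, inv_mul_cancel_left₀ p_ne_zero] at h1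
      have h2 := Q.add_mem htz h1
      rwa [sub_add_cancel] at h2
    have htn : t ≠ 0 := by
      rintro rfl
      exact ht0 red_zero
    obtain ⟨v, hv⟩ := mul_mem hu (inv_mem_of_red_ne_zero ht ht0)
    refine ⟨v, ?_⟩
    rw [LinearMap.toSpanSingleton_apply, ← Submodule.Quotient.mk_smul, Submodule.Quotient.eq]
    have h3 : v • z - w = (u * t⁻¹) • (z - t • m) - (w - u • m) := by
      rw [witt_smul_eq, hv, smul_sub, smul_smul, inv_mul_cancel_right₀ htn]
      abel
    have h4 : v • z - w ∈ Q := by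
      rw [h3]
      exact Q.sub_mem (smul_mem_of_mem (mul_mem hu (inv_mem_of_red_ne_zero ht ht0)) htz) huw
    exact ⟨M.sub_mem (M.smul_mem v hz) hw, h4⟩

theorem exists_of_colength_eq_one {M Q : Submodule (WittVector p k) E}
    (h : colength p k M Q = 1) : (∃ m ∈ M, m ∉ Q) ∧
      ∀ m ∈ M, m ∉ Q → ∀ z ∈ M, ∃ t ∈ intRing p k, z - t • m ∈ Q := by
  rw [colength, Module.length_eq_one_iff, isSimpleModule_iff_toSpanSingleton_surjective] at h
  obtain ⟨h1, h2⟩ := h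
  constructor
  · by_contra hcon
    push Not at hcon
    rw [Submodule.Quotient.nontrivial_iff] at h1
    refine h1 (eq_top_iff.2 ?_)
    rintro ⟨m, hm⟩ -
    exact ⟨hm, hcon m hm⟩
  · intro m hm hmQ z hz
    obtain ⟨v, hv⟩ := h2 (Submodule.Quotient.mk ⟨m, hm⟩)
      (fun h0 => hmQ ((Submodule.Quotient.mk_eq_zero _).1 h0).2) (Submodule.Quotient.mk ⟨z, hz⟩)
    rw [LinearMap.toSpanSingleton_apply, ← Submodule.Quotient.mk_smul, eq_comm,
      Submodule.Quotient.eq] at hv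
    refine ⟨_, ⟨v, rfl⟩, ?_⟩
    rw [← witt_smul_eq]
    exact hv.2

/-- A criterion for a self-dual superspecial lattice to be a neighbour of a self-dual lattice. -/
theorem IsSuperspecialNeighbour.of_exists (hsymm : ∀ x y : E, φ x y = φ y x)
    {M Q : Submodule (WittVector p k) E} (hperf : dual p k φ M = M) (hQ : IsSuperspecial p k Q)
    (hQperf : dual p k φ Q = Q) {m : E} (hm : m ∈ M) (hmQ : m ∉ Q) (hpm : (p : K(p, k)) • m ∈ Q)
    (h : ∀ z ∈ M, ∃ t ∈ intRing p k, z - t • m ∈ Q) : IsSuperspecialNeighbour p k φ M Q := by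
  refine ⟨hQ, hQperf, colength_eq_one hm hmQ hpm h, ?_⟩
  -- As M is generated by m and M ∩ Q, an x in Q lies in M exactly when φ(m, x) is integral. These
  -- values lie in p⁻¹W(k), and q is a vector where the value is not integral, so it generates Q/(M
  -- ∩ Q).
  obtain ⟨q, hq, hmq⟩ : ∃ q ∈ Q, φ m q ∉ intRing p k := by
    by_contra hcon
    push Not at hcon
    refine hmQ ?_
    rw [← hQperf]
    intro q hq
    rw [hsymm]
    exact hcon q hq
  have hmem : ∀ x ∈ Q, φ m x ∈ intRing p k → x ∈ M := by
    intro x hx hmx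
    rw [← hperf]
    intro z hz
    obtain ⟨t, ht, htz⟩ := h z hz
    have h1 : φ z x = φ (z - t • m) x + t * φ m x := by
      rw [map_sub, map_smul, LinearMap.sub_apply, LinearMap.smul_apply, smul_eq_mul]
      ring
    rw [h1]
    rw [← hQperf] at hx
    exact add_mem (hx _ htz) (mul_mem ht hmx)
  have hp : ∀ x ∈ Q, (p : K(p, k)) * φ m x ∈ intRing p k := by
    intro x hx
    rw [← hQperf] at hx
    have := hx _ hpm
    rwa [map_smul, LinearMap.smul_apply, smul_eq_mul] at this
  have hmq0 : φ m q ≠ 0 := by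
    intro h0
    rw [h0] at hmq
    exact hmq (zero_mem _)
  refine colength_eq_one hq (fun hqM => hmq ?_) (hmem _ (smul_mem_of_mem p_mem hq) ?_) ?_
  · rw [← hperf] at hqM
    exact hqM m hm
  · rw [map_smul, smul_eq_mul]
    exact hp q hq
  · intro x hx
    have ht : φ m x * (φ m q)⁻¹ ∈ intRing p k := by
      have h1 := mul_mem (hp x hx) (inv_mem_of_notMem hmq)
      rwa [show (p : K(p, k)) * φ m x * ((p : K(p, k))⁻¹ * (φ m q)⁻¹) =
        (p * (p : K(p, k))⁻¹) * (φ m x * (φ m q)⁻¹) by ring, mul_inv_cancel₀ p_ne_zero,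
        one_mul] at h1
    refine ⟨_, ht, hmem _ (Q.sub_mem hx (smul_mem_of_mem ht hq)) ?_⟩
    rw [map_sub, map_smul, smul_eq_mul, inv_mul_cancel_right₀ hmq0, sub_self]
    exact zero_mem _

theorem frobPow_one_le {M Q : Submodule (WittVector p k) E} :
    frobPow p k 1 M ≤ Q ↔ ∀ z ∈ M, frob p k z ∈ Q := by
  constructor
  · exact fun h z hz => h ⟨z, hz, by rw [one_zsmul]⟩
  · rintro h _ ⟨z, hz, rfl⟩
    rw [one_zsmul]
    exact h z hz

namespace Frame

variable {N : Submodule (WittVector p k) E} (f : Frame p k φ N)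
variable (hφ : IsPairing p k φ) (hsymm : ∀ x y : E, φ x y = φ y x)
variable {M : Submodule (WittVector p k) E} (hMN : M ≤ N)
  (hmin : ∀ L, IsSuperspecial p k L → M ≤ L → N ≤ L) (hperf : dual p k φ M = M)
  (hF : ∀ z ∈ M, frob p k z ∈ M)

theorem dual_half (hφ : IsPairing p k φ) (hsymm : ∀ x y : E, φ x y = φ y x)
    (hr : ∀ i, f.r i = 0 ∨ f.r i = 2) :
    dual p k φ (f.lat fun i => f.r i / 2) = f.lat fun i => f.r i / 2 := by
  rw [f.dual_lat hφ hsymm]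
  congr 1
  funext i
  rcases hr i with h | h <;> rw [h] <;> norm_num

theorem mem_half (hr : ∀ i, f.r i = 0 ∨ f.r i = 2) {z : E} (hz : z ∈ N) :
    (z ∈ f.lat fun i => f.r i / 2) ↔ ∀ i, f.r i = 2 → f.redA z i = 0 := by
  refine forall_congr' fun i => ?_
  obtain ⟨h1, h2⟩ := (f.mem_iff' z).1 hz i
  rcases hr i with h | h
  · simp only [h]
    norm_num
    exact ⟨h1, h2⟩
  · rw [redA, red_eq_zero_iff h1]
    simp only [h]
    norm_num
    exact fun _ _ => h2

include hφ hsymm hMN hperf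

/-- M ∩ Q is the kernel of the reduction of M onto the coordinates with rᵢ = 2. The image being a
line, M/(M ∩ Q) has length one. -/
theorem exists_neighbour_of_line (hr : ∀ i, f.r i = 0 ∨ f.r i = 2)
    (hline : Module.finrank k (f.redImage M (Subtype.val : {i // f.r i = 2} → Fin 4)) = 1) :
    (∀ z ∈ M, frob p k z ∈ f.lat fun i => f.r i / 2) ∧
      IsSuperspecialNeighbour p k φ M (f.lat fun i => f.r i / 2) := by
  constructor
  · intro z hz
    rw [f.mem_half hr (f.frob_mem (hMN hz))]
    intro i _
    rw [f.redA_frob (hMN hz)]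
    rfl
  obtain ⟨⟨_, m, hm, hmN, rfl⟩, hv0, hv⟩ := finrank_eq_one_iff'.1 hline
  refine .of_exists hsymm hperf (f.lat_isSuperspecial _) (f.dual_half hφ hsymm hr) hm ?_ ?_ ?_
  · intro h
    rw [f.mem_half hr hmN] at h
    refine hv0 (Subtype.ext (funext fun i => h i i.2))
  · rw [f.mem_half hr (smul_mem_of_mem p_mem hmN)]
    intro i _
    rw [f.redA_smul hmN p_mem, Pi.smul_apply, smul_eq_mul]
    have := red_p_mul (p := p) (k := k) (one_mem _)
    rw [mul_one] at this
    rw [this, zero_mul]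
  · intro z hz
    obtain ⟨c, hc⟩ := hv ⟨_, z, hz, hMN hz, rfl⟩
    obtain ⟨t, ht, rfl⟩ := red_surjective (p := p) c
    refine ⟨t, ht, ?_⟩
    rw [f.mem_half hr (N.sub_mem (hMN hz) (smul_mem_of_mem ht hmN))]
    intro i hi
    rw [f.redA_sub (hMN hz) (smul_mem_of_mem ht hmN), f.redA_smul hmN ht]
    have := congrFun (congrArg Subtype.val hc) ⟨i, hi⟩
    exact sub_eq_zero.2 this.symm

omit hMN hperf

/-- When all rᵢ are 1, Nᵗ = FN and pφ induces a nondegenerate quadratic form on N/FN = k⁴. Lattices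
between FN and N are subspaces there, and duality is the orthogonal complement. -/
theorem dual_comap (hr : ∀ i, f.r i = 1) (S : Submodule k (Fin 4 → k)) :
    dual p k φ (f.comap S) = f.comap (wperp (fun i => red (f.ε i)) S) := by
  have hform : ∀ {y z : E}, y ∈ N → z ∈ N → (φ y z ∈ intRing p k ↔
      ∑ i, red (f.ε i) * f.redA y i * f.redA z i = 0) := by
    intro y z hy hz
    obtain ⟨h1, h2⟩ := f.red_apply hy hz hφ hsymm (s := 0) (fun i => (hr i).le)
    simp only [hr] at h1 h2
    norm_num at h1 h2
    have h3 := red_eq_zero_iff (RingHom.mem_range.2 h1)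
    rw [h2, inv_mul_cancel_left₀ p_ne_zero] at h3
    exact h3.symm
  apply le_antisymm
  · intro z hz
    have hzN : z ∈ N := by
      have h1 : f.lat (fun _ => 1) ≤ f.comap S := by
        intro y hy
        have hyN : y ∈ N := by
          rw [← f.lat_zero]
          exact f.lat_anti (fun _ => zero_le_one) hy
        refine ⟨hyN, ?_⟩
        have h2 : f.redA y = 0 := by
          funext i
          refine red_eq_zero_of_mem ?_
          simpa using (hy i).1
        rw [h2]
        exact S.zero_mem
      have h2 := dual_anti h1 hz
      rw [f.dual_lat hφ hsymm] at h2
      simp only [hr, sub_self] at h2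
      rw [← f.lat_zero]
      exact h2
    refine ⟨hzN, fun u hu => ?_⟩
    obtain ⟨y, hy, rfl⟩ := f.exists_redA_eq u
    exact (hform hy hzN).1 (hz y ⟨hy, hu⟩)
  · rintro z ⟨hz, hz'⟩ y ⟨hy, hy'⟩
    exact (hform hy hz).2 (hz' _ hy')

theorem comap_injective {S T : Submodule k (Fin 4 → k)} (h : f.comap S = f.comap T) : S = T := by
  have key : ∀ {S T : Submodule k (Fin 4 → k)}, f.comap S ≤ f.comap T → S ≤ T := by
    intro S T h u hu
    obtain ⟨z, hz, rfl⟩ := f.exists_redA_eq u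
    exact (h ⟨hz, hu⟩ : z ∈ f.comap T).2
  exact le_antisymm (key h.le) (key h.ge)

include hMN hperf

/-- M is the preimage of a maximal isotropic subspace of k⁴. The discriminant condition makes the
form split over 𝔽_{p²}, so a rational maximal isotropic subspace meets it in a line; its preimage is
Q. -/
theorem exists_neighbour_of_one (hp : p ≠ 2) (hdisc : IsCrisDisc p k 4 φ 1)
    (hF : ∀ z ∈ M, frob p k z ∈ M) (hr : ∀ i, f.r i = 1) :
    ∃ Q, (∀ z ∈ M, frob p k z ∈ Q) ∧ IsSuperspecialNeighbour p k φ M Q := by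
  have hdualN : dual p k φ N ≤ M := (dual_anti hMN).trans hperf.le
  have hM : f.comap (f.redImage M id) = M := by
    apply le_antisymm
    · rintro z ⟨hz, m, hm, hmN, hmz⟩
      have h1 : z - m ∈ M := by
        refine hdualN ?_
        rw [f.dual_eq_lat hφ hsymm]
        intro i
        have h2 := (f.mem_iff' _).1 (N.sub_mem hz hmN) i
        have h3 : red (f.a i (z - m)) = 0 := by
          have := congrFun (f.redA_sub hz hmN) i
          rw [redA] at this
          rw [this, ← hmz]
          simp
        rw [red_eq_zero_iff h2.1] at h3
        rw [hr, show (-((1 + 1) / 2) : ℤ) = -1 by norm_num, show (-(1 / 2) : ℤ) = 0 by norm_num,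
          zpow_neg_one, zpow_zero, one_mul]
        exact ⟨h3, h2.2⟩
      have := M.add_mem h1 hm
      rwa [sub_add_cancel] at this
    · exact fun z hz => ⟨hMN hz, z, hz, hMN hz, rfl⟩
  have hU : wperp (fun i => red (f.ε i)) (f.redImage M id) = f.redImage M id := by
    refine f.comap_injective hφ hsymm ?_
    rw [← f.dual_comap hφ hsymm hr, hM, hperf]
  obtain ⟨-, d, hd, hdq⟩ := f.disc hφ hsymm hdisc
  obtain ⟨S, hS, hSperp, u, ⟨m, hm, hmN, hmu⟩, huS, hu⟩ := exists_rational_plane hp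
    (w := fun i => red (f.ε i)) (fun i => f.eps_red i)
    (fun i => f.eps_red_pow hφ hsymm hMN hperf hF i) hd hdq hU
  have hmu' : f.redA m = u := hmu
  refine ⟨f.comap S, fun z hz => ⟨f.frob_mem (hMN hz), ?_⟩, .of_exists hsymm hperf
    (f.comap_isSuperspecial hS) (by rw [f.dual_comap hφ hsymm hr, hSperp]) hm ?_ ?_ ?_⟩
  · rw [f.redA_frob (hMN hz)]
    exact S.zero_mem
  · rintro ⟨-, h⟩
    exact huS (hmu' ▸ h)
  · refine ⟨smul_mem_of_mem p_mem hmN, ?_⟩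
    have := red_p_mul (p := p) (k := k) (one_mem _)
    rw [mul_one] at this
    rw [f.redA_smul hmN p_mem, this, zero_smul]
    exact S.zero_mem
  · intro z hz
    obtain ⟨c, hc⟩ := hu _ ⟨z, hz, hMN hz, rfl⟩
    obtain ⟨t, ht, rfl⟩ := red_surjective (p := p) c
    refine ⟨t, ht, N.sub_mem (hMN hz) (smul_mem_of_mem ht hmN), ?_⟩
    rw [f.redA_sub (hMN hz) (smul_mem_of_mem ht hmN), f.redA_smul hmN ht, hmu']
    exact hc

/-- Here M = N. The neighbour is generated by an isotropic fixed vector q = p⁻¹(Fx₀ + cFx₁) and the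
sublattice R of M pairing integrally with q. -/
theorem exists_neighbour_of_zero (hr : ∀ i, f.r i = 0) :
    ∃ Q, (∀ z ∈ M, frob p k z ∈ Q) ∧ IsSuperspecialNeighbour p k φ M Q := by
  have hp0 : (p : K(p, k)) ≠ 0 := p_ne_zero
  have hdualN : dual p k φ N = N := by
    rw [f.dual_eq_lat hφ hsymm, show f.r = 0 from funext hr, f.lat_zero]
  obtain rfl : M = N := le_antisymm hMN
    (hdualN.symm.le.trans ((dual_anti hMN).trans hperf.le))
  have hform : ∀ z w, φ z w = ∑ i, (f.a i z * f.b i w + f.b i z * f.a i w) := by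
    intro z w
    rw [f.form_eq hφ hsymm]
    refine Finset.sum_congr rfl fun i _ => ?_
    have hri := hr i
    rcases f.cases i with ⟨h1, -, h2, h3⟩ | ⟨h1, -⟩
    · rw [h2, h3, show f.n i = 0 by omega, map_zero, zpow_zero]
      ring
    · omega
  -- The choice c₀^(p+1) = −1 makes φ(Fq, q) = p⁻¹(1 + cσ(c)) integral, so Fq lies in R. The same
  -- equation puts c₀ in 𝔽_{p²}, so q can be taken ψ-fixed.
  obtain ⟨c₀, hc₀⟩ := IsAlgClosed.exists_pow_nat_eq (-1 : k) (Nat.succ_pos p)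
  have hc₀0 : c₀ ≠ 0 := by
    rintro rfl
    rw [zero_pow (Nat.succ_ne_zero p)] at hc₀
    exact one_ne_zero (neg_eq_zero.1 hc₀.symm)
  have hc₀q : c₀ ^ p ^ 2 = c₀ := by
    refine mul_right_cancel₀ (pow_ne_zero p hc₀0) ?_
    have h1 := neg_pow_p_pow (p := p) (k := k) 1 1
    rw [pow_one, one_pow] at h1
    calc c₀ ^ p ^ 2 * c₀ ^ p = (c₀ ^ (p + 1)) ^ p := by ring
      _ = c₀ ^ (p + 1) := by rw [Nat.succ_eq_add_one] at hc₀; rw [hc₀, h1]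
      _ = c₀ * c₀ ^ p := by ring
  obtain ⟨c, hc, hcr, hcf⟩ := intRing_fixed_lift hc₀q
  set q : E := f.vec 0 ![(p : K(p, k))⁻¹, (p : K(p, k))⁻¹ * c, 0, 0] with hq
  have hqf : psi p k q = q := by
    refine f.ext_coord (fun i => ?_) fun i => ?_
    · rw [a_psi, hq, a_vec]
      simp
    · rw [b_psi, hq, b_vec]
      fin_cases i <;> simp [hcf]
  have hzq : ∀ z, φ z q = (p : K(p, k))⁻¹ * (f.a 0 z + c * f.a 1 z) := by
    intro z
    rw [hform, hq]
    simp only [a_vec, b_vec, Fin.sum_univ_four]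
    simp
    ring
  have hqq : φ q q = 0 := by
    rw [hzq, hq, a_vec, a_vec]
    simp
  have hFq : frob p k q ∈ M ∧ φ (frob p k q) q ∈ intRing p k := by
    have h1 : ∀ i, f.a i (frob p k q) = ![1, σ c, 0, 0] i := by
      intro i
      rw [a_frob, hq, b_vec]
      fin_cases i <;> simp [hp0]
    have h2 : ∀ i, f.b i (frob p k q) = 0 := by
      intro i
      rw [b_frob, hq, a_vec]
      simp
    have hσc := frobenius_mem_iff.2 hc
    refine ⟨(f.mem_iff' _).2 fun i => ?_, ?_⟩
    · rw [h1, h2]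
      refine ⟨?_, zero_mem _⟩
      fin_cases i
      · exact one_mem _
      · exact hσc
      · exact zero_mem _
      · exact zero_mem _
    · have h3 : 1 + c * σ c ∈ intRing p k := add_mem (one_mem _) (mul_mem hc hσc)
      rw [hzq, h1, h1]
      change (p : K(p, k))⁻¹ * (1 + c * σ c) ∈ _
      rw [← red_eq_zero_iff h3, red_add (one_mem _) (mul_mem hc hσc), red_mul hc hσc,
        red_frobenius hc, hcr, red_one, ← pow_succ']
      rw [Nat.succ_eq_add_one] at hc₀
      rw [hc₀, add_neg_cancel]
  let R : Submodule (WittVector p k) E :=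
    { carrier := {z | z ∈ M ∧ φ z q ∈ intRing p k}
      add_mem' := by
        rintro z w ⟨hz, hz'⟩ ⟨hw, hw'⟩
        refine ⟨M.add_mem hz hw, ?_⟩
        rw [map_add, LinearMap.add_apply]
        exact add_mem hz' hw'
      zero_mem' := ⟨M.zero_mem, by rw [map_zero]; exact zero_mem _⟩
      smul_mem' := by
        rintro t z ⟨hz, hz'⟩
        refine ⟨M.smul_mem t hz, ?_⟩
        rw [witt_smul_eq, map_smul, LinearMap.smul_apply]
        exact mul_mem ⟨t, rfl⟩ hz' }
  have hR : ∀ z, z ∈ R ↔ z ∈ M ∧ φ z q ∈ intRing p k := fun _ => Iff.rfl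
  have hFR : ∀ z ∈ M, frob p k z ∈ R := by
    intro z hz
    refine ⟨f.frob_mem hz, ?_⟩
    rw [hsymm, hφ.apply_frob_of_fixed hqf, frobenius_mem_iff]
    rw [← hperf] at hz
    exact hz _ hFq.1
  have hψR : ∀ z, psi p k z ∈ R ↔ z ∈ R := by
    intro z
    rw [hR, hR, f.psi_mem_iff]
    refine and_congr_right fun _ => ?_
    conv_lhs => rw [← hqf, hφ.psi_psi, frobenius_mem_iff, frobenius_mem_iff]
  have hRle : R ≤ M := fun z hz => hz.1
  have hpM : ∀ z ∈ M, (p : K(p, k)) • z ∈ R := by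
    intro z hz
    refine ⟨smul_mem_of_mem p_mem hz, ?_⟩
    have hz' := (f.mem_iff' z).1 hz
    rw [map_smul, LinearMap.smul_apply, hzq, smul_eq_mul, mul_inv_cancel_left₀ hp0]
    exact add_mem (hz' 0).1 (mul_mem hc (hz' 1).1)
  let Q := R ⊔ Submodule.span (WittVector p k) {q}
  have hQ : ∀ z, z ∈ Q ↔ ∃ r ∈ R, ∃ t ∈ intRing p k, z = r + t • q := by
    intro z
    rw [Submodule.mem_sup]
    constructor
    · rintro ⟨r, hr', y, hy, rfl⟩
      obtain ⟨t, rfl⟩ := Submodule.mem_span_singleton.1 hy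
      exact ⟨r, hr', _, ⟨t, rfl⟩, by rw [witt_smul_eq]⟩
    · rintro ⟨r, hr', t, ⟨t, rfl⟩, rfl⟩
      exact ⟨r, hr', _, Submodule.mem_span_singleton.2 ⟨t, rfl⟩, by rw [witt_smul_eq]⟩
  have hRQ : R ≤ Q := le_sup_left
  have hqQ : q ∈ Q := Submodule.mem_sup_right (Submodule.mem_span_singleton_self q)
  have hQss : IsSuperspecial p k Q := by
    rw [isSuperspecial_iff]
    refine ⟨(fg_of_le f.fg hRle).sup (Submodule.fg_span_singleton q), ?_, ?_, ?_⟩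
    · rw [eq_top_iff, ← f.span_lat 0, f.lat_zero, Submodule.span_le]
      intro z hz
      rw [← inv_smul_smul₀ hp0 z]
      exact Submodule.smul_mem _ _ (Submodule.subset_span (hRQ (hpM z hz)))
    · intro z hz
      obtain ⟨r, hr', t, ht, rfl⟩ := (hQ z).1 hz
      rw [map_add, frob_smul']
      exact hRQ (R.add_mem (hFR r (hRle hr'))
        (smul_mem_of_mem (frobenius_mem_iff.2 ht) hFq))
    · intro z
      rw [hQ, hQ]
      constructor
      · rintro ⟨r, hr', t, ht, hz⟩
        obtain ⟨r, rfl⟩ := psi_surjective p k r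
        obtain ⟨t, rfl⟩ := (σ).surjective t
        obtain ⟨t, rfl⟩ := (σ).surjective t
        refine ⟨r, (hψR r).1 hr', t, frobenius_mem_iff.1 (frobenius_mem_iff.1 ht),
          psi_injective p k ?_⟩
        rw [hz, map_add, psi_smul', hqf]
      · rintro ⟨r, hr', t, ht, rfl⟩
        exact ⟨_, (hψR r).2 hr', _, frobenius_mem_iff.2 (frobenius_mem_iff.2 ht), by
          rw [map_add, psi_smul', hqf]⟩
  set x := f.basis (0, 0) with hx
  have hxq : φ x q = (p : K(p, k))⁻¹ := by
    rw [hzq, hx, a_basis, a_basis]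
    simp
  have hxM : x ∈ M := by
    have := f.smul_basis_mem_lat 0 0
    rw [f.lat_zero] at this
    simpa using this
  have hdec : ∀ z ∈ M, ∃ t ∈ intRing p k, z - t • x ∈ R := by
    intro z hz
    have hz' := (f.mem_iff' z).1 hz
    have ht : f.a 0 z + c * f.a 1 z ∈ intRing p k := add_mem (hz' 0).1 (mul_mem hc (hz' 1).1)
    refine ⟨_, ht, M.sub_mem hz (smul_mem_of_mem ht hxM), ?_⟩
    rw [map_sub, map_smul, LinearMap.sub_apply, LinearMap.smul_apply, hxq, hzq, smul_eq_mul,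
      mul_comm, sub_self]
    exact zero_mem _
  have hQperf : dual p k φ Q = Q := by
    apply le_antisymm
    · intro z hz
      have ht := hz _ (hRQ (hpM x hxM))
      rw [map_smul, LinearMap.smul_apply, smul_eq_mul] at ht
      -- The multiple of q is chosen to make the difference orthogonal to x. Since M is generated by
      -- x and R, only the pairing with R remains to be checked.
      have h1 : z - (p * φ x z) • q ∈ M := by
        rw [← hdualN]
        intro n hn
        obtain ⟨u, hu, hun⟩ := hdec n hn
        have h2 : φ n (z - (p * φ x z) • q) = φ (n - u • x) (z - (p * φ x z) • q) := by
          have h3 : φ x (z - (p * φ x z) • q) = 0 := by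
            rw [map_sub, map_smul, hxq, smul_eq_mul, mul_right_comm, mul_inv_cancel₀ hp0, one_mul,
              sub_self]
          rw [map_sub φ n, LinearMap.sub_apply, map_smul φ, LinearMap.smul_apply, h3, smul_zero,
            sub_zero]
        rw [h2, map_sub, map_smul]
        exact sub_mem (hz _ (hRQ hun)) (mul_mem ht hun.2)
      refine (hQ z).2 ⟨_, ⟨h1, ?_⟩, _, ht, (sub_add_cancel _ _).symm⟩
      rw [map_sub, map_smul, LinearMap.sub_apply, LinearMap.smul_apply, hqq, smul_zero, sub_zero,
        hsymm]
      exact hz q hqQ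
    · intro z hz y hy
      obtain ⟨r, hr', t, ht, rfl⟩ := (hQ z).1 hz
      obtain ⟨s, hs', u, hu, rfl⟩ := (hQ y).1 hy
      have h1 : φ s r ∈ intRing p k := by
        have := hRle hr'
        rw [← hdualN] at this
        exact this s (hRle hs')
      have h2 : φ (s + u • q) (r + t • q) = φ s r + t * φ s q + u * φ r q := by
        simp only [map_add, map_smul, LinearMap.add_apply, LinearMap.smul_apply, smul_eq_mul, hqq,
          hsymm q r]
        ring
      rw [h2]
      exact add_mem (add_mem h1 (mul_mem ht hs'.2)) (mul_mem hu hr'.2)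
  refine ⟨Q, fun z hz => hRQ (hFR z hz), .of_exists hsymm hperf hQss hQperf hxM ?_
    (hRQ (hpM x hxM)) fun z hz => ?_⟩
  · intro h
    rw [← hQperf] at h
    have := h q hqQ
    rw [hsymm, hxq] at this
    exact inv_p_notMem this
  · obtain ⟨t, ht, htz⟩ := hdec z hz
    exact ⟨t, ht, hRQ htz⟩

end Frame

end Neighbours

end SymmDieudonne

namespace SymmDieudonne

/-! ### Uniqueness of the neighbour -/

section Uniqueness

variable {p : ℕ} [Fact p.Prime] {k : Type*} [Field k] [IsAlgClosed k] [CharP k p]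
variable {E : Type*} [AddCommGroup E] [WittVector.Isocrystal p k E]
variable [Module (WittVector p k) E] [IsScalarTower (WittVector p k) K(p, k) E]
variable {φ : LinearMap.BilinForm K(p, k) E}

local notation "σ" => WittVector.FractionRing.frobenius p k

/-- If `Q` is superspecial and `M / (M ∩ Q)` has length one, then `F` is nilpotent, hence zero, on
`M / (M ∩ Q)`. -/
theorem frob_mem_of_colength_eq_one {M Q : Submodule (WittVector p k) E}
    (hM : IsDieudonneLattice p k M) (hQ : IsSuperspecial p k Q) (h : colength p k M Q = 1) :
    ∀ z ∈ M, frob p k z ∈ Q := by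
  by_contra! hcon
  obtain ⟨z, hz, hzQ⟩ := hcon
  -- M/(M ∩ Q) is simple, so if F does not kill it then F is injective on it.
  have hback : ∀ x ∈ M, frob p k x ∈ Q → x ∈ Q := by
    intro x hx hFx
    by_contra hxQ
    obtain ⟨t, ht, htz⟩ := (exists_of_colength_eq_one h).2 x hx hxQ z hz
    refine hzQ ?_
    have h1 := Q.add_mem (hQ.frob_mem _ htz) (smul_mem_of_mem (frobenius_mem_iff.2 ht) hFx)
    rwa [← frob_smul', ← map_add, sub_add_cancel] at h1
  -- Because F² = pψ and Q is ψ-invariant, injectivity of F on M/(M ∩ Q) makes p injective there,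
  -- against pᵃM ⊆ Q.
  have hpow : ∀ (n : ℕ) (x : E), x ∈ M → (p : K(p, k)) ^ n • x ∈ Q → x ∈ Q := by
    intro n
    induction n with
    | zero =>
      intro x _ hx
      rwa [pow_zero, one_smul] at hx
    | succ n ih =>
      intro x hx hpx
      refine hback x hx (hback _ (hM.frob_mem x hx)
        (ih _ (hM.frob_mem _ (hM.frob_mem x hx)) ?_))
      rw [← p_smul_psi, smul_smul, ← pow_succ]
      have h1 := (hQ.psi_mem_iff _).2 hpx
      rwa [psi_smul', map_pow, map_pow, frobenius_p, frobenius_p] at h1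
  obtain ⟨a, ha⟩ := exists_pow_smul_mem hQ.span_eq_top hM.fg
  exact hzQ (hQ.frob_mem z (hpow a z hz (ha z hz)))

variable (p k) in
/-- The preimage of a lattice under `F`. -/
def frobComap (Q : Submodule (WittVector p k) E) : Submodule (WittVector p k) E where
  carrier := {z | frob p k z ∈ Q}
  add_mem' := by
    intro z w hz hw
    rw [Set.mem_ofPred_eq, map_add]
    exact Q.add_mem hz hw
  zero_mem' := by
    rw [Set.mem_ofPred_eq, map_zero]
    exact Q.zero_mem
  smul_mem' := by
    intro c z hz
    rw [Set.mem_ofPred_eq, frob_smul]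
    exact Q.smul_mem _ hz

theorem mem_frobComap {Q : Submodule (WittVector p k) E} {z : E} :
    z ∈ frobComap p k Q ↔ frob p k z ∈ Q := Iff.rfl

theorem IsSuperspecial.frobComap {Q : Submodule (WittVector p k) E} (hQ : IsSuperspecial p k Q) :
    IsSuperspecial p k (frobComap p k Q) := by
  rw [isSuperspecial_iff]
  refine ⟨fg_of_le (scale_fg (p_ne_zero (p := p) (k := k)) hQ.fg) fun z hz => ?_, ?_, ?_, ?_⟩
  · rw [mem_scale, ← ver_frob]
    exact hQ.ver_mem _ hz
  · rw [eq_top_iff, ← hQ.span_eq_top]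
    exact Submodule.span_mono fun z hz => hQ.frob_mem z hz
  · exact fun z hz => hQ.frob_mem _ hz
  · intro z
    rw [mem_frobComap, mem_frobComap, frob_psi, hQ.psi_mem_iff]

/-- σ preserves valuations, so pcσ(c) has valuation 2v(c) + 1, which is nonnegative only if v(c) is.
-/
theorem mem_of_p_mul_mul_frobenius_mem {c : K(p, k)} (hc : p * (c * σ c) ∈ intRing p k) :
    c ∈ intRing p k := by
  by_contra h
  have h0 : σ c ≠ 0 := by
    rw [Ne, map_eq_zero]
    rintro rfl
    exact h (zero_mem _)
  have h1 := mul_mem hc (inv_mem_of_notMem (a := σ c) (by rwa [frobenius_mem_iff]))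
  rw [show (p : K(p, k)) * (c * σ c) * ((p : K(p, k))⁻¹ * (σ c)⁻¹) =
    (p * (p : K(p, k))⁻¹) * (c * (σ c * (σ c)⁻¹)) by ring, mul_inv_cancel₀ p_ne_zero,
    mul_inv_cancel₀ h0, one_mul, mul_one] at h1
  exact h h1

namespace Frame

variable {N : Submodule (WittVector p k) E} (f : Frame p k φ N)
variable (hφ : IsPairing p k φ) (hsymm : ∀ x y : E, φ x y = φ y x)
include hφ hsymm

/-- F⁻¹Q is superspecial and contains M, so FN ⊆ Q and dually Q ⊆ F⁻¹Nᵗ. Where rᵢ = 2 this already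
bounds Q by FNᵢ. If r₀ = 0, integrality of φ(z, Fz) improves F⁻¹N₀ to N₀. An inclusion of self-dual
lattices is an equality. -/
theorem neighbour_eq {M Q : Submodule (WittVector p k) E} (hM : IsDieudonneLattice p k M)
    (hmin : ∀ L, IsSuperspecial p k L → M ≤ L → N ≤ L) (hr0 : f.r 0 = 0 ∨ f.r 0 = 2)
    (hr : ∀ i, i ≠ 0 → f.r i = 2) (hQ : IsSuperspecialNeighbour p k φ M Q) :
    Q = f.lat fun i => f.r i / 2 := by
  have hr' : ∀ i, f.r i = 0 ∨ f.r i = 2 := by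
    intro i
    rcases eq_or_ne i 0 with rfl | hi
    · exact hr0
    · exact Or.inr (hr i hi)
  have hNQ : N ≤ frobComap p k Q := hmin _ hQ.superspecial.frobComap
    (frob_mem_of_colength_eq_one hM hQ.superspecial hQ.left)
  have hlatQ : f.lat (fun _ => 1) ≤ Q := by
    intro z hz
    obtain ⟨y, rfl⟩ := (frob p k (E := E)).surjective z
    refine hNQ ?_
    rw [← f.lat_zero, ← f.frob_mem_lat]
    simpa using hz
  have hQlat : Q ≤ f.lat fun i => f.r i - 1 := by
    rw [← f.dual_lat hφ hsymm, ← hQ.self_dual]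
    exact dual_anti hlatQ
  have hle : Q ≤ f.lat fun i => f.r i / 2 := by
    intro z hz
    have hzl := hQlat hz
    have h2 : ∀ i, f.r i = 2 → (p : K(p, k))⁻¹ * f.a i z ∈ intRing p k ∧
        f.b i z ∈ intRing p k := by
      intro i hi
      have := hzl i
      simp only [hi] at this
      rwa [show (-((2 - 1 + 1) / 2) : ℤ) = -1 by norm_num,
        show (-((2 - 1) / 2) : ℤ) = 0 by norm_num, zpow_neg_one, zpow_zero, one_mul] at this
    have hgoal2 : ∀ i, f.r i = 2 → (p : K(p, k)) ^ (-((f.r i / 2 + 1) / 2)) * f.a i z ∈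
        intRing p k ∧ (p : K(p, k)) ^ (-(f.r i / 2 / 2)) * f.b i z ∈ intRing p k := by
      intro i hi
      rw [hi, show (-((2 / 2 + 1) / 2) : ℤ) = -1 by norm_num,
        show (-(2 / 2 / 2) : ℤ) = 0 by norm_num, zpow_neg_one, zpow_zero, one_mul]
      exact h2 i hi
    rcases hr0 with h0 | h0
    swap
    · exact fun i => hgoal2 i ((hr' i).resolve_left fun hi => by
        rcases eq_or_ne i 0 with rfl | hi'
        · omega
        · have := hr i hi'
          omega)
    have ha0 : f.a 0 z ∈ intRing p k := by
      have := (hzl 0).1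
      simp only [h0] at this
      rwa [show (-((0 - 1 + 1) / 2) : ℤ) = 0 by norm_num, zpow_zero, one_mul] at this
    have hint : φ z (frob p k z) ∈ intRing p k := by
      have := hQ.superspecial.frob_mem z hz
      rw [← hQ.self_dual] at this
      exact this z hz
    have hterm : ∀ i, i ≠ 0 → f.a i z * f.a i (frob p k z) * f.al i +
        (f.a i z * f.b i (frob p k z) + f.b i z * f.a i (frob p k z)) * f.be i +
        f.b i z * f.b i (frob p k z) * (p * σ (f.al i)) ∈ intRing p k := by
      intro i hi
      have hri := hr i hi
      obtain ⟨h3, h4⟩ := h2 i hri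
      rcases f.cases i with ⟨h5, -, hal, hbe⟩ | ⟨h5, -⟩
      · have h6 : f.a i z = p * ((p : K(p, k))⁻¹ * f.a i z) :=
          (mul_inv_cancel_left₀ p_ne_zero _).symm
        set a' := (p : K(p, k))⁻¹ * f.a i z
        rw [a_frob, b_frob, hal, hbe, show f.n i = -1 by omega, map_zero, zpow_neg_one, h6,
          map_mul, frobenius_p, show p * a' * (p * σ (f.b i z)) * 0 +
            (p * a' * (p * σ a') + f.b i z * (p * σ (f.b i z))) * (p : K(p, k))⁻¹ +
            f.b i z * (p * σ a') * (p * 0) =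
            (p * (p : K(p, k))⁻¹) * (p * (a' * σ a') + f.b i z * σ (f.b i z)) by ring,
          mul_inv_cancel₀ p_ne_zero, one_mul]
        exact add_mem (mul_mem p_mem (mul_mem h3 (frobenius_mem_iff.2 h3)))
          (mul_mem h4 (frobenius_mem_iff.2 h4))
      · omega
    -- The other planes contribute integrally to φ(z, Fz). What remains is a₀σ(a₀) + p b₀σ(b₀) with
    -- a₀ integral.
    have hb0 : f.b 0 z ∈ intRing p k := by
      refine mem_of_p_mul_mul_frobenius_mem ?_
      rw [f.form_eq hφ hsymm, ← Finset.add_sum_erase _ _ (Finset.mem_univ (0 : Fin 4))] at hint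
      have h3 := sub_mem hint (sum_mem (t := Finset.univ.erase (0 : Fin 4))
        fun i hi => hterm i (Finset.ne_of_mem_erase hi))
      rw [add_sub_cancel_right] at h3
      rcases f.cases 0 with ⟨h5, -, hal, hbe⟩ | ⟨h5, -⟩
      · rw [a_frob, b_frob, hal, hbe, show f.n 0 = 0 by omega, map_zero, zpow_zero] at h3
        have h4 := sub_mem h3 (mul_mem ha0 (frobenius_mem_iff.2 ha0))
        convert h4 using 1
        ring
      · omega
    intro i
    rcases eq_or_ne i 0 with rfl | hi
    · simp only [h0]
      norm_num
      exact ⟨ha0, hb0⟩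
    · exact hgoal2 i (hr i hi)
  refine le_antisymm hle ?_
  rw [← f.dual_half hφ hsymm hr', ← hQ.self_dual]
  exact dual_anti hle

/-- In the last two types there is exactly one neighbour. -/
theorem neighbour_of_type {M : Submodule (WittVector p k) E} (hM : IsDieudonneLattice p k M)
    (hMN : M ≤ N) (hmin : ∀ L, IsSuperspecial p k L → M ≤ L → N ≤ L)
    (hperf : dual p k φ M = M) (hr : f.r = ![0, 2, 2, 2] ∨ f.r = ![2, 2, 2, 2]) :
    ∃ Q, ((∀ z ∈ M, frob p k z ∈ Q) ∧ IsSuperspecialNeighbour p k φ M Q) ∧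
      ∀ Q', IsSuperspecialNeighbour p k φ M Q' → Q' = Q := by
  have hr0 : f.r 0 = 0 ∨ f.r 0 = 2 := by
    rcases hr with hr | hr <;> simp [hr]
  have hri : ∀ i, i ≠ 0 → f.r i = 2 := by
    intro i hi
    rcases hr with hr | hr <;> rw [hr] <;> fin_cases i <;> simp at hi ⊢
  have hr' : ∀ i, f.r i = 0 ∨ f.r i = 2 := by
    intro i
    rcases eq_or_ne i 0 with rfl | hi
    · exact hr0
    · exact Or.inr (hri i hi)
  have hline := (f.redImage_of_even hφ hsymm hMN hmin hperf hM.frob_mem zero_lt_one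
    (fun i => by rcases hr' i with h | h <;> omega) ⟨3, hri 3 (by decide)⟩).2.2
  exact ⟨_, f.exists_neighbour_of_line hφ hsymm hMN hperf hr' hline,
    fun Q' hQ' => f.neighbour_eq hφ hsymm hM hmin hr0 hri hQ'⟩

end Frame

end Uniqueness

end SymmDieudonne

end

/-! ### The main theorem. -/

open SymmDieudonne

theorem mainTheorem3 {p : ℕ} [Fact p.Prime] (hp : p ≠ 2)
    {k : Type*} [Field k] [IsAlgClosed k] [CharP k p]
    {E : Type*} [AddCommGroup E] [WittVector.Isocrystal p k E]
    [Module (WittVector p k) E] [IsScalarTower (WittVector p k) K(p, k) E]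
    (φ : LinearMap.BilinForm K(p, k) E) (hφ : SymmDieudonne.IsPairing p k φ)
    (hsymm : ∀ x y : E, φ x y = φ y x)
    (M : Submodule (WittVector p k) E) (hM : SymmDieudonne.IsDieudonneLattice p k M)
    (hss : SymmDieudonne.IsSupersingular p k E)
    (hperf : SymmDieudonne.dual p k φ M = M)
    (hrank : Module.finrank (WittVector p k) M = 8)
    (hdisc : SymmDieudonne.IsCrisDisc p k 4 φ 1) :
    (∃ P r, SymmDieudonne.HasType p k φ M P r) ∧
    (∀ P r, SymmDieudonne.HasType p k φ M P r →
      r = ![0, 0, 0, 0] ∨ r = ![1, 1, 1, 1] ∨ r = ![0, 2, 2, 2] ∨ r = ![2, 2, 2, 2]) ∧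
    (∃ Q, SymmDieudonne.frobPow p k 1 M ≤ Q ∧ SymmDieudonne.IsSuperspecialNeighbour p k φ M Q) ∧
    (∀ P r, SymmDieudonne.HasType p k φ M P r → (r = ![0, 2, 2, 2] ∨ r = ![2, 2, 2, 2]) →
      ∃! Q, SymmDieudonne.IsSuperspecialNeighbour p k φ M Q) := by
  obtain ⟨hfin, hdim⟩ : Module.Finite K(p, k) E ∧ Module.finrank K(p, k) E = 8 := by
    obtain ⟨b, -⟩ := hdisc
    exact ⟨.of_basis b, by rw [Module.finrank_eq_card_basis b, Fintype.card_fin]⟩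
  have hN := upperS_isSuperspecial hss hM.fg hM.span_eq_top
  have hMN := le_upperS (p := p) (k := k) M
  have hmin : ∀ L, IsSuperspecial p k L → M ≤ L → upperS p k M ≤ L := fun L hL h => upperS_le hL h
  have hclass : ∀ P r, HasType p k φ M P r → ∃ f : Frame p k φ (upperS p k M), f.r = r ∧
      (r = ![0, 0, 0, 0] ∨ r = ![1, 1, 1, 1] ∨ r = ![0, 2, 2, 2] ∨ r = ![2, 2, 2, 2]) := by
    intro P r h
    obtain ⟨f, rfl⟩ := h.exists_frame hφ hsymm hN.span_eq_top
    exact ⟨f, rfl, f.classification hφ hsymm hMN hmin hperf hM.frob_mem hp hdisc h.mono⟩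
  obtain ⟨P, r, hPr⟩ := exists_hasType hφ hsymm hp hss hM.fg hM.span_eq_top hperf hdim
  refine ⟨⟨P, r, hPr⟩, fun P r h => (hclass P r h).choose_spec.2, ?_, ?_⟩
  · suffices h : ∃ Q, (∀ z ∈ M, frob p k z ∈ Q) ∧ IsSuperspecialNeighbour p k φ M Q by
      obtain ⟨Q, h1, h2⟩ := h
      exact ⟨Q, frobPow_one_le.2 h1, h2⟩
    obtain ⟨f, rfl, hr | hr | hr⟩ := hclass P r hPr
    · exact f.exists_neighbour_of_zero hφ hsymm hMN hperf fun i => by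
        rw [hr]; fin_cases i <;> rfl
    · exact f.exists_neighbour_of_one hφ hsymm hMN hperf hp hdisc hM.frob_mem fun i => by
        rw [hr]; fin_cases i <;> rfl
    · obtain ⟨Q, hQ, -⟩ := f.neighbour_of_type hφ hsymm hM hMN hmin hperf hr
      exact ⟨Q, hQ⟩
  · intro P r h hr
    obtain ⟨f, rfl, -⟩ := hclass P r h
    obtain ⟨Q, hQ, huniq⟩ := f.neighbour_of_type hφ hsymm hM hMN hmin hperf hr
    exact ⟨Q, hQ.2, huniq⟩
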